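/- Let $p$ be a prime, $F_0$ a $p$-adic local field with ring of integers $\mathcal{O}$, and let $q_0$ be the cardinality of its residue field. Let $R$ be a commutative ring and $r\ge 0$ an integer. We consider three independent cases: (uH) unramified Hermitian, where $F/F_0$ is an unramified quadratic extension; (S) symmetric, where $F=F_0$, $q=q_0$, $p\neq 2$ and $2\in R^\times$; (A) alternating, where $F=F_0$, $q=q_0$. Put $\mathrm{Sign}=\{1\}$ in the cases (uH), (A), and $\mathrm{Sign}=\mathcal{O}^\times/(\mathcal{O}^\times)^2=\mathbb{F}_q^\times/(\mathbb{F}_q^\times)^2=\{\pm1\}$ in the case (S), where $\epsilon\in\mathrm{Sign}$ denotes the class of $-1$. Let $\mathrm{Typ}_r=(\mathbb{Z}\times\mathrm{Sign})^r$, and for $e\in\mathbb{Z}^r$, $\chi\in\mathrm{Sign}^r$ write $\delta(e,\chi)$ for the corresponding basis element of the free $R$-module $R[\mathrm{Typ}_r]$. Concatenation makes $R[\mathrm{Typ}]=\bigoplus_{r\ge0}R[\mathrm{Typ}_r]$ a graded ring. Let $\mathrm{Rel}\subseteq R[\mathrm{Typ}]$ be the homogeneous two-sided ideal generated by the following elements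 of degree $2$, and $\mathrm{Rel}_r=\mathrm{Rel}\cap R[\mathrm{Typ}_r]$. In the cases (uH) and (A), write $(a,b)$ for $\delta((a,b),(1,1))$. The generators are $(a,a+1)-(a+1,a)$ for $a\in\mathbb{Z}$, and, for all integers $a<b$, $$(a,b)-(a+1,b-1)-c_{b-a-1}\bigl((b,a)-(b-1,a+1)\bigr),$$ where $c_k=(-q_0)^{k}$ in the case (uH) and $c_k=q^{2k}$ in the case (A). In the case (S), identify $s\in\{\pm1\}$ with a character of $\mathrm{Sign}=\{\pm1\}$, where $s=1$ is the trivial and $s=-1$ the nontrivial one, and put $$[a,s_1;b,s_2]=\sum_{\chi_1,\chi_2\in\mathrm{Sign}}s_1(\chi_1)s_2(\chi_2)\,\delta\bigl((a,b),(\chi_1,\chi_2)\bigr),$$ $$H_s(a,b)=-[a,s;b,s]+[a-1,s;b+1,s]-\epsilon\bigl([a,-s;b,-s]-[a+1,-s;b-1,-s]\bigr).$$ The generators are, for $a,b\in\mathbb{Z}$ and $s,s_1,s_2\in\{\pm1\}$, 1. for $b-a\ge1$ odd, $\;[a,s_1;b,s_2]-[a+1,s_2;b-1,s_1]-q^{(b-a-1)/2}\bigl([b,s_2;a,s_1]-[b-1,s_1;a+1,s_2]\bigr)$;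 2. for $b-a\ge0$ even, $\;[a,s;b,-s]+q^{(b-a)/2}[b,s;a,-s]$; 3. for $b-a\ge2$ even, $\;H_s(a+1,b-1)+q^{(b-a-2)/2}H_s(b-1,a+1)$. Let $\mathrm{Typ}^0_r$ be the set of pairs $(e^0,\chi^0)$ of functions $e^0\colon\mathbb{Z}\to\mathbb{Z}_{\ge0}$ and $\chi^0\colon\mathbb{Z}\to\mathrm{Sign}$ such that $e^0$ has finite support, $\sum_i e^0(i)=r$, and $\chi^0(i)=1$ whenever $e^0(i)=0$; let $R[\mathrm{Typ}^0_r]$ be the free $R$-module on it. Then in each of the three cases there is an isomorphism of $R$-modules $$\mathrm{str}\colon R[\mathrm{Typ}_r]/\mathrm{Rel}_r\xrightarrow{\ \sim\ }R[\mathrm{Typ}^0_r]$$ such that, for every $(e,\chi)\in\mathrm{Typ}_r$ with $e_1\ge\cdots\ge e_r$, we have $\mathrm{str}(\delta(e,\chi))=(e^0,\chi^0)$, where $e^0(i)=\#\{k\colon e_k=i\}$ and $\chi^0(i)=\prod_{k\colon e_k=i}\chi_k$. Moreover, $\mathrm{str}$ is the only $R$-linear map $R[\mathrm{Typ}_r]/\mathrm{Rel}_r\to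 R[\mathrm{Typ}^0_r]$ with this property. -/

import Mathlib

namespace Straightening

/-- `Typ_r = (ℤ × Sign)^r`, for an arbitrary set of signs. -/
abbrev Typ (S : Type) (r : ℕ) : Type := Fin r → ℤ × S

/-- The noncommutative ring `R[Typ]`, where `Typ = ⨆_r Typ_r` is the monoid of finite words
in `ℤ × Sign` under concatenation. -/
abbrev TypRing (R : Type*) [CommRing R] (S : Type) := MonoidAlgebra R (FreeMonoid (ℤ × S))

/-- `Typ⁰`: pairs `(e⁰, χ⁰)` with `e⁰ : ℤ → ℤ_{≥ 0}` of finite support, `χ⁰ : ℤ → Sign` and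
`χ⁰ i = 1` whenever `e⁰ i = 0`. -/
@[ext]
structure TypZero (S : Type) [CommGroup S] where
  /-- the multiplicities -/
  e : ℤ →₀ ℕ
  /-- the signs -/
  χ : ℤ → S
  χ_eq_one : ∀ i, e i = 0 → χ i = 1

/-- `Typ⁰_r`: the elements `(e⁰, χ⁰)` of `Typ⁰` with `∑ i, e⁰ i = r`. -/
abbrev TypZeroOfRank (S : Type) [CommGroup S] (r : ℕ) : Type :=
  {t : TypZero S // (t.e.sum fun _ m => m) = r}

/-- The multiplicity / sign data of `(e, χ) ∈ Typ_r`: the pair `(e⁰, χ⁰)` with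
`e⁰ i = #{k | e_k = i}` and `χ⁰ i = ∏_{k : e_k = i} χ_k`. -/
noncomputable def typData {S : Type} [CommGroup S] {r : ℕ} (v : Typ S r) : TypZeroOfRank S r :=
  ⟨{ e := Finsupp.onFinset (Finset.univ.image fun k => (v k).1)
        (fun i => (Finset.univ.filter fun k => (v k).1 = i).card) (by
          intro i hi
          obtain ⟨k, hk⟩ := Finset.card_ne_zero.mp hi
          exact Finset.mem_image.mpr ⟨k, Finset.mem_univ k, (Finset.mem_filter.mp hk).2⟩)
     χ := fun i => ∏ k ∈ Finset.univ.filter (fun k => (v k).1 = i), (v k).2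
     χ_eq_one := by
        intro i hi
        rw [Finsupp.onFinset_apply, Finset.card_eq_zero] at hi
        rw [hi, Finset.prod_empty] }, by
    rw [Finsupp.onFinset_sum _ (fun _ => rfl)]
    rw [← Finset.card_eq_sum_card_image (fun k => (v k).1) Finset.univ, Finset.card_univ,
      Fintype.card_fin]⟩

section Relations

variable (R : Type*) [CommRing R]

/-- The inclusion `R[Typ_r] → R[Typ]` of the graded piece of degree `r`. -/
noncomputable def inclusion (S : Type) (r : ℕ) : (Typ S r →₀ R) →ₗ[R] TypRing R S :=
  Finsupp.linearCombination R fun v =>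
    MonoidAlgebra.single (FreeMonoid.ofList (List.ofFn v)) (1 : R)

/-- The degree `r` part of the two-sided ideal of `R[Typ]` generated by `gens`,
as a submodule of `R[Typ_r]`. -/
def relPart {S : Type} (gens : Set (TypRing R S)) (r : ℕ) : Submodule R (Typ S r →₀ R) where
  carrier := {x | inclusion R S r x ∈ TwoSidedIdeal.span gens}
  add_mem' := by
    intro x y hx hy
    simp only [Set.mem_ofPred_eq, map_add] at *
    exact TwoSidedIdeal.add_mem _ hx hy
  zero_mem' := by
    simp only [Set.mem_ofPred_eq, map_zero]
    exact TwoSidedIdeal.zero_mem _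
  smul_mem' := by
    intro c x hx
    simp only [Set.mem_ofPred_eq, map_smul] at *
    rw [Algebra.smul_def]
    exact TwoSidedIdeal.mul_mem_left _ _ _ hx

/-- The element `δ((a, b))` of `R[Typ_2]`, in the cases where `Sign` is trivial. -/
noncomputable def pair (a b : ℤ) : TypRing R Unit :=
  MonoidAlgebra.single (FreeMonoid.of (a, ()) * FreeMonoid.of (b, ())) 1

/-- The generators of `Rel` in the unramified Hermitian case: `Rel(a)`, and `Rel(a, b)` for
`b > a`, written as `b = a + k + 1`. Here `q₀` is the cardinality of the residue field of the
base field. -/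
def relHermitian (q₀ : ℕ) : Set (TypRing R Unit) :=
  {x | ∃ a : ℤ, x = pair R a (a + 1) - pair R (a + 1) a} ∪
  {x | ∃ (a b : ℤ) (k : ℕ), b = a + k + 1 ∧
    x = pair R a b - pair R (a + 1) (b - 1)
      - (-(q₀ : R)) ^ k • (pair R b a - pair R (b - 1) (a + 1))}

/-- The generators of `Rel` in the alternating case: `Rel(a)`, and `Rel(a, b)` for
`b > a`, written as `b = a + k + 1`. -/
def relAlternating (q : ℕ) : Set (TypRing R Unit) :=
  {x | ∃ a : ℤ, x = pair R a (a + 1) - pair R (a + 1) a} ∪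
  {x | ∃ (a b : ℤ) (k : ℕ), b = a + k + 1 ∧
    x = pair R a b - pair R (a + 1) (b - 1)
      - (q : R) ^ (2 * k) • (pair R b a - pair R (b - 1) (a + 1))}

/-- The value at `χ ∈ {±1}` of the character of `{±1}` indexed by `s ∈ {±1}`: the trivial
character for `s = 1`, the identity character for `s = -1`. -/
def signChar (s χ : ℤˣ) : ℤˣ := if s = 1 then 1 else χ

/-- The element `((a, s₁), (b, s₂))^Σ = ∑_{χ₁, χ₂} s₁(χ₁) s₂(χ₂) δ((a, χ₁), (b, χ₂))`
of `R[Typ_2]`, in the symmetric case. -/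
noncomputable def pairSigma (a : ℤ) (s₁ : ℤˣ) (b : ℤ) (s₂ : ℤˣ) : TypRing R ℤˣ :=
  ∑ χ₁ : ℤˣ, ∑ χ₂ : ℤˣ,
    MonoidAlgebra.single (FreeMonoid.of (a, χ₁) * FreeMonoid.of (b, χ₂))
      (((signChar s₁ χ₁ * signChar s₂ χ₂ : ℤˣ) : ℤ) : R)

/-- `RelHalf((a, s), (b, s))` -/
noncomputable def relHalf (ε : ℤˣ) (a b : ℤ) (s : ℤˣ) : TypRing R ℤˣ :=
  - pairSigma R a s b s + pairSigma R (a - 1) s (b + 1) s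
    - ((ε : ℤ) : R) • (pairSigma R a (-s) b (-s) - pairSigma R (a + 1) (-s) (b - 1) (-s))

/-- The generators of `Rel` in the symmetric case. The three families are
`Rel((a, s₁), (b, s₂))` for `b - a = 2 * k + 1`, `Rel((a, s), (b, -s))` for `b - a = 2 * k`,
and `Rel((a, s), (b, s))` for `b - a = 2 * k + 2`, where `k ≥ 0`. -/
def relSymmetric (q : ℕ) (ε : ℤˣ) : Set (TypRing R ℤˣ) :=
  {x | ∃ (a b : ℤ) (s₁ s₂ : ℤˣ) (k : ℕ), b = a + 2 * k + 1 ∧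
    x = pairSigma R a s₁ b s₂ - pairSigma R (a + 1) s₂ (b - 1) s₁
      - (q : R) ^ k • (pairSigma R b s₂ a s₁ - pairSigma R (b - 1) s₁ (a + 1) s₂)} ∪
  {x | ∃ (a b : ℤ) (s : ℤˣ) (k : ℕ), b = a + 2 * k ∧
    x = pairSigma R a s b (-s) + (q : R) ^ k • pairSigma R b s a (-s)} ∪
  {x | ∃ (a b : ℤ) (s : ℤˣ) (k : ℕ), b = a + 2 * k + 2 ∧
    x = relHalf R ε (a + 1) (b - 1) s + (q : R) ^ k • relHalf R ε (b - 1) (a + 1) s}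

variable {R}

/-- A linear map `R[Typ_r] / Rel_r → R[Typ⁰_r]` is a *straightening map* if it sends the class
of `δ(e, χ)` to `(e⁰, χ⁰)` whenever `e_1 ≥ ⋯ ≥ e_r`. -/
def IsStraightening {S : Type} [CommGroup S] {gens : Set (TypRing R S)} {r : ℕ}
    (f : ((Typ S r →₀ R) ⧸ relPart R gens r) →ₗ[R] (TypZeroOfRank S r →₀ R)) : Prop :=
  ∀ v : Typ S r, (Antitone fun k => (v k).1) →
    f (Submodule.Quotient.mk (Finsupp.single v 1)) = Finsupp.single (typData v) 1

end Relations

open scoped Classical in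
/-- The natural map `𝔽_q^× → 𝔽_q^× / (𝔽_q^×)² = {±1}`, for a finite field of odd order. -/
noncomputable def sign (k : Type*) [Field k] (x : kˣ) : ℤˣ := if IsSquare x then 1 else -1

end Straightening

open Straightening
open scoped ValuativeRel

/-! Decreasing words span the quotient because the relations rewrite every ascending pair in terms
of pairs that are closer to decreasing order (`wd_mem_span_sup_relIdeal`). The substance is that
nothing further collapses. This is proved over ℤ[X], with the numerical parameter replaced by X
(`hl_hasNormalForm_polynomial`, `sym_hasNormalForm_polynomial`), and then specialized by
`HasNormalForm.map` to X = -q₀, q², q in the cases (uH), (A), (S).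

For independence the quotient is represented on functions, in the manner of Hall-Littlewood
polynomials. A word a_0 ⋯ a_{r-1} becomes the monomial ∏ (V^k z_k)^{a_k} with V = v⁻¹, with
coefficients in Laurent series in v; the parameter X acts as V, and as V² in the case (S). The
operator s_i exchanges the arguments i, i + 1 and multiplies by an R-matrix: the scalar (w - vz)/(z
- vw) in the cases (uH) and (A), a matrix on pairs of colours in the case (S), where a colour is the
parity of the exponent together with a character and z carries half the exponent, rounded down.
Unitarity and the Yang-Baxter equation give the Coxeter relations for the s_i
(`IsBraided.isCoxeter_op`), hence an antisymmetrizer A with A(1 + s_i) = 0. The function of each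
generator of the relations is fixed by the exchange of its two arguments, so 2A, and then A, kills
it, and A descends to the quotient (`relIdeal_le_ker_wdAntisymm`).

At v = 0 the R-matrix merely permutes monomials, up to a shift of exponents. After this shift the
exponents of a normal word strictly decrease, and every nontrivial permutation creates an ascent, so
among normal words the matrix of leading coefficients is the identity (`wordCoeff_antisymm`).
Comparing lowest powers of v then gives independence (`eq_zero_of_linearCombination_mem_relIdeal`).

In the case (S) the relations are the Fourier transforms, over the signs, of relations between words
in characters, and the transform is invertible because 2 is a unit. There a pair with equal
exponents and opposite characters vanishes, so equal exponents of a normal word carry equal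
characters. Transformed back, this says that flipping both signs of two neighbouring letters with
the same exponent changes nothing: only the product of the signs at each exponent survives. -/

namespace Straightening

/-! ### The antisymmetrizer of a Coxeter system of type A. -/

section Antisymmetrizer

/-- `1 - s_{n-1} + s_{n-1} s_{n-2} - ⋯ ± s_{n-1} ⋯ s_0`. -/
def shuffle {A : Type*} [Ring A] (s : ℕ → A) : ℕ → A
  | 0 => 1
  | n + 1 => 1 - s n * shuffle s n

/-- The signed sum over the group generated by the involutions `s_0, …, s_{n-2}` satisfying the
braid relations. -/
def antisymm {A : Type*} [Ring A] (s : ℕ → A) : ℕ → A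
  | 0 => 1
  | n + 1 => antisymm s n * shuffle s n

/-- The Coxeter relations of the symmetric groups. -/
structure IsCoxeter {A : Type*} [Ring A] (s : ℕ → A) : Prop where
  sq : ∀ i, s i * s i = 1
  comm : ∀ i j, i + 2 ≤ j → s i * s j = s j * s i
  braid : ∀ i, s i * s (i + 1) * s i = s (i + 1) * s i * s (i + 1)

variable {A : Type*} [Ring A] {s : ℕ → A}

theorem IsCoxeter.commute_shuffle (h : IsCoxeter s) {n j : ℕ} (hj : n + 1 ≤ j) :
    shuffle s n * s j = s j * shuffle s n := by
  induction n with
  | zero => simp [shuffle]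
  | succ n ih =>
    have h1 := ih (by omega)
    have h2 := h.comm n j (by omega)
    simp only [shuffle]
    rw [sub_mul, mul_sub, mul_assoc, h1, ← mul_assoc, h2, one_mul, mul_one, mul_assoc]

/-- `shuffle s n` is the alternating sum over coset representatives of S_n in S_{n+1}, so
multiplying by it extends antisymmetry under s_0, …, s_{n-2} to antisymmetry under s_{n-1} as well.
This is the inductive step for `antisymm`. -/
theorem IsCoxeter.mul_shuffle_mul (h : IsCoxeter s) (n : ℕ) :
    ∀ a : A, (∀ j, j + 1 < n → a * (1 + s j) = 0) →
      ∀ i < n, a * shuffle s n * (1 + s i) = 0 := by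
  induction n with
  | zero => intro a _ i hi; omega
  | succ m ih =>
    intro a ha i hi
    rcases Nat.lt_succ_iff_lt_or_eq.mp hi with hi | rfl
    · have h1 : a * s m * shuffle s m * (1 + s i) = 0 := by
        apply ih _ _ i hi
        intro j hj
        have : s m * (1 + s j) = (1 + s j) * s m := by
          rw [mul_add, add_mul, h.comm j m (by omega)]; simp
        rw [mul_assoc, this, ← mul_assoc, ha j (by omega), zero_mul]
      calc a * shuffle s (m + 1) * (1 + s i)
          = a * (1 + s i) - a * s m * shuffle s m * (1 + s i) := by
            simp only [shuffle]; noncomm_ring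
        _ = 0 := by rw [h1, ha i (by omega), sub_zero]
    · rcases i with _ | m
      · have := h.sq 0
        have h2 : (1 - s 0) * (1 + s 0) = 0 := by
          rw [sub_mul, mul_add, mul_add, this]; simp only [mul_one, one_mul]; abel
        simp only [shuffle, mul_one]
        rw [mul_assoc, h2, mul_zero]
      · have hs := h.sq (m + 1)
        have hb := h.braid m
        have hc := h.commute_shuffle (n := m) (j := m + 1) le_rfl
        -- The terms 1 - s_{m+1} are killed by 1 + s_{m+1}. In the remaining term the braid relation
        -- moves this factor to the left, where it becomes 1 + s_m and is killed by a.
        have key : shuffle s (m + 2) * (1 + s (m + 1)) =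
            (1 + s m) * (s (m + 1) * s m * shuffle s m) := by
          have e1 : s (m + 1) * (s m * (shuffle s m * s (m + 1))) =
              s m * (s (m + 1) * (s m * shuffle s m)) := by
            rw [hc]
            calc s (m + 1) * (s m * (s (m + 1) * shuffle s m))
                = (s (m + 1) * s m * s (m + 1)) * shuffle s m := by simp only [mul_assoc]
              _ = s m * (s (m + 1) * (s m * shuffle s m)) := by
                rw [← hb]; simp only [mul_assoc]
          simp only [shuffle]
          simp only [mul_add, add_mul, mul_sub, sub_mul, mul_one, one_mul, mul_assoc, hs, e1]
          abel
        rw [mul_assoc, key, ← mul_assoc, ha m (by omega), zero_mul]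

theorem IsCoxeter.antisymm_mul (h : IsCoxeter s) {n i : ℕ} (hi : i + 1 < n) :
    antisymm s n * (1 + s i) = 0 := by
  induction n generalizing i with
  | zero => omega
  | succ n ih =>
    exact h.mul_shuffle_mul n (antisymm s n) (fun j hj => ih hj) i (by omega)

end Antisymmetrizer

/-! ### Leading terms of antisymmetrized families. -/

section LeadingTerm

variable {k M : Type*} [CommRing k] [AddCommGroup M] [Module k M] {s : ℕ → Module.End k M}
  {E : (ℕ → ℤ) → M}

theorem shuffle_mem_of_mapsTo {U : AddSubgroup M} {n : ℕ}
    (hU : ∀ j < n, ∀ x ∈ U, s j x ∈ U) {x : M} (hx : x ∈ U) : shuffle s n x ∈ U := by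
  induction n with
  | zero => simpa [shuffle]
  | succ n ih =>
    simp only [shuffle, LinearMap.sub_apply, Module.End.one_apply, Module.End.mul_apply]
    exact U.sub_mem hx (hU n (by omega) _ (ih fun j hj => hU j (by omega)))

theorem antisymm_mem_of_mapsTo {U : AddSubgroup M} {n : ℕ}
    (hU : ∀ j, j + 1 < n → ∀ x ∈ U, s j x ∈ U) {x : M} (hx : x ∈ U) : antisymm s n x ∈ U := by
  induction n generalizing x with
  | zero => simpa [antisymm]
  | succ n ih =>
    simp only [antisymm, Module.End.mul_apply]
    exact ih (fun j hj => hU j (by omega)) (shuffle_mem_of_mapsTo (fun j hj => hU j (by omega)) hx)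

theorem span_image_mapsTo {i : ℕ} (hE : ∀ e, s i (E e) = E (e ∘ Equiv.swap i (i + 1)))
    {P Q : (ℕ → ℤ) → Prop} (hP : ∀ e, P e → Q (e ∘ Equiv.swap i (i + 1))) :
    ∀ x ∈ AddSubgroup.closure (E '' {e | P e}), s i x ∈ AddSubgroup.closure (E '' {e | Q e}) := by
  intro x hx
  have : AddSubgroup.closure (E '' {e | P e}) ≤
      (AddSubgroup.closure (E '' {e | Q e})).comap (s i).toAddMonoidHom := by
    rw [AddSubgroup.closure_le]
    rintro _ ⟨e, he, rfl⟩
    simp only [AddSubgroup.coe_comap, Set.mem_preimage, LinearMap.toAddMonoidHom_coe, hE]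
    exact AddSubgroup.subset_closure ⟨_, hP e he, rfl⟩
  exact this hx

/-- A nontrivial permutation of a strictly decreasing sequence has an ascent, so among the terms of
the antisymmetrization only the identity contributes a decreasing sequence. The induction follows
the last entry, which is the smallest one. -/
theorem antisymm_sub_mem_span {n : ℕ}
    (hE : ∀ i, i + 1 < n → ∀ e, s i (E e) = E (e ∘ Equiv.swap i (i + 1))) {e : ℕ → ℤ} (he : ∀ i j, i < j → j < n → e j < e i) :
    antisymm s n (E e) - E e ∈
      AddSubgroup.closure (E '' {e' | ∃ i j, i < j ∧ j < n ∧ e' i ≤ e' j}) := by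
  induction n with
  | zero => simp [antisymm]
  | succ n ih =>
    have ih := ih (fun i hi => hE i (by omega)) fun i j hij hj => he i j hij (by omega)
    have hmono : AddSubgroup.closure (E '' {e' | ∃ i j, i < j ∧ j < n ∧ e' i ≤ e' j}) ≤
        AddSubgroup.closure (E '' {e' | ∃ i j, i < j ∧ j < n + 1 ∧ e' i ≤ e' j}) := by
      apply AddSubgroup.closure_mono (Set.image_mono _)
      rintro e' ⟨i, j, h1, h2, h3⟩
      exact ⟨i, j, h1, by omega, h3⟩
    rcases n with _ | m
    · simp [antisymm, shuffle]
    -- T: the last entry is larger than some earlier one. This survives permutations of the earlier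
    -- entries, hence `antisymm s (m + 1)`.
    set T := AddSubgroup.closure (E '' {e' | ∃ i < m + 1, e' i < e' (m + 1)}) with hT
    have hTle : T ≤ AddSubgroup.closure (E '' {e' | ∃ i j, i < j ∧ j < m + 1 + 1 ∧ e' i ≤ e' j}) := by
      apply AddSubgroup.closure_mono (Set.image_mono _)
      rintro e' ⟨i, h1, h2⟩
      exact ⟨i, m + 1, h1, by omega, h2.le⟩
    have hTs : ∀ j, j + 1 < m + 1 → ∀ x ∈ T, s j x ∈ T := by
      intro j hj
      apply span_image_mapsTo (hE j (by omega))
      rintro e' ⟨i, h1, h2⟩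
      refine ⟨Equiv.swap j (j + 1) i, ?_, ?_⟩
      · rw [Equiv.swap_apply_def]; split_ifs <;> omega
      · simp only [Function.comp_apply, Equiv.swap_apply_self]
        rwa [Equiv.swap_apply_of_ne_of_ne (by omega : m + 1 ≠ j) (by omega)]
    -- U: the last entry is smaller than all earlier ones. `shuffle s m` preserves U, and s_m then
    -- moves the smallest entry forward, landing in T.
    set U := AddSubgroup.closure (E '' {e' | ∀ i < m + 1, e' (m + 1) < e' i}) with hU
    have hUs : ∀ j < m, ∀ x ∈ U, s j x ∈ U := by
      intro j hj
      apply span_image_mapsTo (hE j (by omega))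
      intro e' h i hi
      simp only [Function.comp_apply]
      rw [Equiv.swap_apply_of_ne_of_ne (by omega : m + 1 ≠ j) (by omega)]
      apply h
      rw [Equiv.swap_apply_def]; split_ifs <;> omega
    have hUT : ∀ x ∈ U, s m x ∈ T := by
      apply span_image_mapsTo (hE m (by omega))
      intro e' h
      refine ⟨m, by omega, ?_⟩
      simp only [Function.comp_apply, Equiv.swap_apply_left, Equiv.swap_apply_right]
      exact h m (by omega)
    have hE0 : E e ∈ U := AddSubgroup.subset_closure ⟨e, fun i hi => he i (m + 1) hi (by omega), rfl⟩
    have h1 : antisymm s (m + 1) (s m (shuffle s m (E e))) ∈ T :=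
      antisymm_mem_of_mapsTo hTs (hUT _ (shuffle_mem_of_mapsTo hUs hE0))
    have h2 : antisymm s (m + 1 + 1) (E e) - E e =
        (antisymm s (m + 1) (E e) - E e) - antisymm s (m + 1) (s m (shuffle s m (E e))) := by
      rw [antisymm.eq_2 s (m + 1), shuffle.eq_2]
      simp only [Module.End.mul_apply, LinearMap.sub_apply, Module.End.one_apply, map_sub]
      abel
    rw [h2]
    exact AddSubgroup.sub_mem _ (hmono ih) (hTle h1)

end LeadingTerm


/-! ### R-matrices and the operators they define on functions of many variables. -/

section Kernels

/-- The entries of a matrix-valued function `R(z, w)` of two variables, acting on pairs of colours.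
The row of the pair `(c, c')` has the entries `w κ c c'` in the columns `t κ c c'`. -/
structure Kernel (K C 𝓡 : Type*) where
  /-- the entries -/
  w : K → C → C → ℕ → ℕ → 𝓡
  /-- the columns -/
  t : K → C → C → C × C

variable {K C 𝓡 : Type*} [Fintype K] [CommRing 𝓡]

namespace Kernel

/-- The operator `G(z, w) ↦ R(z, w) G(w, z)`. -/
def rho (k : Kernel K C 𝓡) (G : ℕ × C → ℕ × C → 𝓡) (x y : ℕ × C) : 𝓡 :=
  ∑ κ, k.w κ x.2 y.2 x.1 y.1 * G (y.1, (k.t κ x.2 y.2).1) (x.1, (k.t κ x.2 y.2).2)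

/-- The operator `rho` acting on the first two of three arguments. -/
def rho₁ (k : Kernel K C 𝓡) (G : ℕ × C → ℕ × C → ℕ × C → 𝓡) (x y t : ℕ × C) : 𝓡 :=
  k.rho (fun a b => G a b t) x y

/-- The operator `rho` acting on the last two of three arguments. -/
def rho₂ (k : Kernel K C 𝓡) (G : ℕ × C → ℕ × C → ℕ × C → 𝓡) (x y t : ℕ × C) : 𝓡 :=
  k.rho (fun a b => G x a b) y t

/-- Unitarity and the Yang-Baxter equation. -/
structure IsBraided (k : Kernel K C 𝓡) : Prop where
  sq : ∀ G, k.rho (k.rho G) = G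
  braid : ∀ G, k.rho₁ (k.rho₂ (k.rho₁ G)) = k.rho₂ (k.rho₁ (k.rho₂ G))

/-- Change of the base ring. -/
def map {𝓡' : Type*} [CommRing 𝓡'] (f : 𝓡 →+* 𝓡') (k : Kernel K C 𝓡) : Kernel K C 𝓡' where
  w κ c c' i j := f (k.w κ c c' i j)
  t := k.t

/-- The sequence `x` with the entries in positions `i`, `i + 1` replaced. -/
def put {X : Type*} (x : ℕ → X) (i : ℕ) (a b : X) : ℕ → X :=
  Function.update (Function.update x i a) (i + 1) b

section put

variable {X : Type*} (x : ℕ → X) (i : ℕ) (a b : X)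

@[simp] theorem put_left : put x i a b i = a := by
  simp [put, Function.update_of_ne]

@[simp] theorem put_right : put x i a b (i + 1) = b := by simp [put]

theorem put_of_ne {j : ℕ} (h : j ≠ i) (h' : j ≠ i + 1) : put x i a b j = x j := by
  simp [put, Function.update_of_ne, h, h']

theorem put_apply (j : ℕ) :
    put x i a b j = if j = i + 1 then b else if j = i then a else x j := by
  simp only [put, Function.update_apply]

@[simp] theorem put_self : put x i (x i) (x (i + 1)) = x := by
  simp [put]

@[simp] theorem put_put (a' b' : X) : put (put x i a b) i a' b' = put x i a' b' := by
  funext j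
  simp only [put_apply]
  split_ifs <;> rfl

theorem put_comm {j : ℕ} (h : i + 2 ≤ j) (a' b' : X) :
    put (put x i a b) j a' b' = put (put x j a' b') i a b := by
  funext l
  simp only [put_apply]
  split_ifs <;> first | rfl | omega

end put

/-- The operator `rho` acting in positions `i` and `i + 1` on functions of infinitely many
arguments. -/
def op (k : Kernel K C 𝓡) (i : ℕ) : Module.End 𝓡 ((ℕ → ℕ × C) → 𝓡) where
  toFun F x := k.rho (fun a b => F (put x i a b)) (x i) (x (i + 1))
  map_add' F G := by
    funext x
    simp only [rho, Pi.add_apply, mul_add, Finset.sum_add_distrib]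
  map_smul' r F := by
    funext x
    simp only [rho, Pi.smul_apply, smul_eq_mul, Finset.mul_sum, RingHom.id_apply]
    exact Finset.sum_congr rfl fun _ _ => by ring

theorem op_apply (k : Kernel K C 𝓡) (i : ℕ) (F x) :
    k.op i F x = k.rho (fun a b => F (put x i a b)) (x i) (x (i + 1)) := rfl

theorem op_put (k : Kernel K C 𝓡) (i : ℕ) (F x a b) :
    k.op i F (put x i a b) = k.rho (fun a b => F (put x i a b)) a b := by
  simp [op_apply]

/-- The sequence `x` with the entries in positions `i`, `i + 1`, `i + 2` replaced. -/
def put₃ {X : Type*} (x : ℕ → X) (i : ℕ) (a b c : X) : ℕ → X :=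
  Function.update (put x i a b) (i + 2) c

theorem op_put₃ (k : Kernel K C 𝓡) (i : ℕ) (F x) :
    (fun a b c => k.op i F (put₃ x i a b c)) = k.rho₁ fun a b c => F (put₃ x i a b c) := by
  funext a b c
  have h1 : put₃ x i a b c i = a := by simp [put₃, Function.update_of_ne]
  have h2 : put₃ x i a b c (i + 1) = b := by simp [put₃, Function.update_of_ne]
  have h3 : ∀ a' b', put (put₃ x i a b c) i a' b' = put₃ x i a' b' c := by
    intro a' b'
    funext l
    simp only [put₃, put_apply, Function.update_apply]
    split_ifs <;> first | rfl | omega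
  simp only [op_apply, h1, h2, h3, rho₁]

theorem op_succ_put₃ (k : Kernel K C 𝓡) (i : ℕ) (F x) :
    (fun a b c => k.op (i + 1) F (put₃ x i a b c)) = k.rho₂ fun a b c => F (put₃ x i a b c) := by
  funext a b c
  have h1 : put₃ x i a b c (i + 1) = b := by simp [put₃, Function.update_of_ne]
  have h2 : put₃ x i a b c (i + 1 + 1) = c := by simp [put₃]
  have h3 : ∀ b' c', put (put₃ x i a b c) (i + 1) b' c' = put₃ x i a b' c' := by
    intro b' c'
    funext l
    simp only [put₃, put_apply, Function.update_apply]
    split_ifs <;> rfl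
  simp only [op_apply, h1, h2, h3, rho₂]

theorem put₃_self {X : Type*} (x : ℕ → X) (i : ℕ) :
    put₃ x i (x i) (x (i + 1)) (x (i + 2)) = x := by
  simp [put₃]

/-- Each operator only sees two neighbouring arguments. Distant operators act on disjoint arguments,
and the other two relations are statements about two or three arguments with the rest frozen. -/
theorem IsBraided.isCoxeter_op {k : Kernel K C 𝓡} (hk : k.IsBraided) : IsCoxeter k.op where
  sq i := by
    ext F x
    rw [Module.End.mul_apply, op_apply]
    simp only [op_put]
    exact (congrFun₂ (hk.sq _) _ _).trans (by simp)
  comm i j hij := by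
    ext F x
    simp only [Module.End.mul_apply, op_apply, rho]
    have e1 : ∀ a b, put x i a b j = x j := fun a b => put_of_ne _ _ _ _ (by omega) (by omega)
    have e2 : ∀ a b, put x i a b (j + 1) = x (j + 1) :=
      fun a b => put_of_ne _ _ _ _ (by omega) (by omega)
    have e3 : ∀ a b, put x j a b i = x i := fun a b => put_of_ne _ _ _ _ (by omega) (by omega)
    have e4 : ∀ a b, put x j a b (i + 1) = x (i + 1) :=
      fun a b => put_of_ne _ _ _ _ (by omega) (by omega)
    simp only [e1, e2, e3, e4, Finset.mul_sum]
    rw [Finset.sum_comm]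
    refine Finset.sum_congr rfl fun _ _ => Finset.sum_congr rfl fun _ _ => ?_
    rw [put_comm _ _ _ _ hij]
    ring
  braid i := by
    ext F x
    have h1 : (fun a b c => (k.op i * k.op (i + 1) * k.op i) F (put₃ x i a b c)) =
        fun a b c => (k.op (i + 1) * k.op i * k.op (i + 1)) F (put₃ x i a b c) := by
      simp only [Module.End.mul_apply]
      rw [op_put₃, op_succ_put₃, op_put₃, op_succ_put₃, op_put₃, op_succ_put₃, hk.braid]
    have h2 := congrFun (congrFun₂ h1 (x i) (x (i + 1))) (x (i + 2))
    simpa only [put₃_self] using h2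

/-- The product is fixed by s_i because P does not depend on the arguments i, i + 1. So A(1 + s_i) =
0 gives twice the claim, and 2 is not a zero divisor. -/
theorem IsBraided.antisymm_eq_zero {k : Kernel K C 𝓡} (hk : k.IsBraided) (h2 : ∀ x : 𝓡, 2 * x = 0 → x = 0)
    {G : ℕ × C → ℕ × C → 𝓡} (hG : k.rho G = G) {i r : ℕ} (hi : i + 1 < r)
    {P : (ℕ → ℕ × C) → 𝓡} (hP : ∀ x a b, P (put x i a b) = P x) :
    antisymm k.op r (fun x => P x * G (x i) (x (i + 1))) = 0 := by
  set F : (ℕ → ℕ × C) → 𝓡 := fun x => P x * G (x i) (x (i + 1)) with hF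
  have h1 : k.op i F = F := by
    funext x
    simp only [op_apply, hF, hP, put_left, put_right]
    conv_rhs => rw [← hG]
    simp only [rho, Finset.mul_sum]
    exact Finset.sum_congr rfl fun _ _ => by ring
  have h3 : (antisymm k.op r * (1 + k.op i)) F = 0 := by
    rw [hk.isCoxeter_op.antisymm_mul hi]; rfl
  rw [Module.End.mul_apply, LinearMap.add_apply, h1, Module.End.one_apply, map_add] at h3
  funext x
  apply h2
  rw [two_mul]
  exact congrFun h3 x

section map

variable {𝓡' : Type*} [CommRing 𝓡'] (f : 𝓡 →+* 𝓡') (k : Kernel K C 𝓡)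

theorem map_op (i : ℕ) (F : (ℕ → ℕ × C) → 𝓡) : (k.map f).op i (f ∘ F) = f ∘ k.op i F := by
  funext x
  simp [op_apply, rho, map]

theorem map_shuffle (n : ℕ) (F : (ℕ → ℕ × C) → 𝓡) :
    shuffle (k.map f).op n (f ∘ F) = f ∘ shuffle k.op n F := by
  induction n with
  | zero => rfl
  | succ n ih =>
    simp only [shuffle, LinearMap.sub_apply, Module.End.one_apply, Module.End.mul_apply, ih, map_op]
    funext x
    simp

/-- This allows one kernel over power series in v to be used both over Laurent series, where v is
invertible, and at v = 0. -/
theorem map_antisymm (n : ℕ) (F : (ℕ → ℕ × C) → 𝓡) :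
    antisymm (k.map f).op n (f ∘ F) = f ∘ antisymm k.op n F := by
  induction n generalizing F with
  | zero => rfl
  | succ n ih => simp only [antisymm, Module.End.mul_apply, map_shuffle, ih]

end map

end Kernel

end Kernels


/-! ### Words, two-sided ideals and normal forms. -/

section WordAlgebra

variable {R : Type*} [CommRing R] {S : Type}

/-- The basis element of `R[Typ]` given by a word. -/
noncomputable def wd (R : Type*) [CommRing R] {S : Type} (l : List (ℤ × S)) : TypRing R S :=
  MonoidAlgebra.single (FreeMonoid.ofList l) 1

theorem wd_append (l l' : List (ℤ × S)) : wd R (l ++ l') = wd R l * wd R l' := by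
  simp [wd, MonoidAlgebra.single_mul_single, FreeMonoid.ofList_append]

theorem wd_nil : wd R ([] : List (ℤ × S)) = 1 := rfl

theorem wd_cons (a : ℤ × S) (l : List (ℤ × S)) : wd R (a :: l) = wd R [a] * wd R l :=
  wd_append [a] l

theorem span_range_wd : Submodule.span R (Set.range (wd R : List (ℤ × S) → TypRing R S)) = ⊤ := by
  rw [eq_top_iff]
  rintro x -
  induction x using MonoidAlgebra.induction_linear with
  | zero => exact zero_mem _
  | add x y hx hy => exact add_mem hx hy
  | single m r =>
    have : MonoidAlgebra.single m r = r • wd R (FreeMonoid.toList m) := by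
      simp [wd, MonoidAlgebra.smul_single]
    rw [this]
    exact Submodule.smul_mem _ _ (Submodule.subset_span ⟨_, rfl⟩)

section lift

variable {M : Type*} [AddCommGroup M] [Module R M]

theorem linearMap_ext_wd {f g : TypRing R S →ₗ[R] M} (h : ∀ l, f (wd R l) = g (wd R l)) :
    f = g := by
  apply LinearMap.ext_on_range span_range_wd
  exact h

/-- The linear map on `R[Typ]` with given values on words. -/
noncomputable def wdLift (f : List (ℤ × S) → M) : TypRing R S →ₗ[R] M :=
  (Finsupp.linearCombination R fun w => f (FreeMonoid.toList w)) ∘ₗ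
    (MonoidAlgebra.coeffLinearEquiv R).toLinearMap

@[simp] theorem wdLift_wd (f : List (ℤ × S) → M) (l : List (ℤ × S)) : wdLift f (wd R l) = f l := by
  have : (MonoidAlgebra.coeffLinearEquiv R) (wd R l) = Finsupp.single (FreeMonoid.ofList l) 1 := rfl
  simp [wdLift, this]

end lift

/-- The two-sided ideal generated by `gens`, as an `R`-submodule. -/
def relIdeal (gens : Set (TypRing R S)) : Submodule R (TypRing R S) where
  carrier := {x | x ∈ TwoSidedIdeal.span gens}
  add_mem' := by
    intro x y hx hy
    simp only [Set.mem_ofPred_eq] at *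
    exact TwoSidedIdeal.add_mem _ hx hy
  zero_mem' := by
    simp only [Set.mem_ofPred_eq]
    exact TwoSidedIdeal.zero_mem _
  smul_mem' c x hx := by
    simp only [Set.mem_ofPred_eq] at *
    rw [Algebra.smul_def]
    exact TwoSidedIdeal.mul_mem_left _ _ _ hx

theorem mem_relIdeal {gens : Set (TypRing R S)} {x : TypRing R S} :
    x ∈ relIdeal gens ↔ x ∈ TwoSidedIdeal.span gens := by
  simp [relIdeal]

theorem subset_relIdeal {gens : Set (TypRing R S)} {x : TypRing R S} (hx : x ∈ gens) :
    x ∈ relIdeal gens :=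
  mem_relIdeal.mpr (TwoSidedIdeal.subset_span hx)

theorem mul_mem_relIdeal {gens : Set (TypRing R S)} {x : TypRing R S} (hx : x ∈ relIdeal gens)
    (a b : TypRing R S) : a * x * b ∈ relIdeal gens :=
  mem_relIdeal.mpr
    (TwoSidedIdeal.mul_mem_right _ _ _ (TwoSidedIdeal.mul_mem_left _ _ _ (mem_relIdeal.mp hx)))

/-- The elements x with a * x * b in N for all a, b form a two-sided ideal contained in N; by
linearity it is enough to test words a, b. -/
theorem relIdeal_le {gens : Set (TypRing R S)} {N : Submodule R (TypRing R S)}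
    (h : ∀ g ∈ gens, ∀ u w, wd R u * g * wd R w ∈ N) : relIdeal gens ≤ N := by
  let J : TwoSidedIdeal (TypRing R S) := TwoSidedIdeal.mk' {x | ∀ a b, a * x * b ∈ N}
    (by intro a b; simp)
    (by intro x y hx hy a b; rw [mul_add, add_mul]; exact add_mem (hx a b) (hy a b))
    (by intro x hx a b; rw [mul_neg, neg_mul]; exact neg_mem (hx a b))
    (by intro x y hy a b; rw [← mul_assoc]; exact hy _ _)
    (by
      intro x y hx a b
      have := hx a (y * b)
      simpa only [mul_assoc] using this)
  have hJ : TwoSidedIdeal.span gens ≤ J := by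
    rw [TwoSidedIdeal.span_le]
    intro g hg
    change g ∈ J
    rw [TwoSidedIdeal.mem_mk']
    intro a b
    have ha : a ∈ Submodule.span R (Set.range (wd R : List (ℤ × S) → TypRing R S)) := by
      rw [span_range_wd]; trivial
    induction ha using Submodule.span_induction with
    | zero => simp
    | add x y _ _ hx hy => rw [add_mul, add_mul]; exact add_mem hx hy
    | smul c x _ hx => rw [smul_mul_assoc, smul_mul_assoc]; exact N.smul_mem _ hx
    | mem x hx =>
      obtain ⟨u, rfl⟩ := hx
      have hb : b ∈ Submodule.span R (Set.range (wd R : List (ℤ × S) → TypRing R S)) := by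
        rw [span_range_wd]; trivial
      induction hb using Submodule.span_induction with
      | zero => simp
      | add x y _ _ hx hy => rw [mul_add]; exact add_mem hx hy
      | smul c x _ hx => rw [mul_smul_comm]; exact N.smul_mem _ hx
      | mem x hx => obtain ⟨w, rfl⟩ := hx; exact h g hg u w
  intro x hx
  have h1 : x ∈ J := hJ (mem_relIdeal.mp hx)
  rw [TwoSidedIdeal.mem_mk'] at h1
  simpa using h1 1 1

/-! ### Termination of the straightening procedure. -/

section spanning

/-- The sum of the squares of the exponents of a word. -/
def sqSum (l : List (ℤ × S)) : ℤ := (l.map fun a => a.1 ^ 2).sum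

/-- The sum of the exponents of a word, weighted by their positions. -/
def posSum : List (ℤ × S) → ℤ
  | [] => 0
  | _ :: l => posSum l + (l.map Prod.fst).sum

theorem sqSum_append (l l' : List (ℤ × S)) : sqSum (l ++ l') = sqSum l + sqSum l' := by
  simp [sqSum]

theorem posSum_append (l l' : List (ℤ × S)) :
    posSum (l ++ l') = posSum l + posSum l' + l.length * (l'.map Prod.fst).sum := by
  induction l with
  | nil => simp [posSum]
  | cons a l ih => simp [posSum, ih]; ring

theorem abs_sum_le_sqSum (l : List (ℤ × S)) : |(l.map Prod.fst).sum| ≤ sqSum l := by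
  induction l with
  | nil => simp [sqSum]
  | cons a l ih =>
    have h1 : |a.1| ≤ a.1 ^ 2 := by rw [← sq_abs]; exact Int.le_self_sq _
    have h2 : sqSum (a :: l) = a.1 ^ 2 + sqSum l := by simp [sqSum]
    rw [List.map_cons, List.sum_cons, h2]
    exact (abs_add_le _ _).trans (by linarith)

/-- This bound makes the integer inside `wdMeasure` nonnegative, so that `toNat` loses nothing. -/
theorem neg_posSum_le (l : List (ℤ × S)) : -posSum l ≤ l.length * sqSum l := by
  induction l with
  | nil => simp [posSum]
  | cons a l ih =>
    have h1 := neg_le_of_abs_le (abs_sum_le_sqSum l)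
    have h2 : sqSum (a :: l) = a.1 ^ 2 + sqSum l := by simp [sqSum]
    have h3 : (0 : ℤ) ≤ (l.length + 1) * a.1 ^ 2 := by positivity
    rw [h2, posSum, List.length_cons]
    push_cast
    nlinarith

/-- A measure of the complexity of words that decreases under straightening. -/
def wdMeasure (l : List (ℤ × S)) : ℕ := (posSum l + l.length * sqSum l).toNat

/-- Moving j from the right letter to the left one lowers the position-weighted sum by j and changes
the sum of squares by 2j(x + j - y) ≤ 0. In a plain exchange the squares do not change, and only the
first term decreases. -/
theorem wdMeasure_lt {u w : List (ℤ × S)} {x y x' y' : ℤ × S} {j : ℤ} (hj : 1 ≤ j)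
    (hx : x'.1 = x.1 + j) (hy : y'.1 = y.1 - j) (hxy : x.1 + j ≤ y.1) :
    wdMeasure (u ++ [x', y'] ++ w) < wdMeasure (u ++ [x, y] ++ w) := by
  have h0 := neg_posSum_le (u ++ [x, y] ++ w)
  have h1 : posSum (u ++ [x', y'] ++ w) = posSum (u ++ [x, y] ++ w) - j := by
    simp [posSum_append, posSum, hx, hy]; ring
  have h2 : sqSum (u ++ [x', y'] ++ w) ≤ sqSum (u ++ [x, y] ++ w) := by
    simp only [sqSum_append]
    simp only [sqSum, List.map_cons, List.map_nil, List.sum_cons, List.sum_nil, hx, hy]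
    nlinarith
  have h3 : (u ++ [x', y'] ++ w).length = (u ++ [x, y] ++ w).length := by simp
  have h1' := neg_posSum_le (u ++ [x', y'] ++ w)
  unfold wdMeasure
  rw [h3] at *
  have h4 : ((u ++ [x, y] ++ w).length : ℤ) * sqSum (u ++ [x', y'] ++ w) ≤
      (u ++ [x, y] ++ w).length * sqSum (u ++ [x, y] ++ w) :=
    mul_le_mul_of_nonneg_left h2 (by positivity)
  omega

/-- The words of length two that are closer to being straight than `[x, y]`. -/
def straighter (x y : ℤ × S) : Set (List (ℤ × S)) :=
  {l | ∃ x' y' : ℤ × S, ∃ j : ℤ, 1 ≤ j ∧ x'.1 = x.1 + j ∧ y'.1 = y.1 - j ∧ x.1 + j ≤ y.1 ∧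
    l = [x', y']}

theorem exists_of_not_isChain {α : Type*} {N : α → α → Prop} {l : List α} (h : ¬ l.IsChain N) :
    ∃ u x y w, l = u ++ [x, y] ++ w ∧ ¬ N x y := by
  induction l with
  | nil => simp at h
  | cons a l ih =>
    rcases l with _ | ⟨b, l⟩
    · simp at h
    · rw [List.isChain_cons_cons] at h
      by_cases hab : N a b
      · obtain ⟨u, x, y, w, hl, hxy⟩ := ih fun h' => h ⟨hab, h'⟩
        exact ⟨a :: u, x, y, w, by simp [hl], hxy⟩
      · exact ⟨[], a, b, l, rfl, hab⟩

theorem wd_mem_span_sup_relIdeal {gens : Set (TypRing R S)} {N : ℤ × S → ℤ × S → Prop}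
    (h : ∀ x y, ¬ N x y → ∃ z ∈ Submodule.span R (wd R '' straighter x y),
      wd R [x, y] - z ∈ relIdeal gens) (l : List (ℤ × S)) :
    wd R l ∈ Submodule.span R (wd R '' {n | n.IsChain N ∧ n.length = l.length}) ⊔
      relIdeal gens := by
  induction hm : wdMeasure l using Nat.strong_induction_on generalizing l with
  | _ m ih =>
  by_cases hl : l.IsChain N
  · exact Submodule.mem_sup_left (Submodule.subset_span ⟨l, ⟨hl, rfl⟩, rfl⟩)
  · obtain ⟨u, x, y, w, rfl, hxy⟩ := exists_of_not_isChain hl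
    obtain ⟨z, hz, hzI⟩ := h x y hxy
    have h1 : wd R (u ++ [x, y] ++ w) = wd R u * z * wd R w +
        wd R u * (wd R [x, y] - z) * wd R w := by
      rw [wd_append, wd_append]; noncomm_ring
    rw [h1]
    refine add_mem ?_ (Submodule.mem_sup_right (mul_mem_relIdeal hzI _ _))
    clear h1 hzI
    induction hz using Submodule.span_induction with
    | zero => simp
    | add x y _ _ hx hy => rw [mul_add, add_mul]; exact add_mem hx hy
    | smul c x _ hx => rw [mul_smul_comm, smul_mul_assoc]; exact Submodule.smul_mem _ _ hx
    | mem z hz =>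
      obtain ⟨_, ⟨x', y', j, hj, hx, hy, hj', rfl⟩, rfl⟩ := hz
      rw [← wd_append, ← wd_append]
      have := ih _ (hm ▸ wdMeasure_lt (u := u) (w := w) hj hx hy hj') (u ++ [x', y'] ++ w) rfl
      simpa using this

end spanning

/-! ### Normal forms and their behaviour under base change. -/

section normalForm

/-- Every word has a unique normal form modulo the ideal generated by `gens`, the normal words
being the chains for the relation `N`. -/
def HasNormalForm (gens : Set (TypRing R S)) (N : ℤ × S → ℤ × S → Prop) : Prop :=
  ∃ ν : TypRing R S →ₗ[R] (List (ℤ × S) →₀ R), relIdeal gens ≤ LinearMap.ker ν ∧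
    (∀ l, ν (wd R l) ∈ Finsupp.supported R R {n | n.IsChain N ∧ n.length = l.length}) ∧
    ∀ n, n.IsChain N → ν (wd R n) = Finsupp.single n 1

/-- Spanning gives each word an expansion in normal words; independence makes the linear extension
of a choice of expansions kill the ideal and fix normal words. -/
theorem HasNormalForm.of_linearIndependent {gens : Set (TypRing R S)} {N : ℤ × S → ℤ × S → Prop}
    (hs : ∀ l, wd R l ∈ Submodule.span R (wd R '' {n | n.IsChain N ∧ n.length = l.length}) ⊔
      relIdeal gens)
    (hi : ∀ c ∈ Finsupp.supported R R {n : List (ℤ × S) | n.IsChain N},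
      Finsupp.linearCombination R (wd R) c ∈ relIdeal gens → c = 0) :
    HasNormalForm gens N := by
  have h1 : ∀ l, ∃ c ∈ Finsupp.supported R R {n : List (ℤ × S) | n.IsChain N ∧ n.length = l.length},
      wd R l - Finsupp.linearCombination R (wd R) c ∈ relIdeal gens := by
    intro l
    obtain ⟨y, hy, z, hz, hyz⟩ := Submodule.mem_sup.mp (hs l)
    obtain ⟨c, hc, rfl⟩ := (Finsupp.mem_span_image_iff_linearCombination R).mp hy
    exact ⟨c, hc, by rw [← hyz]; simpa using hz⟩
  choose c hc hcI using h1
  have hle : ∀ l : List (ℤ × S), Finsupp.supported R R {n : List (ℤ × S) | n.IsChain N ∧ n.length = l.length} ≤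
      Finsupp.supported R R {n : List (ℤ × S) | n.IsChain N} :=
    fun l => Finsupp.supported_mono fun n hn => hn.1
  have h2 : ∀ x, x - Finsupp.linearCombination R (wd R) (wdLift c x) ∈ relIdeal gens := by
    intro x
    have hx : x ∈ Submodule.span R (Set.range (wd R : List (ℤ × S) → TypRing R S)) := by
      rw [span_range_wd]; trivial
    induction hx using Submodule.span_induction with
    | zero => simp
    | add x y _ _ hx hy =>
      rw [map_add, map_add, add_sub_add_comm]; exact add_mem hx hy
    | smul a x _ hx =>
      rw [map_smul, map_smul, ← smul_sub]; exact Submodule.smul_mem _ _ hx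
    | mem x hx => obtain ⟨l, rfl⟩ := hx; rw [wdLift_wd]; exact hcI l
  have h3 : ∀ x : TypRing R S,
      wdLift c x ∈ Finsupp.supported R R {n : List (ℤ × S) | n.IsChain N} := by
    intro x
    have hx : x ∈ Submodule.span R (Set.range (wd R : List (ℤ × S) → TypRing R S)) := by
      rw [span_range_wd]; trivial
    induction hx using Submodule.span_induction with
    | zero => simp
    | add x y _ _ hx hy => rw [map_add]; exact add_mem hx hy
    | smul a x _ hx => rw [map_smul]; exact Submodule.smul_mem _ _ hx
    | mem x hx => obtain ⟨l, rfl⟩ := hx; rw [wdLift_wd]; exact hle l (hc l)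
  refine ⟨wdLift c, fun x hx => ?_, fun l => by rw [wdLift_wd]; exact hc l, fun n hn => ?_⟩
  · rw [LinearMap.mem_ker]
    apply hi _ (h3 x)
    have := sub_mem hx (h2 x)
    simpa using this
  · have h4 := hi (Finsupp.single n 1 - wdLift c (wd R n))
      (Submodule.sub_mem _ (Finsupp.single_mem_supported R 1 hn) (h3 _)) (by simpa using h2 (wd R n))
    exact (sub_eq_zero.mp h4).symm

theorem mapRingHom_wd {U R : Type*} [CommRing U] [CommRing R] {S : Type} (φ : U →+* R)
    (l : List (ℤ × S)) : MonoidAlgebra.mapRingHom (FreeMonoid (ℤ × S)) φ (wd U l) = wd R l := by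
  simp [wd]

theorem mapRingHom_smul {U R : Type*} [CommRing U] [CommRing R] {S : Type} (φ : U →+* R) (c : U)
    (x : TypRing U S) : MonoidAlgebra.mapRingHom (FreeMonoid (ℤ × S)) φ (c • x) =
      φ c • MonoidAlgebra.mapRingHom (FreeMonoid (ℤ × S)) φ x := by
  rw [Algebra.smul_def, Algebra.smul_def, map_mul]
  congr 1
  simp [MonoidAlgebra.coe_algebraMap]

/-- Linear independence need not survive a change of rings, but a linear retraction onto normal
words does: its values on words are transported by φ, and it still kills the generators, which all
lift. -/
theorem HasNormalForm.map {U : Type*} [CommRing U] (φ : U →+* R) {gensU : Set (TypRing U S)}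
    {gens : Set (TypRing R S)} {N : ℤ × S → ℤ × S → Prop} (h : HasNormalForm gensU N)
    (hg : ∀ g ∈ gens, ∃ g' ∈ gensU, MonoidAlgebra.mapRingHom (FreeMonoid (ℤ × S)) φ g' = g) :
    HasNormalForm gens N := by
  obtain ⟨ν, hν, hs, hn⟩ := h
  set Φ := MonoidAlgebra.mapRingHom (FreeMonoid (ℤ × S)) φ with hΦ
  have hwd : ∀ l, Φ (wd U l) = wd R l := mapRingHom_wd φ
  let ν' : TypRing R S →ₗ[R] (List (ℤ × S) →₀ R) :=
    wdLift fun l => Finsupp.mapRange φ (map_zero φ) (ν (wd U l))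
  have hcomp : ∀ x, ν' (Φ x) = Finsupp.mapRange φ (map_zero φ) (ν x) := by
    intro x
    have hx : x ∈ Submodule.span U (Set.range (wd U : List (ℤ × S) → TypRing U S)) := by
      rw [span_range_wd]; trivial
    induction hx using Submodule.span_induction with
    | zero => simp
    | add x y _ _ hx hy =>
      rw [map_add, map_add, map_add, hx, hy, Finsupp.mapRange_add (map_add φ)]
    | smul a x _ hx =>
      have h1 : Φ (a • x) = φ a • Φ x := mapRingHom_smul φ a x
      rw [h1, map_smul, map_smul, hx]
      ext i
      simp
    | mem x hx => obtain ⟨l, rfl⟩ := hx; rw [hwd, wdLift_wd]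
  refine ⟨ν', ?_, ?_, ?_⟩
  · apply relIdeal_le
    intro g hgg u w
    obtain ⟨g', hg', rfl⟩ := hg g hgg
    rw [LinearMap.mem_ker, ← hwd, ← hwd, ← map_mul, ← map_mul, hcomp]
    have : ν (wd U u * g' * wd U w) = 0 :=
      hν (mul_mem_relIdeal (subset_relIdeal hg') _ _)
    rw [this, Finsupp.mapRange_zero]
  · intro l
    rw [wdLift_wd, Finsupp.mem_supported]
    exact (Finset.coe_subset.mpr Finsupp.support_mapRange).trans ((Finsupp.mem_supported _ _).mp (hs l))
  · intro n hc
    rw [wdLift_wd, hn n hc, Finsupp.mapRange_single, map_one]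

end normalForm

end WordAlgebra


/-! ### Words as functions, and vanishing of the relations under antisymmetrization. -/

section WordFunctions

variable {S : Type} {K C 𝓡 : Type*} [DecidableEq C] [CommRing 𝓡]

/-- The encoding of letters by a colour and an exponent. -/
structure Coding (S C : Type*) where
  /-- the colour -/
  col : ℤ × S → C
  /-- the exponent -/
  ex : ℤ × S → ℤ

/-- The function of one variable given by a letter. -/
def letter (cd : Coding S C) (z : ℕ → 𝓡ˣ) (a : ℤ × S) (x : ℕ × C) : 𝓡 :=
  if x.2 = cd.col a then ((z x.1 ^ cd.ex a : 𝓡ˣ) : 𝓡) else 0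

/-- The function of two variables given by two letters. -/
def pairFun (cd : Coding S C) (z : ℕ → 𝓡ˣ) (V : 𝓡ˣ) (a b : ℤ × S) (x y : ℕ × C) : 𝓡 :=
  ((V ^ b.1 : 𝓡ˣ) : 𝓡) * letter cd z a x * letter cd z b y

/-- The function given by a word, placed at position `k`. -/
def wordFun (cd : Coding S C) (z : ℕ → 𝓡ˣ) (V : 𝓡ˣ) : List (ℤ × S) → ℕ → (ℕ → ℕ × C) → 𝓡
  | [], _, _ => 1
  | a :: l, k, x => (((V ^ k) ^ a.1 : 𝓡ˣ) : 𝓡) * letter cd z a (x k) * wordFun cd z V l (k + 1) x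

variable (cd : Coding S C) (z : ℕ → 𝓡ˣ) (V : 𝓡ˣ)

theorem wordFun_append (l l' : List (ℤ × S)) (k : ℕ) (x : ℕ → ℕ × C) :
    wordFun cd z V (l ++ l') k x = wordFun cd z V l k x * wordFun cd z V l' (k + l.length) x := by
  induction l generalizing k with
  | nil => simp [wordFun]
  | cons a l ih =>
    simp only [List.cons_append, wordFun, ih, List.length_cons]
    rw [show k + 1 + l.length = k + (l.length + 1) by ring]
    ring

theorem wordFun_congr (l : List (ℤ × S)) (k : ℕ) {x y : ℕ → ℕ × C}
    (h : ∀ j, k ≤ j → j < k + l.length → x j = y j) :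
    wordFun cd z V l k x = wordFun cd z V l k y := by
  induction l generalizing k with
  | nil => rfl
  | cons a l ih =>
    simp only [List.length_cons] at h
    simp only [wordFun]
    rw [h k le_rfl (by omega), ih (k + 1) fun j h1 h2 => h j (by omega) (by omega)]

/-- The twist by V is a single scalar for each word, so it can be taken out of the
antisymmetrization. -/
theorem wordFun_eq_smul (l : List (ℤ × S)) (k : ℕ) (x : ℕ → ℕ × C) :
    wordFun cd z V l k x =
      ((V ^ (posSum l + k * (l.map Prod.fst).sum) : 𝓡ˣ) : 𝓡) * wordFun cd z 1 l k x := by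
  induction l generalizing k with
  | nil => simp [wordFun, posSum]
  | cons a l ih =>
    simp only [wordFun, ih, posSum, List.map_cons, List.sum_cons, one_pow, one_zpow]
    have : (V ^ (posSum l + (l.map Prod.fst).sum + k * (a.1 + (l.map Prod.fst).sum)) : 𝓡ˣ) =
        (V ^ k) ^ a.1 * V ^ (posSum l + ((k + 1 : ℕ) : ℤ) * (l.map Prod.fst).sum) := by
      rw [← zpow_natCast, ← zpow_mul, ← zpow_add]
      congr 1
      push_cast
      ring
    rw [this]
    push_cast
    ring

/-- The factor in front of the two middle letters depends on them only through a + b. Relations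
between pairs preserve this sum, so the factor is common to all their terms. -/
theorem wordFun_middle (u w : List (ℤ × S)) (a b : ℤ × S) (x : ℕ → ℕ × C) :
    wordFun cd z V (u ++ [a, b] ++ w) 0 x =
      ((((V ^ u.length) ^ (a.1 + b.1) : 𝓡ˣ) : 𝓡) * wordFun cd z V u 0 x *
        wordFun cd z V w (u.length + 2) x) *
          pairFun cd z V a b (x u.length) (x (u.length + 1)) := by
  simp only [List.append_assoc, wordFun_append, zero_add, List.cons_append, List.nil_append, wordFun,
    pairFun]
  have : ((V ^ (u.length + 1)) ^ b.1 : 𝓡ˣ) = (V ^ u.length) ^ b.1 * V ^ b.1 := by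
    rw [pow_succ, mul_zpow]
  rw [this, zpow_add]
  push_cast
  ring

variable [Fintype K] {U : Type*} [CommRing U] [Algebra U 𝓡]

/-- The pairs consisting of a combination of words `[a, b]`, where `a + b = N`, and the function
given by it. -/
noncomputable def pairSpan (U : Type*) [CommRing U] [Algebra U 𝓡] (N : ℤ) :
    Submodule U (TypRing U S × (ℕ × C → ℕ × C → 𝓡)) :=
  Submodule.span U {p | ∃ a b : ℤ × S, a.1 + b.1 = N ∧ p = (wd U [a, b], pairFun cd z V a b)}

theorem mem_pairSpan (a b : ℤ × S) (N : ℤ) (h : a.1 + b.1 = N) :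
    (wd U [a, b], pairFun cd z V a b) ∈ pairSpan cd z V U N :=
  Submodule.subset_span ⟨a, b, h, rfl⟩

/-- The antisymmetrization of the functions given by words of length `r`. -/
noncomputable def wdAntisymm (k : Kernel K C 𝓡) (r : ℕ) :
    TypRing U S →ₗ[U] ((ℕ → ℕ × C) → 𝓡) :=
  wdLift fun l => if l.length = r then antisymm k.op r (wordFun cd z V l 0) else 0

variable {cd z V}

/-- The function of a sequence given by a function `G` of the entries in positions `i`, `i + 1`
and a factor `P`. -/
def insertAt (U : Type*) [CommRing U] [Algebra U 𝓡] (P : (ℕ → ℕ × C) → 𝓡) (i : ℕ) :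
    (ℕ × C → ℕ × C → 𝓡) →ₗ[U] ((ℕ → ℕ × C) → 𝓡) where
  toFun G x := P x * G (x i) (x (i + 1))
  map_add' G G' := by funext x; simp [mul_add]
  map_smul' c G := by funext x; simp

theorem wdAntisymm_eq_insertAt (k : Kernel K C 𝓡) {N : ℤ} (u w : List (ℤ × S)) (r : ℕ)
    {p : TypRing U S × (ℕ × C → ℕ × C → 𝓡)} (hp : p ∈ pairSpan cd z V U N) :
    wdAntisymm cd z V k r (wd U u * p.1 * wd U w) =
      if u.length + w.length + 2 = r then
        antisymm k.op r (insertAt U (fun x => (((V ^ u.length) ^ N : 𝓡ˣ) : 𝓡) *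
          wordFun cd z V u 0 x * wordFun cd z V w (u.length + 2) x) u.length p.2) else 0 := by
  set T : (ℕ × C → ℕ × C → 𝓡) →ₗ[U] ((ℕ → ℕ × C) → 𝓡) :=
    insertAt U (fun x => (((V ^ u.length) ^ N : 𝓡ˣ) : 𝓡) *
          wordFun cd z V u 0 x * wordFun cd z V w (u.length + 2) x) u.length with hT
  let L₁ : TypRing U S × (ℕ × C → ℕ × C → 𝓡) →ₗ[U] ((ℕ → ℕ × C) → 𝓡) :=
    wdAntisymm cd z V k r ∘ₗ LinearMap.mulRight U (wd U w) ∘ₗ LinearMap.mulLeft U (wd U u) ∘ₗ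
      LinearMap.fst U _ _
  let L₂ : TypRing U S × (ℕ × C → ℕ × C → 𝓡) →ₗ[U] ((ℕ → ℕ × C) → 𝓡) :=
    (if u.length + w.length + 2 = r then (antisymm k.op r).restrictScalars U ∘ₗ T else 0) ∘ₗ
      LinearMap.snd U _ _
  have h : Set.EqOn L₁ L₂ {p | ∃ a b : ℤ × S, a.1 + b.1 = N ∧ p = (wd U [a, b], pairFun cd z V a b)} := by
    rintro _ ⟨a, b, hab, rfl⟩
    have h1 : (u ++ [a, b] ++ w).length = u.length + w.length + 2 := by simp; ring
    have h2 : L₁ (wd U [a, b], pairFun cd z V a b) =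
        wdAntisymm cd z V k r (wd U (u ++ [a, b] ++ w)) := by
      rw [wd_append, wd_append]; rfl
    have h3 : L₂ (wd U [a, b], pairFun cd z V a b) = if u.length + w.length + 2 = r then
        antisymm k.op r (T (pairFun cd z V a b)) else 0 := by
      simp only [L₂]
      split_ifs <;> rfl
    rw [h2, h3, wdAntisymm, wdLift_wd, h1]
    congr 2
    funext x
    rw [wordFun_middle, hab]
    rfl
  have h4 := LinearMap.eqOn_span h hp
  have h5 : L₂ p = if u.length + w.length + 2 = r then antisymm k.op r (T p.2) else 0 := by
    simp only [L₂]
    split_ifs <;> rfl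
  exact h4.trans h5

/-- Whatever surrounds the two letters does not involve their arguments, so a pair function fixed by
the exchange stays fixed when placed inside a word. -/
theorem wdAntisymm_mul_mul {k : Kernel K C 𝓡} (hk : k.IsBraided)
    (h2 : ∀ x : 𝓡, 2 * x = 0 → x = 0) {N : ℤ} {g : TypRing U S} {G : ℕ × C → ℕ × C → 𝓡}
    (hg : (g, G) ∈ pairSpan cd z V U N) (hG : k.rho G = G) (u w : List (ℤ × S)) (r : ℕ) :
    wdAntisymm cd z V k r (wd U u * g * wd U w) = 0 := by
  rw [wdAntisymm_eq_insertAt k u w r hg]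
  split_ifs with hr
  · apply Kernel.IsBraided.antisymm_eq_zero hk h2 hG (by omega)
    intro x a b
    rw [wordFun_congr cd z V u 0 (y := x) fun j _ hj => Kernel.put_of_ne _ _ _ _ (by omega) (by omega),
      wordFun_congr cd z V w (u.length + 2) (y := x) fun j hj _ =>
        Kernel.put_of_ne _ _ _ _ (by omega) (by omega)]
  · rfl

theorem relIdeal_le_ker_wdAntisymm {k : Kernel K C 𝓡} (hk : k.IsBraided)
    (h2 : ∀ x : 𝓡, 2 * x = 0 → x = 0) {gens : Set (TypRing U S)}
    (hg : ∀ g ∈ gens, ∃ N G, (g, G) ∈ pairSpan cd z V U N ∧ k.rho G = G) (r : ℕ) :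
    relIdeal gens ≤ LinearMap.ker (wdAntisymm cd z V k r) := by
  apply relIdeal_le
  intro g hgg u w
  obtain ⟨N, G, h1, h3⟩ := hg g hgg
  exact wdAntisymm_mul_mul hk h2 h1 h3 u w r

end WordFunctions


/-! ### Monomial R-matrices and leading coefficients. -/

section LeadingCoefficient

variable {S : Type} {K C 𝓡 : Type*} [Inhabited S] (cd : Coding S C)

/-- The shift of the exponents for a sequence of colours. -/
def colShift (κ : C → C → ℤ) (c : ℕ → C) (j : ℕ) : ℤ :=
  -∑ l ∈ Finset.range j, κ (c l) (c (l + 1))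

/-- The sequence of colours of a word. -/
def colSeq (l : List (ℤ × S)) (j : ℕ) : C := cd.col (l.getD j default)

/-- The sequence of exponents of a word. -/
def exSeq (l : List (ℤ × S)) (j : ℕ) : ℤ := cd.ex (l.getD j default)

variable {cd}

theorem eq_of_colSeq_exSeq (hcd : ∀ a b, cd.col a = cd.col b → cd.ex a = cd.ex b → a = b)
    {l l' : List (ℤ × S)} (hl : l.length = l'.length)
    (hc : ∀ j < l.length, colSeq cd l j = colSeq cd l' j)
    (he : ∀ j < l.length, exSeq cd l j = exSeq cd l' j) : l = l' := by
  apply List.ext_getElem hl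
  intro j h1 h2
  have h := hcd _ _ (hc j h1) (he j h1)
  rwa [List.getD_eq_getElem _ _ h1, List.getD_eq_getElem _ _ h2] at h

/-- The condition on N is exactly a strict descent between neighbours after the shift, which plays
the role of adding ρ to a partition. -/
theorem strictAnti_of_isChain {κ : C → C → ℤ} {N : ℤ × S → ℤ × S → Prop}
    (hN : ∀ a b, N a b → cd.ex b < cd.ex a + κ (cd.col a) (cd.col b)) {l : List (ℤ × S)}
    (hl : l.IsChain N) {i j : ℕ} (hij : i < j) (hj : j < l.length) :
    exSeq cd l j + colShift κ (colSeq cd l) j < exSeq cd l i + colShift κ (colSeq cd l) i := by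
  induction j with
  | zero => omega
  | succ j ih =>
    have h1 : exSeq cd l (j + 1) + colShift κ (colSeq cd l) (j + 1) <
        exSeq cd l j + colShift κ (colSeq cd l) j := by
      have h2 := hN _ _ (List.isChain_iff_getElem.mp hl j hj)
      have h3 : colShift κ (colSeq cd l) (j + 1) = colShift κ (colSeq cd l) j -
          κ (colSeq cd l j) (colSeq cd l (j + 1)) := by
        simp only [colShift, Finset.sum_range_succ]; ring
      rw [h3]
      simp only [exSeq, colSeq, List.getD_eq_getElem _ _ hj,
        List.getD_eq_getElem _ _ (Nat.lt_of_succ_lt hj)]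
      linarith
    rcases Nat.lt_succ_iff_lt_or_eq.mp hij with h | rfl
    · exact h1.trans (ih h (by omega))
    · exact h1

variable [DecidableEq C] [CommRing 𝓡] [Fintype K]

/-- A monomial in two variables, placed at a pair of colours. -/
def mono (z : ℕ → 𝓡ˣ) (c : C) (m : ℤ) (c' : C) (m' : ℤ) (x y : ℕ × C) : 𝓡 :=
  (if x.2 = c then ((z x.1 ^ m : 𝓡ˣ) : 𝓡) else 0) *
    (if y.2 = c' then ((z y.1 ^ m' : 𝓡ˣ) : 𝓡) else 0)

/-- The kernel permutes monomials, after a shift of the exponents by `κ`. -/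
def Kernel.IsMonomial (k : Kernel K C 𝓡) (z : ℕ → 𝓡ˣ) (κ : C → C → ℤ) : Prop :=
  ∀ c c' m m', k.rho (mono z c m c' m') = mono z c (m' - κ c c') c' (m + κ c c')

/-- A monomial in `r` variables placed at a sequence of colours, with shifted exponents. -/
def monoFun (z : ℕ → 𝓡ˣ) (κ : C → C → ℤ) (c : ℕ → C) (r : ℕ) (e : ℕ → ℤ) (x : ℕ → ℕ × C) : 𝓡 :=
  ∏ j ∈ Finset.range r,
    if (x j).2 = c j then ((z (x j).1 ^ (e j - colShift κ c j) : 𝓡ˣ) : 𝓡) else 0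

/-- Consecutive values of `colShift` differ by κ, which absorbs the shift in `IsMonomial`: in the
shifted exponents the operator is a plain transposition. -/
theorem op_monoFun {k : Kernel K C 𝓡} {z : ℕ → 𝓡ˣ} {κ : C → C → ℤ} (hk : k.IsMonomial z κ)
    (c : ℕ → C) {r i : ℕ} (hi : i + 1 < r) (e : ℕ → ℤ) :
    k.op i (monoFun z κ c r e) = monoFun z κ c r (e ∘ Equiv.swap i (i + 1)) := by
  set P : (ℕ → ℕ × C) → 𝓡 := fun x => ∏ j ∈ ((Finset.range r).erase i).erase (i + 1),
    if (x j).2 = c j then ((z (x j).1 ^ (e j - colShift κ c j) : 𝓡ˣ) : 𝓡) else 0 with hP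
  have hP' : ∀ x a b, P (Kernel.put x i a b) = P x := by
    intro x a b
    refine Finset.prod_congr rfl fun j hj => ?_
    simp only [Finset.mem_erase] at hj
    rw [Kernel.put_of_ne _ _ _ _ hj.2.1 hj.1]
  have hi1 : i ∈ Finset.range r := by simp; omega
  have hi2 : i + 1 ∈ (Finset.range r).erase i := by simp; omega
  have h1 : ∀ x, monoFun z κ c r e x = P x * mono z (c i) (e i - colShift κ c i) (c (i + 1))
      (e (i + 1) - colShift κ c (i + 1)) (x i) (x (i + 1)) := by
    intro x
    rw [monoFun, ← Finset.mul_prod_erase _ _ hi1, ← Finset.mul_prod_erase _ _ hi2, mono]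
    ring
  have h2 : ∀ x, monoFun z κ c r (e ∘ Equiv.swap i (i + 1)) x =
      P x * mono z (c i) (e (i + 1) - colShift κ c i) (c (i + 1))
      (e i - colShift κ c (i + 1)) (x i) (x (i + 1)) := by
    intro x
    rw [monoFun, ← Finset.mul_prod_erase _ _ hi1, ← Finset.mul_prod_erase _ _ hi2, mono]
    simp only [Function.comp_apply, Equiv.swap_apply_left, Equiv.swap_apply_right]
    have : P x = ∏ j ∈ ((Finset.range r).erase i).erase (i + 1), if (x j).2 = c j then
        ((z (x j).1 ^ (e (Equiv.swap i (i + 1) j) - colShift κ c j) : 𝓡ˣ) : 𝓡) else 0 := by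
      refine Finset.prod_congr rfl fun j hj => ?_
      simp only [Finset.mem_erase] at hj
      rw [Equiv.swap_apply_of_ne_of_ne hj.2.1 hj.1]
    rw [← this]
    ring
  have h3 : colShift κ c (i + 1) = colShift κ c i - κ (c i) (c (i + 1)) := by
    simp only [colShift, Finset.sum_range_succ]; ring
  funext x
  rw [h2, Kernel.op_apply]
  simp only [h1, hP', Kernel.put_left, Kernel.put_right]
  have h4 := congrFun₂ (hk (c i) (c (i + 1)) (e i - colShift κ c i)
    (e (i + 1) - colShift κ c (i + 1))) (x i) (x (i + 1))
  rw [show e (i + 1) - colShift κ c (i + 1) - κ (c i) (c (i + 1)) = e (i + 1) - colShift κ c i by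
    rw [h3]; ring, show e i - colShift κ c i + κ (c i) (c (i + 1)) = e i - colShift κ c (i + 1) by
    rw [h3]; ring] at h4
  rw [← h4]
  simp only [Kernel.rho, Finset.mul_sum]
  exact Finset.sum_congr rfl fun _ _ => by ring

/-- The ring of Laurent polynomials in infinitely many variables. -/
abbrev LaurentRing : Type := AddMonoidAlgebra ℤ (ℕ →₀ ℤ)

/-- The variables of `LaurentRing`. -/
noncomputable def laurentVar (i : ℕ) : LaurentRingˣ where
  val := AddMonoidAlgebra.single (Finsupp.single i 1) 1
  inv := AddMonoidAlgebra.single (Finsupp.single i (-1)) 1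
  val_inv := by
    rw [AddMonoidAlgebra.single_mul_single, ← Finsupp.single_add]
    simp [AddMonoidAlgebra.one_def]
  inv_val := by
    rw [AddMonoidAlgebra.single_mul_single, ← Finsupp.single_add]
    simp [AddMonoidAlgebra.one_def]

theorem laurentVar_zpow (i : ℕ) (m : ℤ) :
    ((laurentVar i ^ m : LaurentRingˣ) : LaurentRing) =
      AddMonoidAlgebra.single (Finsupp.single i m) 1 := by
  induction m using Int.induction_on with
  | zero => simp [AddMonoidAlgebra.one_def]
  | succ n ih =>
    rw [zpow_add_one, Units.val_mul, ih, laurentVar, AddMonoidAlgebra.single_mul_single,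
      ← Finsupp.single_add, mul_one]
  | pred n ih =>
    rw [zpow_sub_one, Units.val_mul, ih, laurentVar, Units.inv_mk, AddMonoidAlgebra.single_mul_single,
      ← Finsupp.single_add, mul_one, sub_eq_add_neg]

variable (cd)

theorem wordFun_one_eq_prod (z : ℕ → 𝓡ˣ) (l : List (ℤ × S)) (k : ℕ) (x : ℕ → ℕ × C) :
    wordFun cd z 1 l k x =
      ∏ j ∈ Finset.range l.length, letter cd z (l.getD j default) (x (k + j)) := by
  induction l generalizing k with
  | nil => rfl
  | cons a l ih =>
    rw [wordFun, ih, List.length_cons, Finset.prod_range_succ']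
    simp only [one_pow, one_zpow, Units.val_one, one_mul, List.getD_cons_succ, List.getD_cons_zero,
      add_zero]
    rw [mul_comm]
    congr 1
    exact Finset.prod_congr rfl fun j _ => by rw [show k + 1 + j = k + (j + 1) by ring]

theorem wordFun_one_eq_monoFun (z : ℕ → 𝓡ˣ) (κ : C → C → ℤ) (l : List (ℤ × S)) :
    wordFun cd z 1 l 0 = monoFun z κ (colSeq cd l) l.length
      fun j => exSeq cd l j + colShift κ (colSeq cd l) j := by
  funext x
  rw [wordFun_one_eq_prod, monoFun]
  refine Finset.prod_congr rfl fun j _ => ?_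
  simp [letter, colSeq, exSeq]

/-- The coefficient of the word `b` in a function. -/
noncomputable def wordCoeff (b : List (ℤ × S)) : ((ℕ → ℕ × C) → LaurentRing) →+ ℤ where
  toFun F := (F fun j => (j, colSeq cd b j)).coeff
    (∑ j ∈ Finset.range b.length, Finsupp.single j (exSeq cd b j))
  map_zero' := by simp
  map_add' F G := by simp

variable {cd}

theorem wordCoeff_monoFun (b : List (ℤ × S)) (κ : C → C → ℤ) (c : ℕ → C) (e : ℕ → ℤ) :
    wordCoeff cd b (monoFun laurentVar κ c b.length e) =
      if (∀ j < b.length, colSeq cd b j = c j) ∧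
        ∀ j < b.length, exSeq cd b j = e j - colShift κ c j then 1 else 0 := by
  have hw : wordCoeff cd b (monoFun laurentVar κ c b.length e) =
      (monoFun laurentVar κ c b.length e fun j => (j, colSeq cd b j)).coeff
      (∑ j ∈ Finset.range b.length, Finsupp.single j (exSeq cd b j)) := rfl
  rw [hw, monoFun]
  by_cases hc : ∀ j < b.length, colSeq cd b j = c j
  · have h1 : (∏ j ∈ Finset.range b.length, if colSeq cd b j = c j then
        ((laurentVar j ^ (e j - colShift κ c j) : LaurentRingˣ) : LaurentRing) else 0) =
        AddMonoidAlgebra.single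
          (∑ j ∈ Finset.range b.length, Finsupp.single j (e j - colShift κ c j)) 1 := by
      rw [Finset.prod_congr rfl (g := fun j => AddMonoidAlgebra.single
        (Finsupp.single j (e j - colShift κ c j)) (1 : ℤ))]
      · rw [AddMonoidAlgebra.prod_single, Finset.prod_const_one]
      · intro j hj
        rw [if_pos (hc j (Finset.mem_range.mp hj)), laurentVar_zpow]
    rw [h1, AddMonoidAlgebra.coeff_single, Finsupp.single_apply]
    refine if_congr ?_ rfl rfl
    rw [and_iff_right hc]
    have h2 : ∀ (f : ℕ → ℤ) (i : ℕ), i < b.length →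
        (∑ j ∈ Finset.range b.length, Finsupp.single j (f j)) i = f i := by
      intro f i hi
      rw [Finsupp.finsetSum_apply, Finset.sum_eq_single i]
      · simp
      · intro j _ hj; simp [hj]
      · intro h; exact absurd (Finset.mem_range.mpr hi) h
    constructor
    · intro h j hj
      have := DFunLike.congr_fun h j
      rw [h2 _ _ hj, h2 _ _ hj] at this
      exact this.symm
    · intro h
      refine Finset.sum_congr rfl fun j hj => ?_
      rw [h j (Finset.mem_range.mp hj)]
  · rw [if_neg (fun h => hc h.1)]
    push Not at hc
    obtain ⟨j, hj, hne⟩ := hc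
    rw [Finset.prod_eq_zero (Finset.mem_range.mpr hj)]
    · simp
    · simp [hne]

/-- Every term other than the leading one has an ascent in its shifted exponents. It cannot be the
monomial of b: with equal colours the shifts agree, and the shifted exponents of b strictly
decrease. -/
theorem wordCoeff_antisymm [DecidableEq S] {k : Kernel K C LaurentRing} {κ : C → C → ℤ}
    (hk : k.IsMonomial laurentVar κ)
    (hcd : ∀ a b, cd.col a = cd.col b → cd.ex a = cd.ex b → a = b) {N : ℤ × S → ℤ × S → Prop}
    (hN : ∀ a b, N a b → cd.ex b < cd.ex a + κ (cd.col a) (cd.col b)) {b n : List (ℤ × S)}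
    (hb : b.IsChain N) (hn : n.IsChain N) (hbn : n.length = b.length) :
    wordCoeff cd b (antisymm k.op b.length (wordFun cd laurentVar 1 n 0)) =
      if n = b then 1 else 0 := by
  rw [wordFun_one_eq_monoFun cd laurentVar κ n, hbn]
  set e : ℕ → ℤ := fun j => exSeq cd n j + colShift κ (colSeq cd n) j with he
  have h1 := antisymm_sub_mem_span (s := k.op) (n := b.length)
    (E := monoFun laurentVar κ (colSeq cd n) b.length)
    (fun i hi e => op_monoFun hk _ hi e) (e := e)
    (fun i j hij hj => strictAnti_of_isChain hN hn hij (by omega))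
  have h2 : ∀ F ∈ AddSubgroup.closure (monoFun laurentVar κ (colSeq cd n) b.length ''
      {e' | ∃ i j, i < j ∧ j < b.length ∧ e' i ≤ e' j}), wordCoeff cd b F = 0 := by
    intro F hF
    induction hF using AddSubgroup.closure_induction with
    | zero => simp
    | add x y _ _ hx hy => rw [map_add, hx, hy, add_zero]
    | neg x _ hx => rw [map_neg, hx, neg_zero]
    | mem F hF =>
      obtain ⟨e', ⟨i, j, hij, hj, hle⟩, rfl⟩ := hF
      rw [wordCoeff_monoFun, if_neg]
      rintro ⟨hc, hex⟩
      -- Colours agree only at positions below the length, which suffices since the shift at l uses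
      -- colours up to l ≤ j.
      have hs : ∀ l ≤ j, colShift κ (colSeq cd n) l = colShift κ (colSeq cd b) l := by
        intro l hl
        simp only [colShift]
        congr 1
        refine Finset.sum_congr rfl fun t ht => ?_
        rw [Finset.mem_range] at ht
        rw [hc t (by omega), hc (t + 1) (by omega)]
      have h3 := strictAnti_of_isChain hN hb hij hj
      rw [hex i (by omega), hex j hj, hs i hij.le, hs j le_rfl] at h3
      linarith
  have h3 := h2 _ h1
  rw [map_sub, sub_eq_zero] at h3
  rw [h3, wordCoeff_monoFun]
  refine if_congr ⟨?_, ?_⟩ rfl rfl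
  · rintro ⟨hc, hex⟩
    symm
    apply eq_of_colSeq_exSeq hcd hbn.symm hc
    intro j hj
    rw [hex j hj, he]
    ring
  · rintro rfl
    exact ⟨fun _ _ => rfl, fun j _ => by simp [he]⟩

end LeadingCoefficient


/-! ### Linear independence of normal words by comparison of lowest powers of v. -/

section Independence

open Polynomial

theorem HahnSeries.coeff_mul_ofPowerSeries {L : Type*} [CommRing L] {D : LaurentSeries L} {t : ℤ}
    (hD : ∀ s < t, D.coeff s = 0) (Y : PowerSeries L) :
    (D * HahnSeries.ofPowerSeries ℤ L Y).coeff t = D.coeff t * PowerSeries.constantCoeff Y := by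
  have hneg : ∀ s < 0, (HahnSeries.ofPowerSeries ℤ L Y).coeff s = 0 := by
    intro s hs
    rw [HahnSeries.ofPowerSeries_apply]
    apply HahnSeries.embDomain_of_notMem_range
    rintro ⟨n, hn⟩
    simp at hn
    omega
  have h0 : (HahnSeries.ofPowerSeries ℤ L Y).coeff 0 = PowerSeries.constantCoeff Y := by
    have := HahnSeries.ofPowerSeries_apply_coeff (Γ := ℤ) Y 0
    simpa using this
  rw [HahnSeries.coeff_mul, ← h0]
  rw [Finset.sum_eq_single (t, 0)]
  · rintro ⟨i, j⟩ hij hne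
    rw [Finset.mem_antidiagonal] at hij
    obtain ⟨h1, h2, h3⟩ := hij
    simp only [HahnSeries.mem_support] at h1 h2
    have hi : t ≤ i := by by_contra h; exact h1 (hD i (by omega))
    have hj : 0 ≤ j := by by_contra h; exact h2 (hneg j (by omega))
    exact absurd (Prod.ext (by simp only at h3 ⊢; omega) (by simp only at h3 ⊢; omega)) hne
  · intro h
    rw [Finset.mem_antidiagonal] at h
    simp only [HahnSeries.mem_support, add_zero, and_true, not_and_or, not_not] at h
    rcases h with h | h <;> simp [h]

/-- In the lowest degree only the constant terms of the Y contribute, and the functionals f isolate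
each coefficient. As f is only additive, it matters that the coefficients of D are integers. -/
theorem HahnSeries.eq_zero_of_sum_mul_eq_zero {ι L : Type*} [DecidableEq ι] [CommRing L]
    {s : Finset ι} {D : ι → LaurentSeries L} {a : ι → ℤ → ℤ} (ha : ∀ n t, (D n).coeff t = a n t)
    {Y : ι → ι → PowerSeries L} {f : ι → L →+ ℤ}
    (hY : ∀ b ∈ s, ∀ n ∈ s, f b (PowerSeries.constantCoeff (Y b n)) = if n = b then 1 else 0)
    (h : ∀ b ∈ s, ∑ n ∈ s, D n * HahnSeries.ofPowerSeries ℤ L (Y b n) = 0) :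
    ∀ n ∈ s, D n = 0 := by
  -- T bounds the orders of the finitely many D n from below; the vanishing then propagates upwards
  -- one degree at a time.
  obtain ⟨T, hT⟩ := (s.image fun n => (D n).order).bddBelow
  have key : ∀ j : ℕ, ∀ n ∈ s, ∀ t < T + j, (D n).coeff t = 0 := by
    intro j
    induction j with
    | zero =>
      intro n hn t ht
      apply HahnSeries.coeff_eq_zero_of_lt_order
      have := hT (Finset.mem_coe.mpr (Finset.mem_image_of_mem _ hn))
      push_cast at ht
      omega
    | succ j ih =>
      intro b hb t ht
      rcases lt_or_ge t (T + j) with h1 | h1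
      · exact ih b hb t h1
      · have h2 := congrArg (fun F => f b (HahnSeries.coeff F t)) (h b hb)
        simp only [HahnSeries.coeff_sum, map_sum, HahnSeries.coeff_zero, map_zero] at h2
        rw [Finset.sum_congr rfl (g := fun n => if n = b then a n t else 0)] at h2
        · rw [Finset.sum_ite_eq' s b, if_pos hb] at h2
          rw [ha, h2, Int.cast_zero]
        · intro n hn
          rw [HahnSeries.coeff_mul_ofPowerSeries
            (fun s' hs' => ih n hn s' (by push_cast at ht; omega)), ha, ← zsmul_eq_mul, map_zsmul,
            hY b hb n hn, smul_eq_mul]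
          simp
  intro n hn
  ext t
  rw [HahnSeries.coeff_zero]
  exact key (t - T).toNat.succ n hn t (by push_cast; omega)

/-- The variable of the ring of Laurent series. -/
noncomputable def seriesVar (L : Type*) [CommRing L] : (LaurentSeries L)ˣ where
  val := HahnSeries.single 1 1
  inv := HahnSeries.single (-1) 1
  val_inv := by simp
  inv_val := by simp

theorem seriesVar_zpow (L : Type*) [CommRing L] (m : ℤ) :
    ((seriesVar L ^ m : (LaurentSeries L)ˣ) : LaurentSeries L) = HahnSeries.single m 1 := by
  induction m using Int.induction_on with
  | zero => simp
  | succ n ih => rw [zpow_add_one, Units.val_mul, ih, seriesVar, HahnSeries.single_mul_single, mul_one]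
  | pred n ih =>
    rw [zpow_sub_one, Units.val_mul, ih, seriesVar, Units.inv_mk, HahnSeries.single_mul_single,
      mul_one, sub_eq_add_neg]

theorem coeff_eval₂_mul {L : Type*} [CommRing L] (p : ℤ[X]) (m w t : ℤ) :
    (p.eval₂ (Int.castRingHom (LaurentSeries L)) (HahnSeries.single m 1) *
      HahnSeries.single w 1).coeff t =
        ((p.sum fun k a => if t = k * m + w then a else 0 : ℤ) : L) := by
  rw [Polynomial.eval₂_eq_sum, Polynomial.sum_def, Polynomial.sum_def, Finset.sum_mul,
    HahnSeries.coeff_sum, Int.cast_sum]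
  refine Finset.sum_congr rfl fun k _ => ?_
  rw [HahnSeries.single_pow, one_pow, mul_assoc, HahnSeries.single_mul_single, mul_one, eq_intCast,
    ← zsmul_eq_mul, HahnSeries.coeff_smul, HahnSeries.coeff_single, nsmul_eq_mul]
  split_ifs <;> simp

/-- For m ≠ 0, distinct powers of X go to distinct powers of v. -/
theorem eq_zero_of_eval₂_mul_eq_zero {L : Type*} [CommRing L] [CharZero L] {p : ℤ[X]} {m w : ℤ}
    (hm : m ≠ 0) (h : p.eval₂ (Int.castRingHom (LaurentSeries L)) (HahnSeries.single m 1) *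
      HahnSeries.single w 1 = 0) : p = 0 := by
  ext k
  have h1 := coeff_eval₂_mul (L := L) p m w (k * m + w)
  rw [h, HahnSeries.coeff_zero, eq_comm, Int.cast_eq_zero, Polynomial.sum_def] at h1
  rw [Polynomial.coeff_zero]
  by_contra hk
  rw [Finset.sum_eq_single k] at h1
  · simp at h1; exact hk h1
  · intro j _ hj
    rw [if_neg]
    intro h2
    have h3 : (k : ℤ) * m = j * m := by linarith
    exact hj (by exact_mod_cast (mul_right_cancel₀ hm h3).symm)
  · intro h2
    simp at h2
    simp [h2]

theorem laurentSeries_two_mul {x : LaurentSeries LaurentRing} (h : 2 * x = 0) : x = 0 := by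
  ext t i
  have h1 := congrArg (fun F => (HahnSeries.coeff F t).coeff i) h
  simp [two_mul] at h1 ⊢
  omega

instance : CharZero LaurentRing :=
  charZero_of_injective_algebraMap (R := ℤ) (by
    intro a b h
    have h1 := congrArg (fun F => AddMonoidAlgebra.coeff F 0) h
    simpa [AddMonoidAlgebra.intCast_def] using h1)

theorem wordFun_map {S : Type} {C 𝓡 𝓡' : Type*} [DecidableEq C] [CommRing 𝓡] [CommRing 𝓡']
    (f : 𝓡 →+* 𝓡') (cd : Coding S C) (z : ℕ → 𝓡ˣ) (l : List (ℤ × S)) (k : ℕ) :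
    wordFun cd (fun i => Units.map f.toMonoidHom (z i)) 1 l k = f ∘ wordFun cd z 1 l k := by
  funext x
  induction l generalizing k with
  | nil => simp [wordFun]
  | cons a l ih =>
    simp only [wordFun, ih, Function.comp_apply, map_mul, letter, one_pow, one_zpow, Units.val_one,
      map_one, ← map_zpow, apply_ite f, map_zero]
    rfl

/-- The variables of `LaurentRing`, in the ring of Laurent series. -/
noncomputable def seriesLaurentVar (i : ℕ) : (LaurentSeries LaurentRing)ˣ :=
  Units.map (HahnSeries.ofPowerSeries ℤ LaurentRing).toMonoidHom
    (Units.map (PowerSeries.C (R := LaurentRing)).toMonoidHom (laurentVar i))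

/-- The kernel lives over power series in v. Over Laurent series it kills the relations, whose
parameter is a negative power of v; at v = 0 it is monomial and exhibits the leading terms. -/
theorem eq_zero_of_linearCombination_mem_relIdeal {S : Type} [Inhabited S] [DecidableEq S]
    {K C : Type*} [DecidableEq C] [Fintype K] {cd : Coding S C}
    (hcd : ∀ a b, cd.col a = cd.col b → cd.ex a = cd.ex b → a = b)
    {κ : C → C → ℤ} {N : ℤ × S → ℤ × S → Prop}
    (hN : ∀ a b, N a b → cd.ex b < cd.ex a + κ (cd.col a) (cd.col b))
    {k : Kernel K C (PowerSeries LaurentRing)}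
    (hb : (k.map (HahnSeries.ofPowerSeries ℤ LaurentRing)).IsBraided)
    (hm : (k.map PowerSeries.constantCoeff).IsMonomial laurentVar κ)
    [Algebra ℤ[X] (LaurentSeries LaurentRing)] {m : ℤ} (hm0 : m ≠ 0)
    (hX : algebraMap ℤ[X] (LaurentSeries LaurentRing) X = HahnSeries.single m 1)
    {gens : Set (TypRing ℤ[X] S)}
    (hg : ∀ g ∈ gens, ∃ N G,
      (g, G) ∈ pairSpan cd seriesLaurentVar (seriesVar LaurentRing)⁻¹ ℤ[X] N ∧
      (k.map (HahnSeries.ofPowerSeries ℤ LaurentRing)).rho G = G) :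
    ∀ c ∈ Finsupp.supported ℤ[X] ℤ[X] {n : List (ℤ × S) | n.IsChain N},
      Finsupp.linearCombination ℤ[X] (wd ℤ[X]) c ∈ relIdeal gens → c = 0 := by
  intro c hc hcI
  have halg : ∀ p : ℤ[X], algebraMap ℤ[X] (LaurentSeries LaurentRing) p =
      p.eval₂ (Int.castRingHom (LaurentSeries LaurentRing)) (HahnSeries.single m 1) := by
    intro p
    have : algebraMap ℤ[X] (LaurentSeries LaurentRing) = Polynomial.eval₂RingHom
        (Int.castRingHom (LaurentSeries LaurentRing)) (HahnSeries.single m 1) := by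
      apply Polynomial.ringHom_ext
      · intro a; simp
      · simp [hX]
    rw [this]; rfl
  -- The coefficient of n at X = v^m, times the power of v coming from the twist by V = v⁻¹. All
  -- coefficients are integers.
  set D : List (ℤ × S) → LaurentSeries LaurentRing := fun n =>
    (c n).eval₂ (Int.castRingHom (LaurentSeries LaurentRing)) (HahnSeries.single m 1) *
      HahnSeries.single (-posSum n) 1 with hD
  set ψ := HahnSeries.ofPowerSeries ℤ LaurentRing with hψ
  let F : List (ℤ × S) → (ℕ → ℕ × C) → LaurentRing := fun n => wordFun cd laurentVar 1 n 0
  let Y : ℕ → List (ℤ × S) → (ℕ → ℕ × C) → PowerSeries LaurentRing :=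
    fun r n => antisymm k.op r (PowerSeries.C (R := LaurentRing) ∘ F n)
  -- Once the twist is removed, the antisymmetrization already takes place over power series.
  have hwf : ∀ r n, antisymm (k.map ψ).op r
      (wordFun cd seriesLaurentVar (seriesVar LaurentRing)⁻¹ n 0) =
      fun x => HahnSeries.single (-posSum n) 1 * ψ (Y r n x) := by
    intro r n
    have h1 : wordFun cd seriesLaurentVar (seriesVar LaurentRing)⁻¹ n 0 =
        (HahnSeries.single (-posSum n) 1 : LaurentSeries LaurentRing) •
          (ψ ∘ (PowerSeries.C (R := LaurentRing) ∘ F n)) := by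
      funext x
      rw [wordFun_eq_smul, Pi.smul_apply, smul_eq_mul, inv_zpow', Nat.cast_zero, zero_mul, add_zero,
        seriesVar_zpow]
      congr 1
      have h2 := wordFun_map PowerSeries.C cd laurentVar n 0
      have h3 := wordFun_map ψ cd
        (fun i => Units.map (PowerSeries.C (R := LaurentRing)).toMonoidHom (laurentVar i)) n 0
      rw [h2] at h3
      exact congrFun h3 x
    rw [h1, map_smul, Kernel.map_antisymm]
    rfl
  have hker := relIdeal_le_ker_wdAntisymm hb (fun x hx => laurentSeries_two_mul hx) hg
  have hD0 : ∀ r, ∀ n ∈ c.support.filter (fun n => n.length = r), D n = 0 := by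
    intro r
    apply HahnSeries.eq_zero_of_sum_mul_eq_zero (L := LaurentRing)
      (a := fun n t => (c n).sum fun k a => if t = k * m + -posSum n then a else 0)
      (fun n t => coeff_eval₂_mul (c n) m _ t)
      (Y := fun b n => Y r n fun j => (j, colSeq cd b j))
      (f := fun b => (AddMonoidHom.mk' (fun y : LaurentRing => y.coeff
        (∑ j ∈ Finset.range b.length, Finsupp.single j (exSeq cd b j))) (by intros; simp)))
    · intro b hbs n hns
      rw [Finset.mem_filter] at hbs hns
      have h1 : PowerSeries.constantCoeff ∘ Y r n =
          antisymm (k.map PowerSeries.constantCoeff).op r (F n) := by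
        rw [← Kernel.map_antisymm]
        congr 1
      have h2 := wordCoeff_antisymm hm hcd hN (hc hbs.1) (hc hns.1) (hns.2.trans hbs.2.symm)
      rw [hbs.2] at h2
      change wordCoeff cd b (antisymm (k.map PowerSeries.constantCoeff).op r (F n)) = _ at h2
      rw [← h1] at h2
      exact h2
    · intro b hbs
      have h1 : wdAntisymm cd seriesLaurentVar (seriesVar LaurentRing)⁻¹ (k.map ψ) r
          (Finsupp.linearCombination ℤ[X] (wd ℤ[X]) c) = 0 := hker r hcI
      rw [Finsupp.linearCombination_apply, Finsupp.sum, map_sum] at h1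
      have h2 := congrFun h1 fun j => (j, colSeq cd b j)
      rw [Finset.sum_apply, Pi.zero_apply] at h2
      rw [Finset.sum_filter]
      refine Eq.trans ?_ h2
      refine Finset.sum_congr rfl fun n _ => ?_
      rw [map_smul, Pi.smul_apply, wdAntisymm, wdLift_wd, Algebra.smul_def, halg]
      split_ifs with hr
      · rw [hwf]
        exact mul_assoc _ _ _
      · simp
  ext1 n
  by_cases hn : n ∈ c.support
  · exact eq_zero_of_eval₂_mul_eq_zero hm0
      (hD0 n.length n (Finset.mem_filter.mpr ⟨hn, rfl⟩))
  · simpa using hn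

end Independence


/-! ### The R-matrix of the symmetric case: unitarity and the Yang-Baxter equation. -/

section SymmetricKernel

variable {𝓡 : Type*} [CommRing 𝓡]

/-- The `R`-matrix of the symmetric case, up to the scalar `(z - v² w)²`. A colour consists of the
parity of an exponent and a sign, both encoded as Booleans. -/
def symN (v ε : 𝓡) (z : ℕ → 𝓡) : Kernel (Fin 4) (Bool × Bool) 𝓡 where
  t κ c c' := match κ with
    | 0 => (c, c')
    | 1 => if c.1 = c'.1 then ((!c.1, c.2), (!c'.1, c'.2)) else (c', c)
    | 2 => ((c.1, !c.2), (c'.1, !c'.2))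
    | 3 => ((!c.1, !c.2), (!c'.1, !c'.2))
  w κ c c' i j :=
    if c.1 = c'.1 then
      if c.2 = c'.2 then
        match κ with
        | 0 => (1 - v ^ 2) ^ 2 * z i * z j
        | 1 => (1 - v ^ 2) * v * (z j - z i) * (bif c.1 then 1 else z i * z j)
        | 2 => ε * v ^ 2 * (z j - z i) ^ 2
        | 3 => ε * (1 - v ^ 2) * v * (z j - z i) * (bif c.1 then 1 else z i * z j)
      else match κ with
        | 0 => (z i - v ^ 2 * z j) ^ 2
        | _ => 0
    else match κ with
      | 0 => (1 - v ^ 2) * (bif c.1 then z j else z i) * (z i - v ^ 2 * z j)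
      | 1 => v * (z j - z i) * (z i - v ^ 2 * z j)
      | _ => 0



section rows

variable (v ε : 𝓡) (z : ℕ → 𝓡) (G : ℕ × Bool × Bool → ℕ × Bool × Bool → 𝓡) (i j : ℕ) (p s s' : Bool)

theorem symN_rho_ft : (symN v ε z).rho G (i, false, s) (j, true, s') =
    (1 - v ^ 2) * z i * (z i - v ^ 2 * z j) * G (j, false, s) (i, true, s') +
    v * (z j - z i) * (z i - v ^ 2 * z j) * G (j, true, s') (i, false, s) := by
  simp [Kernel.rho, Fin.sum_univ_four, symN]

theorem symN_rho_tf : (symN v ε z).rho G (i, true, s) (j, false, s') =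
    (1 - v ^ 2) * z j * (z i - v ^ 2 * z j) * G (j, true, s) (i, false, s') +
    v * (z j - z i) * (z i - v ^ 2 * z j) * G (j, false, s') (i, true, s) := by
  simp [Kernel.rho, Fin.sum_univ_four, symN]

theorem symN_rho_opp : (symN v ε z).rho G (i, p, s) (j, p, !s) =
    (z i - v ^ 2 * z j) ^ 2 * G (j, p, s) (i, p, !s) := by
  simp [Kernel.rho, Fin.sum_univ_four, symN]

theorem symN_rho_opp' : (symN v ε z).rho G (i, p, !s) (j, p, s) =
    (z i - v ^ 2 * z j) ^ 2 * G (j, p, !s) (i, p, s) := by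
  simp [Kernel.rho, Fin.sum_univ_four, symN]

theorem symN_rho_ff : (symN v ε z).rho G (i, false, s) (j, false, s) =
    (1 - v ^ 2) ^ 2 * z i * z j * G (j, false, s) (i, false, s) +
    (1 - v ^ 2) * v * (z j - z i) * (z i * z j) * G (j, true, s) (i, true, s) +
    ε * v ^ 2 * (z j - z i) ^ 2 * G (j, false, !s) (i, false, !s) +
    ε * (1 - v ^ 2) * v * (z j - z i) * (z i * z j) * G (j, true, !s) (i, true, !s) := by
  simp [Kernel.rho, Fin.sum_univ_four, symN]

theorem symN_rho_tt : (symN v ε z).rho G (i, true, s) (j, true, s) =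
    (1 - v ^ 2) ^ 2 * z i * z j * G (j, true, s) (i, true, s) +
    (1 - v ^ 2) * v * (z j - z i) * G (j, false, s) (i, false, s) +
    ε * v ^ 2 * (z j - z i) ^ 2 * G (j, true, !s) (i, true, !s) +
    ε * (1 - v ^ 2) * v * (z j - z i) * G (j, false, !s) (i, false, !s) := by
  simp [Kernel.rho, Fin.sum_univ_four, symN]

end rows

/-- The sign by which the colour triples are rescaled in order to remove `ε`. -/
def gauge (ε : 𝓡) (a b c : ℕ × Bool × Bool) : 𝓡 :=
  bif (a.2.2 && b.2.2) || (a.2.2 && c.2.2) || (b.2.2 && c.2.2) then 1 else ε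

/-- `gauge` is determined by the majority of the three signs. The entries of the kernel that flip
two equal signs reverse the majority and carry a factor ε; all other nonzero entries at most permute
the signs. So the gauge removes ε. -/
theorem symN_rho₁_gauge (v : 𝓡) (z : ℕ → 𝓡)
    (G : ℕ × Bool × Bool → ℕ × Bool × Bool → ℕ × Bool × Bool → 𝓡) :
    (symN v (-1) z).rho₁ (fun a b c => gauge (-1) a b c * G a b c) =
      fun a b c => gauge (-1) a b c * (symN v 1 z).rho₁ G a b c := by
  funext ⟨i, p1, s1⟩ ⟨j, p2, s2⟩ ⟨l, p3, s3⟩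
  simp only [Kernel.rho₁, Kernel.rho, Finset.mul_sum]
  refine Finset.sum_congr rfl fun κ _ => ?_
  obtain h | h : p1 = p2 ∨ p1 ≠ p2 := em _ <;> fin_cases κ <;> cases s1 <;> cases s2 <;>
    cases s3 <;> simp [symN, gauge, h] <;> ring1

theorem symN_rho₂_gauge (v : 𝓡) (z : ℕ → 𝓡)
    (G : ℕ × Bool × Bool → ℕ × Bool × Bool → ℕ × Bool × Bool → 𝓡) :
    (symN v (-1) z).rho₂ (fun a b c => gauge (-1) a b c * G a b c) =
      fun a b c => gauge (-1) a b c * (symN v 1 z).rho₂ G a b c := by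
  funext ⟨i, p1, s1⟩ ⟨j, p2, s2⟩ ⟨l, p3, s3⟩
  simp only [Kernel.rho₂, Kernel.rho, Finset.mul_sum]
  refine Finset.sum_congr rfl fun κ _ => ?_
  obtain h | h : p2 = p3 ∨ p2 ≠ p3 := em _ <;> fin_cases κ <;> cases s1 <;> cases s2 <;>
    cases s3 <;> simp [symN, gauge, h] <;> ring1

set_option linter.unusedSimpArgs false in
theorem symN_one_braid (v : 𝓡) (z : ℕ → 𝓡)
    (G : ℕ × Bool × Bool → ℕ × Bool × Bool → ℕ × Bool × Bool → 𝓡) :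
    (symN v 1 z).rho₁ ((symN v 1 z).rho₂ ((symN v 1 z).rho₁ G)) =
      (symN v 1 z).rho₂ ((symN v 1 z).rho₁ ((symN v 1 z).rho₂ G)) := by
  funext ⟨i, p1, s1⟩ ⟨j, p2, s2⟩ ⟨l, p3, s3⟩
  -- For ε = 1 the kernel commutes with flipping all signs, so only signs relative to the first
  -- matter; what remains are polynomial identities.
  have hb : ∀ a : Bool, a = s1 ∨ a = !s1 := by cases s1 <;> decide
  obtain rfl | rfl := hb s2 <;> obtain rfl | rfl := hb s3 <;> cases p1 <;> cases p2 <;>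
    cases p3 <;>
  simp only [Kernel.rho₁, Kernel.rho₂, symN_rho_ft, symN_rho_tf, symN_rho_opp, symN_rho_opp',
    symN_rho_ff, symN_rho_tt, Bool.not_true, Bool.not_false, Bool.not_not] <;> ring

theorem symN_braid (v ε : 𝓡) (hε : ε = 1 ∨ ε = -1) (z : ℕ → 𝓡)
    (G : ℕ × Bool × Bool → ℕ × Bool × Bool → ℕ × Bool × Bool → 𝓡) :
    (symN v ε z).rho₁ ((symN v ε z).rho₂ ((symN v ε z).rho₁ G)) =
      (symN v ε z).rho₂ ((symN v ε z).rho₁ ((symN v ε z).rho₂ G)) := by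
  obtain rfl | rfl := hε
  · exact symN_one_braid v z G
  · have hG : ∃ G' : ℕ × Bool × Bool → ℕ × Bool × Bool → ℕ × Bool × Bool → 𝓡, G = fun a b c => gauge (-1) a b c * G' a b c := by
      refine ⟨fun a b c => gauge (-1) a b c * G a b c, ?_⟩
      funext a b c
      rw [← mul_assoc]
      have : gauge (-1 : 𝓡) a b c * gauge (-1) a b c = 1 := by
        unfold gauge
        cases (a.2.2 && b.2.2) || (a.2.2 && c.2.2) || (b.2.2 && c.2.2) <;> simp
      rw [this, one_mul]
    obtain ⟨G', rfl⟩ := hG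
    simp only [symN_rho₁_gauge, symN_rho₂_gauge, symN_one_braid]

/-- The `R`-matrix of the symmetric case. -/
def symKernel (v ε : 𝓡) (z : ℕ → 𝓡) (d : ℕ → ℕ → 𝓡) : Kernel (Fin 4) (Bool × Bool) 𝓡 where
  t := (symN v ε z).t
  w κ c c' i j := d i j ^ 2 * (symN v ε z).w κ c c' i j

theorem symKernel_rho (v ε : 𝓡) (z : ℕ → 𝓡) (d : ℕ → ℕ → 𝓡)
    (G : ℕ × Bool × Bool → ℕ × Bool × Bool → 𝓡) (x y) :
    (symKernel v ε z d).rho G x y = d x.1 y.1 ^ 2 * (symN v ε z).rho G x y := by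
  simp only [Kernel.rho, Finset.mul_sum]
  exact Finset.sum_congr rfl fun _ _ => by simp only [symKernel]; ring

/-- Scalars depending only on the two variables pass through with the variables exchanged; this
moves all denominators out of compositions. -/
theorem symN_rho_mul (v ε : 𝓡) (z : ℕ → 𝓡) (f : ℕ → ℕ → 𝓡)
    (G : ℕ × Bool × Bool → ℕ × Bool × Bool → 𝓡) (x y) :
    (symN v ε z).rho (fun a b => f a.1 b.1 * G a b) x y =
      f y.1 x.1 * (symN v ε z).rho G x y := by
  simp only [Kernel.rho, Finset.mul_sum]
  exact Finset.sum_congr rfl fun _ _ => by ring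

theorem symN_rho_rho (v ε : 𝓡) (hε : ε = 1 ∨ ε = -1) (z : ℕ → 𝓡)
    (G : ℕ × Bool × Bool → ℕ × Bool × Bool → 𝓡) (x y) :
    (symN v ε z).rho ((symN v ε z).rho G) x y =
      (z x.1 - v ^ 2 * z y.1) ^ 2 * (z y.1 - v ^ 2 * z x.1) ^ 2 * G x y := by
  obtain ⟨i, p1, s1⟩ := x
  obtain ⟨j, p2, s2⟩ := y
  have hb : s2 = s1 ∨ s2 = !s1 := by cases s1 <;> cases s2 <;> decide
  obtain rfl | rfl := hε <;> obtain rfl | rfl := hb <;> cases p1 <;> cases p2 <;>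
  simp only [symN_rho_ft, symN_rho_tf, symN_rho_opp, symN_rho_ff,
    symN_rho_tt, Bool.not_not] <;> ring

/-- Once the denominators are moved out, both sides of the braid equation carry the same product
over the three pairs of variables. -/
theorem symKernel_isBraided {v ε : 𝓡} (hε : ε = 1 ∨ ε = -1) {z : ℕ → 𝓡} {d : ℕ → ℕ → 𝓡}
    (hd : ∀ i j, d i j * (z i - v ^ 2 * z j) = 1) : (symKernel v ε z d).IsBraided where
  sq G := by
    funext x y
    have : (symKernel v ε z d).rho G =
        fun a b => d a.1 b.1 ^ 2 * (symN v ε z).rho G a b := by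
      funext a b; rw [symKernel_rho]
    rw [this, symKernel_rho, symN_rho_mul v ε z (fun a b => d a b ^ 2), symN_rho_rho v ε hε]
    calc _ = (d x.1 y.1 * (z x.1 - v ^ 2 * z y.1)) ^ 2 *
          (d y.1 x.1 * (z y.1 - v ^ 2 * z x.1)) ^ 2 * G x y := by ring
      _ = G x y := by simp [hd]
  braid G := by
    have h1 : ∀ G, (symKernel v ε z d).rho₁ G =
        fun a b c => d a.1 b.1 ^ 2 * (symN v ε z).rho₁ G a b c := by
      intro G; funext a b c; simp only [Kernel.rho₁, symKernel_rho]
    have h2 : ∀ G, (symKernel v ε z d).rho₂ G =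
        fun a b c => d b.1 c.1 ^ 2 * (symN v ε z).rho₂ G a b c := by
      intro G; funext a b c; simp only [Kernel.rho₂, symKernel_rho]
    have h3 : ∀ (f : ℕ → ℕ → ℕ → 𝓡) G,
        (symN v ε z).rho₁ (fun a b c => f a.1 b.1 c.1 * G a b c) =
        fun a b c => f b.1 a.1 c.1 * (symN v ε z).rho₁ G a b c := by
      intro f G; funext a b c
      simp only [Kernel.rho₁]
      exact symN_rho_mul v ε z (fun i j => f i j c.1) _ _ _
    have h4 : ∀ (f : ℕ → ℕ → ℕ → 𝓡) G,
        (symN v ε z).rho₂ (fun a b c => f a.1 b.1 c.1 * G a b c) =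
        fun a b c => f a.1 c.1 b.1 * (symN v ε z).rho₂ G a b c := by
      intro f G; funext a b c
      simp only [Kernel.rho₂]
      exact symN_rho_mul v ε z (fun i j => f a.1 i j) _ _ _
    rw [h1 G, h2, h1, h2 G, h1, h2]
    rw [h4 (fun a b _ => d a b ^ 2), h3 (fun _ b c => d b c ^ 2), h3 (fun a _ c => d a c ^ 2),
      h4 (fun a b _ => d a b ^ 2), h3 (fun _ b c => d b c ^ 2), h4 (fun a _ c => d a c ^ 2),
      symN_braid v ε hε]
    funext a b c
    ring

theorem symKernel_map {𝓡' : Type*} [CommRing 𝓡'] (f : 𝓡 →+* 𝓡') (v ε : 𝓡) (z : ℕ → 𝓡)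
    (d : ℕ → ℕ → 𝓡) :
    (symKernel v ε z d).map f =
      symKernel (f v) (f ε) (fun i => f (z i)) (fun i j => f (d i j)) := by
  have hif : ∀ (p : Prop) [Decidable p] (a b : 𝓡), f (if p then a else b) =
      if p then f a else f b := fun p _ a b => apply_ite f p a b
  simp only [Kernel.map, symKernel, Kernel.mk.injEq]
  refine ⟨?_, rfl⟩
  funext κ ⟨p, s⟩ ⟨p', s'⟩ i j
  fin_cases κ <;> cases p <;> cases s <;> cases p' <;> cases s' <;> simp [symN]

end SymmetricKernel

/-! ### The scalar R-matrix of the Hermitian and alternating cases. -/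

section HallLittlewoodKernel

variable {𝓡 : Type*} [CommRing 𝓡]

/-- The scalar `(w - v z) / (z - v w)`. -/
def hlKernel (v : 𝓡) (z : ℕ → 𝓡) (d : ℕ → ℕ → 𝓡) : Kernel Unit Unit 𝓡 where
  t _ c c' := (c, c')
  w _ _ _ i j := d i j * (z j - v * z i)

theorem hlKernel_rho (v : 𝓡) (z : ℕ → 𝓡) (d : ℕ → ℕ → 𝓡) (G : ℕ × Unit → ℕ × Unit → 𝓡) (x y) :
    (hlKernel v z d).rho G x y = d x.1 y.1 * (z y.1 - v * z x.1) * G y x := by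
  simp [Kernel.rho, hlKernel]

theorem hlKernel_isBraided {v : 𝓡} {z : ℕ → 𝓡} {d : ℕ → ℕ → 𝓡}
    (hd : ∀ i j, d i j * (z i - v * z j) = 1) : (hlKernel v z d).IsBraided where
  sq G := by
    funext x y
    rw [hlKernel_rho, hlKernel_rho]
    calc _ = (d x.1 y.1 * (z x.1 - v * z y.1)) * (d y.1 x.1 * (z y.1 - v * z x.1)) * G x y := by
          ring
      _ = G x y := by simp [hd]
  braid G := by
    funext x y t
    simp only [Kernel.rho₁, Kernel.rho₂, hlKernel_rho]
    ring

theorem hlKernel_map {𝓡' : Type*} [CommRing 𝓡'] (f : 𝓡 →+* 𝓡') (v : 𝓡) (z : ℕ → 𝓡)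
    (d : ℕ → ℕ → 𝓡) :
    (hlKernel v z d).map f = hlKernel (f v) (fun i => f (z i)) (fun i j => f (d i j)) := by
  simp [Kernel.map, hlKernel]

end HallLittlewoodKernel


/-! ### Denominators over power series, and pair functions. -/

section Series

open Polynomial

/-- The constant term in v of the denominator is the variable z_i, which is a unit. -/
theorem exists_inverse (v : PowerSeries LaurentRing) (hv : PowerSeries.constantCoeff v = 0) :
    ∃ d : ℕ → ℕ → PowerSeries LaurentRing, ∀ i j,
      d i j * (PowerSeries.C (laurentVar i : LaurentRing) -
        v * PowerSeries.C (laurentVar j : LaurentRing)) = 1 := by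
  have : ∀ i j, ∃ d, d * (PowerSeries.C (laurentVar i : LaurentRing) -
        v * PowerSeries.C (laurentVar j : LaurentRing)) = 1 := by
    intro i j
    apply IsUnit.exists_left_inv
    rw [PowerSeries.isUnit_iff_constantCoeff]
    simp [hv]
  choose d hd using this
  exact ⟨d, hd⟩

theorem pairFun_eq {S : Type} {C 𝓡 : Type*} [DecidableEq C] [CommRing 𝓡] (cd : Coding S C)
    (z : ℕ → 𝓡ˣ) (V : 𝓡ˣ) (a b : ℤ × S) (x y : ℕ × C) :
    pairFun cd z V a b x y = ((V ^ b.1 : 𝓡ˣ) : 𝓡) * ((z x.1 ^ cd.ex a : 𝓡ˣ) : 𝓡) *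
      ((z y.1 ^ cd.ex b : 𝓡ˣ) : 𝓡) * (if x.2 = cd.col a ∧ y.2 = cd.col b then 1 else 0) := by
  rw [pairFun, letter, letter]
  by_cases h1 : x.2 = cd.col a <;> by_cases h2 : y.2 = cd.col b <;> simp [h1, h2]

section pairSpan

variable {S : Type} {C 𝓡 U : Type*} [DecidableEq C] [CommRing 𝓡] [CommRing U] [Algebra U 𝓡]
  {cd : Coding S C} {z : ℕ → 𝓡ˣ} {V : 𝓡ˣ} {N : ℤ} {g g' : TypRing U S}
  {G G' : ℕ × C → ℕ × C → 𝓡}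

theorem pairSpan_add (h : (g, G) ∈ pairSpan cd z V U N) (h' : (g', G') ∈ pairSpan cd z V U N) :
    (g + g', G + G') ∈ pairSpan cd z V U N :=
  add_mem h h'

theorem pairSpan_sub (h : (g, G) ∈ pairSpan cd z V U N) (h' : (g', G') ∈ pairSpan cd z V U N) :
    (g - g', G - G') ∈ pairSpan cd z V U N :=
  sub_mem h h'

theorem pairSpan_smul (c : U) (h : (g, G) ∈ pairSpan cd z V U N) :
    (c • g, c • G) ∈ pairSpan cd z V U N :=
  Submodule.smul_mem _ c h

end pairSpan

end Series

/-! ### Normal forms in the Hermitian and alternating cases. -/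

section HallLittlewood

open Polynomial

variable {R : Type*} [CommRing R]

/-- The generators of `Rel` in the Hermitian and alternating cases, for a general parameter. -/
def hlGens (R : Type*) [CommRing R] (t : R) : Set (TypRing R Unit) :=
  {x | ∃ a : ℤ, x = wd R [(a, ()), (a + 1, ())] - wd R [(a + 1, ()), (a, ())]} ∪
  {x | ∃ (a b : ℤ) (k : ℕ), b = a + k + 1 ∧
    x = wd R [(a, ()), (b, ())] - wd R [(a + 1, ()), (b - 1, ())]
      - t ^ k • (wd R [(b, ()), (a, ())] - wd R [(b - 1, ()), (a + 1, ())])}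

/-- The encoding of letters in the Hermitian and alternating cases. -/
def hlCoding : Coding Unit Unit where
  col _ := ()
  ex a := a.1

/-- The relation between consecutive exponents of a weakly decreasing word. -/
def descends {S : Type} (a b : ℤ × S) : Prop := b.1 ≤ a.1

theorem hl_straighten (t : R) (x y : ℤ × Unit) (h : ¬ descends x y) :
    ∃ z ∈ Submodule.span R (wd R '' straighter x y), wd R [x, y] - z ∈ relIdeal (hlGens R t) := by
  obtain ⟨a, u⟩ := x
  obtain ⟨b, u'⟩ := y
  simp only [descends, not_le] at h
  have hmem : ∀ a' b' j : ℤ, 1 ≤ j → a' = a + j → b' = b - j → a + j ≤ b →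
      wd R [(a', ()), (b', ())] ∈ Submodule.span R (wd R '' straighter (a, u) (b, u')) := by
    intro a' b' j h1 h2 h3 h4
    exact Submodule.subset_span ⟨_, ⟨(a', ()), (b', ()), j, h1, h2, h3, h4, rfl⟩, rfl⟩
  -- For b = a + 1 the general relation is twice the commutation relation and would not suffice
  -- without dividing by 2.
  by_cases h1 : b = a + 1
  · refine ⟨wd R [(b, ()), (a, ())], hmem _ _ 1 le_rfl h1 (by omega) (by omega), ?_⟩
    subst h1
    exact subset_relIdeal (Or.inl ⟨a, rfl⟩)
  · refine ⟨wd R [(a + 1, ()), (b - 1, ())] + t ^ (b - a - 1).toNat •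
      (wd R [(b, ()), (a, ())] - wd R [(b - 1, ()), (a + 1, ())]), ?_, ?_⟩
    · refine add_mem (hmem _ _ 1 le_rfl rfl rfl (by omega)) (Submodule.smul_mem _ _ (sub_mem
        (hmem _ _ (b - a) (by omega) (by omega) (by omega) (by omega))
        (hmem _ _ (b - a - 1) (by omega) (by omega) (by omega) (by omega))))
    · apply subset_relIdeal
      refine Or.inr ⟨a, b, (b - a - 1).toNat, by omega, ?_⟩
      exact (sub_sub _ _ _).symm

/-- The factor w - vz of G becomes z - vw after the exchange and cancels the denominator, while the
numerator of the scalar restores it. -/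
theorem hlKernel_rho_eq {𝓡 : Type*} [CommRing 𝓡] {v : 𝓡} {z : ℕ → 𝓡} {d : ℕ → ℕ → 𝓡}
    (hd : ∀ i j, d i j * (z i - v * z j) = 1) {G : ℕ × Unit → ℕ × Unit → 𝓡} {s : ℕ → ℕ → 𝓡}
    (hs : ∀ i j, s i j = s j i) (hG : ∀ x y, G x y = s x.1 y.1 * (z y.1 - v * z x.1)) :
    (hlKernel v z d).rho G = G := by
  funext x y
  rw [hlKernel_rho, hG, hG, hs y.1]
  linear_combination (s x.1 y.1 * (z y.1 - v * z x.1)) * hd x.1 y.1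

/-- At v = 0 the scalar is w / z. -/
theorem hlKernel_isMonomial {d : ℕ → ℕ → LaurentRing}
    (hd : ∀ i j, d i j * (laurentVar i : LaurentRing) = 1) :
    (hlKernel 0 (fun i => (laurentVar i : LaurentRing)) d).IsMonomial laurentVar fun _ _ => 1 := by
  intro c c' m m'
  funext ⟨i, u⟩ ⟨j, u'⟩
  have h1 : d i j = ((laurentVar i)⁻¹ : LaurentRingˣ) := by
    rw [← mul_one (d i j), ← Units.mul_inv (laurentVar i), ← mul_assoc, hd, one_mul]
  rw [hlKernel_rho]
  simp only [mono, h1, if_true, zpow_sub, zpow_add, zpow_one, Units.val_mul]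
  ring

/-- Thanks to the twist V^b in `pairFun`, each generator becomes a symmetric function times w - vz.
-/
theorem hlGens_exists_pairSpan {U 𝓡 : Type*} [CommRing U] [CommRing 𝓡] [Algebra U 𝓡] {v : 𝓡}
    {z : ℕ → 𝓡ˣ} {d : ℕ → ℕ → 𝓡} (hd : ∀ i j, d i j * ((z i : 𝓡) - v * z j) = 1) {V : 𝓡ˣ}
    (hvV : v * V = 1) {t : U} (ht : algebraMap U 𝓡 t = V) :
    ∀ g ∈ hlGens U t, ∃ N G, (g, G) ∈ pairSpan hlCoding z V U N ∧
      (hlKernel v (fun i => (z i : 𝓡)) d).rho G = G := by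
  have htk : ∀ (k : ℕ) (f : 𝓡), t ^ k • f = ((V ^ (k : ℤ) : 𝓡ˣ) : 𝓡) * f := by
    intro k f
    rw [Algebra.smul_def, map_pow, ht, zpow_natCast, Units.val_pow_eq_pow_val]
  rintro g (⟨a, rfl⟩ | ⟨a, b, k, rfl, rfl⟩)
  · refine ⟨2 * a + 1, _, pairSpan_sub (mem_pairSpan _ _ _ (a, ()) (a + 1, ()) _ (by simp; ring))
      (mem_pairSpan _ _ _ (a + 1, ()) (a, ()) _ (by simp; ring)), ?_⟩
    apply hlKernel_rho_eq hd (s := fun i j => ((V ^ (a + 1) * z i ^ a * z j ^ a : 𝓡ˣ) : 𝓡))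
    · intro i j; push_cast; ring
    · intro x y
      simp only [Pi.sub_apply, pairFun_eq, hlCoding, and_self, if_true, zpow_add, zpow_one,
        Units.val_mul]
      linear_combination ((V ^ a : 𝓡ˣ) * ((z x.1 ^ a : 𝓡ˣ) * z x.1) * (z y.1 ^ a : 𝓡ˣ) : 𝓡) * hvV
  · refine ⟨2 * a + k + 1, _, pairSpan_sub (pairSpan_sub
      (mem_pairSpan _ _ _ (a, ()) (a + k + 1, ()) _ (by simp; ring))
      (mem_pairSpan _ _ _ (a + 1, ()) (a + k + 1 - 1, ()) _ (by simp; ring)))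
      (pairSpan_smul (t ^ k) (pairSpan_sub
        (mem_pairSpan _ _ _ (a + k + 1, ()) (a, ()) _ (by simp; ring))
        (mem_pairSpan _ _ _ (a + k + 1 - 1, ()) (a + 1, ()) _ (by simp; ring)))), ?_⟩
    apply hlKernel_rho_eq hd (s := fun i j => (V ^ (a + k + 1) : 𝓡ˣ) *
      ((z i ^ a : 𝓡ˣ) * (z j ^ (a + k) : 𝓡ˣ) + (z j ^ a : 𝓡ˣ) * (z i ^ (a + k) : 𝓡ˣ)))
    · intro i j; ring
    · intro x y
      simp only [Pi.sub_apply, Pi.smul_apply, htk, pairFun_eq,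
        hlCoding, and_self, if_true, add_sub_cancel_right, zpow_add, zpow_one, Units.val_mul]
      linear_combination ((V ^ a : 𝓡ˣ) * (V ^ (k : ℤ) : 𝓡ˣ) *
        ((z x.1 ^ a : 𝓡ˣ) * z x.1 * (z y.1 ^ a : 𝓡ˣ) * (z y.1 ^ (k : ℤ) : 𝓡ˣ) +
          (z x.1 ^ a : 𝓡ˣ) * (z x.1 ^ (k : ℤ) : 𝓡ˣ) * z x.1 * (z y.1 ^ a : 𝓡ˣ)) : 𝓡) * hvV

theorem hl_hasNormalForm_polynomial : HasNormalForm (hlGens ℤ[X] X) descends := by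
  apply HasNormalForm.of_linearIndependent
  · exact wd_mem_span_sup_relIdeal (hl_straighten X)
  obtain ⟨d, hd⟩ := exists_inverse PowerSeries.X (by simp)
  set ψ := HahnSeries.ofPowerSeries ℤ LaurentRing with hψ
  have hψX : ψ PowerSeries.X = seriesVar LaurentRing := HahnSeries.ofPowerSeries_X
  have hk : (hlKernel PowerSeries.X (fun i => PowerSeries.C (laurentVar i : LaurentRing)) d).map ψ =
      hlKernel (seriesVar LaurentRing : LaurentSeries LaurentRing)
        (fun i => (seriesLaurentVar i : LaurentSeries LaurentRing)) fun i j => ψ (d i j) := by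
    rw [hlKernel_map, hψX]
    rfl
  have hd' : ∀ i j, ψ (d i j) * ((seriesLaurentVar i : LaurentSeries LaurentRing) -
      (seriesVar LaurentRing : LaurentSeries LaurentRing) * seriesLaurentVar j) = 1 := by
    intro i j
    have h := congrArg ψ (hd i j)
    rw [map_mul, map_sub, map_mul, hψX, map_one] at h
    exact h
  -- X acts as V = v⁻¹.
  let _ : Algebra ℤ[X] (LaurentSeries LaurentRing) := (Polynomial.eval₂RingHom
    (Int.castRingHom (LaurentSeries LaurentRing)) (HahnSeries.single (-1) 1)).toAlgebra
  have hX : algebraMap ℤ[X] (LaurentSeries LaurentRing) X = HahnSeries.single (-1) 1 :=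
    Polynomial.eval₂_X _ _
  refine eq_zero_of_linearCombination_mem_relIdeal (cd := hlCoding) (κ := fun _ _ => 1)
    (k := hlKernel PowerSeries.X (fun i => PowerSeries.C (laurentVar i : LaurentRing)) d)
    (m := -1) ?_ ?_ ?_ ?_ (by decide) hX ?_
  · rintro ⟨a, u⟩ ⟨b, u'⟩ - h
    exact Prod.ext h rfl
  · intro a b h
    exact Int.lt_add_one_iff.mpr h
  · rw [hk]
    exact hlKernel_isBraided hd'
  · rw [hlKernel_map]
    simp only [PowerSeries.constantCoeff_X, PowerSeries.constantCoeff_C]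
    apply hlKernel_isMonomial
    intro i j
    have := congrArg PowerSeries.constantCoeff (hd i j)
    simpa using this
  · rw [hk]
    exact hlGens_exists_pairSpan hd' (Units.mul_inv _) hX

theorem hl_hasNormalForm (t : R) : HasNormalForm (hlGens R t) descends := by
  set φ := Polynomial.eval₂RingHom (Int.castRingHom R) t with hφ
  have hφX : φ X = t := by simp [φ]
  apply hl_hasNormalForm_polynomial.map φ
  rintro g (⟨a, rfl⟩ | ⟨a, b, k, hb, rfl⟩)
  · exact ⟨_, Or.inl ⟨a, rfl⟩, by simp only [map_sub, mapRingHom_wd]⟩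
  · exact ⟨_, Or.inr ⟨a, b, k, hb, rfl⟩, by
      simp only [map_sub, mapRingHom_smul, mapRingHom_wd, map_pow, hφX]⟩

end HallLittlewood


/-! ### The symmetric case: eigenfunctions of the R-matrix. -/

section SymmetricNormalForm

open Polynomial

/-- The encoding of letters in the symmetric case. -/
def symCoding : Coding ℤˣ (Bool × Bool) where
  col a := (decide (a.1 % 2 = 1), decide (a.2 = 1))
  ex a := a.1 / 2

theorem symCoding_col_even (m : ℤ) (s : ℤˣ) : symCoding.col (2 * m, s) = (false, decide (s = 1)) := by
  simp [symCoding]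

theorem symCoding_col_odd (m : ℤ) (s : ℤˣ) :
    symCoding.col (2 * m + 1, s) = (true, decide (s = 1)) := by
  simp [symCoding]

theorem symCoding_ex_even (m : ℤ) (s : ℤˣ) : symCoding.ex (2 * m, s) = m := by
  simp [symCoding]

theorem symCoding_ex_odd (m : ℤ) (s : ℤˣ) : symCoding.ex (2 * m + 1, s) = m := by
  simp only [symCoding]; omega

theorem decide_neg_eq_one (s : ℤˣ) : decide (-s = 1) = !decide (s = 1) := by
  obtain rfl | rfl := Int.units_eq_one_or s <;> decide

section kernel

variable {𝓡 : Type*} [CommRing 𝓡] (v ε : 𝓡) (z : ℕ → 𝓡)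

/-- The indicator function of a pair of colours. -/
def ind {C : Type*} [DecidableEq C] (c c' : C) (x y : ℕ × C) : 𝓡 :=
  if x.2 = c ∧ y.2 = c' then 1 else 0

/-- A symmetric scalar s is untouched by the exchange, so invariance only has to be checked on the
few functions h treated below, one for each type of generator and parity. -/
theorem symKernel_rho_eq {v ε : 𝓡} {z : ℕ → 𝓡} {d : ℕ → ℕ → 𝓡}
    (hd : ∀ i j, d i j * (z i - v ^ 2 * z j) = 1)
    {G h : ℕ × Bool × Bool → ℕ × Bool × Bool → 𝓡} {s : ℕ → ℕ → 𝓡}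
    (hh : ∀ x y, (symN v ε z).rho h x y = (z x.1 - v ^ 2 * z y.1) ^ 2 * h x y)
    (hs : ∀ i j, s i j = s j i) (hG : ∀ x y, G x y = s x.1 y.1 * h x y) :
    (symKernel v ε z d).rho G = G := by
  have hG' : G = fun x y => s x.1 y.1 * h x y := by funext x y; exact hG x y
  funext x y
  rw [symKernel_rho, hG', symN_rho_mul, hh, hs y.1]
  linear_combination (s x.1 y.1 * h x y) *
    (d x.1 y.1 * (z x.1 - v ^ 2 * z y.1) + 1) * hd x.1 y.1

theorem symN_rho_even_odd (β β' : Bool) (x y : ℕ × Bool × Bool) :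
    (symN v ε z).rho (fun x y => ind (false, β) (true, β') x y -
      v * ind (true, β') (false, β) x y) x y =
      (z x.1 - v ^ 2 * z y.1) ^ 2 * (ind (false, β) (true, β') x y -
      v * ind (true, β') (false, β) x y) := by
  obtain ⟨i, p, s⟩ := x
  obtain ⟨j, p', s'⟩ := y
  have hb : s = s' ∨ s' = !s := by cases s <;> cases s' <;> decide
  cases p <;> cases p' <;> obtain rfl | rfl := hb <;>
    simp only [symN_rho_ft, symN_rho_tf, symN_rho_opp, symN_rho_ff, symN_rho_tt] <;>
    cases s <;> cases β <;> cases β' <;> simp [ind] <;> ring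

theorem symN_rho_odd_even (β β' : Bool) (x y : ℕ × Bool × Bool) :
    (symN v ε z).rho (fun x y => z y.1 * ind (true, β) (false, β') x y -
      v * z x.1 * ind (false, β') (true, β) x y) x y =
      (z x.1 - v ^ 2 * z y.1) ^ 2 * (z y.1 * ind (true, β) (false, β') x y -
      v * z x.1 * ind (false, β') (true, β) x y) := by
  obtain ⟨i, p, s⟩ := x
  obtain ⟨j, p', s'⟩ := y
  have hb : s = s' ∨ s' = !s := by cases s <;> cases s' <;> decide
  cases p <;> cases p' <;> obtain rfl | rfl := hb <;>
    simp only [symN_rho_ft, symN_rho_tf, symN_rho_opp, symN_rho_ff, symN_rho_tt] <;>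
    cases s <;> cases β <;> cases β' <;> simp [ind] <;> ring

theorem symN_rho_opposite (p β : Bool) (x y : ℕ × Bool × Bool) :
    (symN v ε z).rho (ind (p, β) (p, !β)) x y =
      (z x.1 - v ^ 2 * z y.1) ^ 2 * ind (p, β) (p, !β) x y := by
  obtain ⟨i, p₁, s⟩ := x
  obtain ⟨j, p', s'⟩ := y
  have hb : s = s' ∨ s' = !s := by cases s <;> cases s' <;> decide
  cases p₁ <;> cases p' <;> obtain rfl | rfl := hb <;>
    simp only [symN_rho_ft, symN_rho_tf, symN_rho_opp, symN_rho_ff, symN_rho_tt] <;>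
    cases s <;> cases β <;> cases p <;> simp [ind]

theorem symN_rho_even_even (hε : ε = 1 ∨ ε = -1) (β : Bool) (x y : ℕ × Bool × Bool) :
    (symN v ε z).rho (fun x y => -v * z x.1 * z y.1 * ind (false, β) (false, β) x y +
      z y.1 * ind (true, β) (true, β) x y - ε * v * z x.1 * z y.1 * ind (false, !β) (false, !β) x y +
      ε * v ^ 2 * z x.1 * ind (true, !β) (true, !β) x y) x y =
      (z x.1 - v ^ 2 * z y.1) ^ 2 * (-v * z x.1 * z y.1 * ind (false, β) (false, β) x y +
      z y.1 * ind (true, β) (true, β) x y - ε * v * z x.1 * z y.1 * ind (false, !β) (false, !β) x y +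
      ε * v ^ 2 * z x.1 * ind (true, !β) (true, !β) x y) := by
  obtain ⟨i, p, s⟩ := x
  obtain ⟨j, p', s'⟩ := y
  have hb : s = s' ∨ s' = !s := by cases s <;> cases s' <;> decide
  obtain rfl | rfl := hε <;> cases p <;> cases p' <;> obtain rfl | rfl := hb <;>
    simp only [symN_rho_ft, symN_rho_tf, symN_rho_opp, symN_rho_ff, symN_rho_tt] <;>
    cases s <;> cases β <;> simp [ind] <;> ring

theorem symN_rho_odd_odd (hε : ε = 1 ∨ ε = -1) (β : Bool) (x y : ℕ × Bool × Bool) :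
    (symN v ε z).rho (fun x y => -v * ind (true, β) (true, β) x y +
      z y.1 * ind (false, β) (false, β) x y - ε * v * ind (true, !β) (true, !β) x y +
      ε * v ^ 2 * z x.1 * ind (false, !β) (false, !β) x y) x y =
      (z x.1 - v ^ 2 * z y.1) ^ 2 * (-v * ind (true, β) (true, β) x y +
      z y.1 * ind (false, β) (false, β) x y - ε * v * ind (true, !β) (true, !β) x y +
      ε * v ^ 2 * z x.1 * ind (false, !β) (false, !β) x y) := by
  obtain ⟨i, p, s⟩ := x
  obtain ⟨j, p', s'⟩ := y
  have hb : s = s' ∨ s' = !s := by cases s <;> cases s' <;> decide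
  obtain rfl | rfl := hε <;> cases p <;> cases p' <;> obtain rfl | rfl := hb <;>
    simp only [symN_rho_ft, symN_rho_tf, symN_rho_opp, symN_rho_ff, symN_rho_tt] <;>
    cases s <;> cases β <;> simp [ind] <;> ring

end kernel

end SymmetricNormalForm


/-! ### The symmetric case: the generators as invariant functions. -/

section SymmetricNormalForm

open Polynomial

variable {R : Type*} [CommRing R]

/-- The combination of words given by `RelHalf`, in terms of characters. -/
noncomputable def halfRel (R : Type*) [CommRing R] (ε : ℤˣ) (a b : ℤ) (s : ℤˣ) : TypRing R ℤˣ :=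
  -wd R [(a, s), (b, s)] + wd R [(a - 1, s), (b + 1, s)]
    - ((ε : ℤ) : R) • (wd R [(a, -s), (b, -s)] - wd R [(a + 1, -s), (b - 1, -s)])

/-- The generators of `Rel` in the symmetric case in terms of characters, for a general parameter
and saturated with respect to division by `2`. -/
def symGens (R : Type*) [CommRing R] (t : R) (ε : ℤˣ) : Set (TypRing R ℤˣ) :=
  {x | ∃ (a : ℤ) (s₁ s₂ : ℤˣ), x = wd R [(a, s₁), (a + 1, s₂)] - wd R [(a + 1, s₂), (a, s₁)]} ∪
  {x | ∃ (a b : ℤ) (s₁ s₂ : ℤˣ) (k : ℕ), b = a + 2 * k + 1 ∧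
    x = wd R [(a, s₁), (b, s₂)] - wd R [(a + 1, s₂), (b - 1, s₁)]
      - t ^ k • (wd R [(b, s₂), (a, s₁)] - wd R [(b - 1, s₁), (a + 1, s₂)])} ∪
  {x | ∃ (a : ℤ) (s : ℤˣ), x = wd R [(a, s), (a, -s)]} ∪
  {x | ∃ (a b : ℤ) (s : ℤˣ) (k : ℕ), b = a + 2 * k ∧
    x = wd R [(a, s), (b, -s)] + t ^ k • wd R [(b, s), (a, -s)]} ∪
  {x | ∃ (a : ℤ) (s : ℤˣ), x = halfRel R ε a a s} ∪
  {x | ∃ (a b : ℤ) (s : ℤˣ) (k : ℕ), b = a + 2 * k ∧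
    x = halfRel R ε a b s + t ^ k • halfRel R ε b a s}

theorem pairFun_eq_ind {S : Type} {C 𝓡 : Type*} [DecidableEq C] [CommRing 𝓡] (cd : Coding S C)
    (z : ℕ → 𝓡ˣ) (V : 𝓡ˣ) (a b : ℤ × S) (x y : ℕ × C) :
    pairFun cd z V a b x y = ((V ^ b.1 : 𝓡ˣ) : 𝓡) * ((z x.1 ^ cd.ex a : 𝓡ˣ) : 𝓡) *
      ((z y.1 ^ cd.ex b : 𝓡ˣ) : 𝓡) * ind (cd.col a) (cd.col b) x y :=
  pairFun_eq cd z V a b x y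

section generators

variable {U 𝓡 : Type*} [CommRing U] [CommRing 𝓡] [Algebra U 𝓡] {v : 𝓡}
    {z : ℕ → 𝓡ˣ} {d : ℕ → ℕ → 𝓡} {V : 𝓡ˣ} {t : U} (ε : ℤˣ)

theorem pow_smul_eq (ht : algebraMap U 𝓡 t = ((V ^ 2 : 𝓡ˣ) : 𝓡)) (k : ℕ) (f : 𝓡) :
    t ^ k • f = ((V ^ (2 * (k : ℤ)) : 𝓡ˣ) : 𝓡) * f := by
  rw [Algebra.smul_def, map_pow, ht, zpow_mul, zpow_natCast, Units.val_pow_eq_pow_val]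
  rfl

theorem intCast_smul_eq (f : 𝓡) : ((ε : ℤ) : U) • f = ((ε : ℤ) : 𝓡) * f := by
  rw [Algebra.smul_def, map_intCast]

variable (hd : ∀ i j, d i j * ((z i : 𝓡) - v ^ 2 * z j) = 1) (hvV : v * V = 1)
  (ht : algebraMap U 𝓡 t = ((V ^ 2 : 𝓡ˣ) : 𝓡))

include hd hvV

theorem exists_pairSpan_commute (a : ℤ) (s₁ s₂ : ℤˣ) : ∃ N G,
    (wd U [(a, s₁), (a + 1, s₂)] - wd U [(a + 1, s₂), (a, s₁)], G) ∈ pairSpan symCoding z V U N ∧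
      (symKernel v ((ε : ℤ) : 𝓡) (fun i => (z i : 𝓡)) d).rho G = G := by
  refine ⟨2 * a + 1, _, pairSpan_sub (mem_pairSpan _ _ _ (a, s₁) (a + 1, s₂) _ (by simp; ring))
      (mem_pairSpan _ _ _ (a + 1, s₂) (a, s₁) _ (by simp; ring)), ?_⟩
  obtain ⟨m, rfl | rfl⟩ := Int.even_or_odd' a
  · apply symKernel_rho_eq hd (symN_rho_even_odd _ _ _ (decide (s₁ = 1)) (decide (s₂ = 1)))
      (s := fun i j => (V ^ (2 * m + 1) : 𝓡ˣ) * (z i ^ m : 𝓡ˣ) * (z j ^ m : 𝓡ˣ))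
    · intro i j; ring
    · intro x y
      simp only [Pi.sub_apply, pairFun_eq, symCoding_col_even, symCoding_col_odd,
        symCoding_ex_even, symCoding_ex_odd, zpow_add, zpow_one, Units.val_mul, ind]
      linear_combination ((V ^ (2 * m) : 𝓡ˣ) * (z x.1 ^ m : 𝓡ˣ) * (z y.1 ^ m : 𝓡ˣ) *
        (if x.2 = (true, decide (s₂ = 1)) ∧ y.2 = (false, decide (s₁ = 1)) then 1 else 0) : 𝓡) * hvV
  · apply symKernel_rho_eq hd (symN_rho_odd_even _ _ _ (decide (s₁ = 1)) (decide (s₂ = 1)))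
      (s := fun i j => (V ^ (2 * m + 1 + 1) : 𝓡ˣ) * (z i ^ m : 𝓡ˣ) * (z j ^ m : 𝓡ˣ))
    · intro i j; ring
    · intro x y
      simp only [Pi.sub_apply, pairFun_eq, show 2 * m + 1 + 1 = 2 * (m + 1) by ring,
        symCoding_col_even, symCoding_col_odd, symCoding_ex_even, symCoding_ex_odd, ind]
      rw [show 2 * (m + 1) = 2 * m + 1 + 1 by ring]
      simp only [zpow_add, zpow_one, Units.val_mul]
      linear_combination ((V ^ (2 * m) : 𝓡ˣ) * V * (z x.1 ^ m : 𝓡ˣ) * z x.1 * (z y.1 ^ m : 𝓡ˣ) *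
        (if x.2 = (false, decide (s₂ = 1)) ∧ y.2 = (true, decide (s₁ = 1)) then 1 else 0) : 𝓡) * hvV

include ht

theorem exists_pairSpan_odd (a b : ℤ) (s₁ s₂ : ℤˣ) (k : ℕ) (hb : b = a + 2 * k + 1) : ∃ N G,
    (wd U [(a, s₁), (b, s₂)] - wd U [(a + 1, s₂), (b - 1, s₁)]
      - t ^ k • (wd U [(b, s₂), (a, s₁)] - wd U [(b - 1, s₁), (a + 1, s₂)]), G) ∈
        pairSpan symCoding z V U N ∧
      (symKernel v ((ε : ℤ) : 𝓡) (fun i => (z i : 𝓡)) d).rho G = G := by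
  refine ⟨a + b, _, pairSpan_sub (pairSpan_sub
      (mem_pairSpan _ _ _ (a, s₁) (b, s₂) _ (by simp))
      (mem_pairSpan _ _ _ (a + 1, s₂) (b - 1, s₁) _ (by simp)))
      (pairSpan_smul (t ^ k) (pairSpan_sub
        (mem_pairSpan _ _ _ (b, s₂) (a, s₁) _ (by simp; ring))
        (mem_pairSpan _ _ _ (b - 1, s₁) (a + 1, s₂) _ (by simp; ring)))), ?_⟩
  obtain ⟨m, rfl | rfl⟩ := Int.even_or_odd' a
  · apply symKernel_rho_eq hd (symN_rho_even_odd _ _ _ (decide (s₁ = 1)) (decide (s₂ = 1)))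
      (s := fun i j => (V ^ b : 𝓡ˣ) * ((z i ^ m : 𝓡ˣ) * (z j ^ (m + k) : 𝓡ˣ) +
        (z i ^ (m + k) : 𝓡ˣ) * (z j ^ m : 𝓡ˣ)))
    · intro i j; ring
    · intro x y
      obtain rfl : b = 2 * (m + k) + 1 := by linarith
      simp only [Pi.sub_apply, Pi.smul_apply, pow_smul_eq ht, pairFun_eq, add_sub_cancel_right,
        symCoding_col_even, symCoding_col_odd, symCoding_ex_even, symCoding_ex_odd, ind]
      simp only [mul_add, zpow_add, zpow_one, Units.val_mul]
      linear_combination ((V ^ (2 * m) : 𝓡ˣ) * (V ^ (2 * (k : ℤ)) : 𝓡ˣ) *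
        ((z x.1 ^ m : 𝓡ˣ) * (z y.1 ^ m : 𝓡ˣ) * (z y.1 ^ (k : ℤ) : 𝓡ˣ) +
          (z x.1 ^ m : 𝓡ˣ) * (z x.1 ^ (k : ℤ) : 𝓡ˣ) * (z y.1 ^ m : 𝓡ˣ)) *
        (if x.2 = (true, decide (s₂ = 1)) ∧ y.2 = (false, decide (s₁ = 1)) then 1 else 0) : 𝓡) * hvV
  · apply symKernel_rho_eq hd (symN_rho_odd_even _ _ _ (decide (s₁ = 1)) (decide (s₂ = 1)))
      (s := fun i j => (V ^ b : 𝓡ˣ) * ((z i ^ m : 𝓡ˣ) * (z j ^ (m + k) : 𝓡ˣ) +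
        (z i ^ (m + k) : 𝓡ˣ) * (z j ^ m : 𝓡ˣ)))
    · intro i j; ring
    · intro x y
      obtain rfl : b = 2 * (m + k + 1) := by linarith
      simp only [Pi.sub_apply, Pi.smul_apply, pow_smul_eq ht, pairFun_eq,
        show 2 * m + 1 + 1 = 2 * (m + 1) by ring,
        show 2 * (m + (k : ℤ) + 1) - 1 = 2 * (m + k) + 1 by ring,
        symCoding_col_even, symCoding_col_odd, symCoding_ex_even, symCoding_ex_odd, ind]
      rw [show 2 * (m + (k : ℤ) + 1) = 2 * m + 2 * k + 1 + 1 by ring,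
        show 2 * (m + (k : ℤ)) = 2 * m + 2 * k by ring,
        show 2 * (m + 1) = 2 * m + 1 + 1 by ring]
      simp only [zpow_add, zpow_one, Units.val_mul]
      linear_combination ((V ^ (2 * m) : 𝓡ˣ) * (V ^ (2 * (k : ℤ)) : 𝓡ˣ) * V * z x.1 *
        ((z x.1 ^ m : 𝓡ˣ) * (z y.1 ^ m : 𝓡ˣ) * (z y.1 ^ (k : ℤ) : 𝓡ˣ) +
          (z x.1 ^ m : 𝓡ˣ) * (z x.1 ^ (k : ℤ) : 𝓡ˣ) * (z y.1 ^ m : 𝓡ˣ)) *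
        (if x.2 = (false, decide (s₂ = 1)) ∧ y.2 = (true, decide (s₁ = 1)) then 1 else 0) : 𝓡) * hvV

omit hvV ht in
theorem exists_pairSpan_opposite_self (a : ℤ) (s : ℤˣ) : ∃ N G,
    (wd U [(a, s), (a, -s)], G) ∈ pairSpan symCoding z V U N ∧
      (symKernel v ((ε : ℤ) : 𝓡) (fun i => (z i : 𝓡)) d).rho G = G := by
  refine ⟨2 * a, _, mem_pairSpan _ _ _ (a, s) (a, -s) _ (by simp; ring), ?_⟩
  -- Parity and half exponent depend only on a, so both parities are treated at once.
  obtain ⟨p, m, hp⟩ : ∃ (p : Bool) (m : ℤ), ∀ s, symCoding.col (a, s) = (p, decide (s = 1)) ∧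
      symCoding.ex (a, s) = m := ⟨decide (a % 2 = 1), a / 2, fun s => ⟨rfl, rfl⟩⟩
  apply symKernel_rho_eq hd (symN_rho_opposite _ _ _ p (decide (s = 1)))
    (s := fun i j => (V ^ a : 𝓡ˣ) * (z i ^ m : 𝓡ˣ) * (z j ^ m : 𝓡ˣ))
  · intro i j; ring
  · intro x y
    simp only [pairFun_eq, (hp _).1, (hp _).2, decide_neg_eq_one, ind]

omit hvV in
theorem exists_pairSpan_opposite (a b : ℤ) (s : ℤˣ) (k : ℕ) (hb : b = a + 2 * k) : ∃ N G,
    (wd U [(a, s), (b, -s)] + t ^ k • wd U [(b, s), (a, -s)], G) ∈ pairSpan symCoding z V U N ∧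
      (symKernel v ((ε : ℤ) : 𝓡) (fun i => (z i : 𝓡)) d).rho G = G := by
  refine ⟨a + b, _, pairSpan_add (mem_pairSpan _ _ _ (a, s) (b, -s) _ (by simp))
    (pairSpan_smul _ (mem_pairSpan _ _ _ (b, s) (a, -s) _ (by simp; ring))), ?_⟩
  obtain ⟨p, m, hp⟩ : ∃ (p : Bool) (m : ℤ), ∀ s, symCoding.col (a, s) = (p, decide (s = 1)) ∧
      symCoding.ex (a, s) = m := ⟨decide (a % 2 = 1), a / 2, fun s => ⟨rfl, rfl⟩⟩
  obtain ⟨n, hn⟩ : ∃ n : ℤ, ∀ s, symCoding.col (b, s) = (p, decide (s = 1)) ∧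
      symCoding.ex (b, s) = n := by
    refine ⟨b / 2, fun s => ⟨?_, rfl⟩⟩
    rw [← (hp s).1]
    simp only [symCoding, show b % 2 = a % 2 by omega]
  apply symKernel_rho_eq hd (symN_rho_opposite _ _ _ p (decide (s = 1)))
    (s := fun i j => (V ^ b : 𝓡ˣ) * ((z i ^ m : 𝓡ˣ) * (z j ^ n : 𝓡ˣ) +
      (z i ^ n : 𝓡ˣ) * (z j ^ m : 𝓡ˣ)))
  · intro i j; ring
  · intro x y
    simp only [Pi.add_apply, Pi.smul_apply, pow_smul_eq ht, pairFun_eq, (hp _).1, (hp _).2,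
      (hn _).1, (hn _).2, decide_neg_eq_one, ind]
    rw [hb]
    simp only [zpow_add, Units.val_mul]
    ring

/-- The function given by `halfRel`. -/
def halfFun (z : ℕ → 𝓡ˣ) (V : 𝓡ˣ) (a b : ℤ) (s : ℤˣ) (x y : ℕ × Bool × Bool) : 𝓡 :=
  -pairFun symCoding z V (a, s) (b, s) x y + pairFun symCoding z V (a - 1, s) (b + 1, s) x y -
    ((ε : ℤ) : 𝓡) * (pairFun symCoding z V (a, -s) (b, -s) x y -
      pairFun symCoding z V (a + 1, -s) (b - 1, -s) x y)

omit hd hvV ht in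
theorem halfRel_mem_pairSpan (a b : ℤ) (s : ℤˣ) :
    (halfRel U ε a b s, halfFun ε z V a b s) ∈ pairSpan symCoding z V U (a + b) := by
  have h := pairSpan_sub (pairSpan_sub
    (mem_pairSpan (U := U) symCoding z V (a - 1, s) (b + 1, s) (a + b) (by ring))
    (mem_pairSpan _ _ _ (a, s) (b, s) _ (by simp)))
    (pairSpan_smul ((ε : ℤ) : U) (pairSpan_sub
      (mem_pairSpan _ _ _ (a, -s) (b, -s) _ (by simp))
      (mem_pairSpan _ _ _ (a + 1, -s) (b - 1, -s) _ (by simp))))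
  convert h using 1
  refine Prod.ext ?_ ?_
  · simp only [halfRel]; abel
  · funext x y
    change halfFun ε z V a b s x y = (pairFun symCoding z V (a - 1, s) (b + 1, s) -
      pairFun symCoding z V (a, s) (b, s) - ((ε : ℤ) : U) • (pairFun symCoding z V (a, -s) (b, -s) -
        pairFun symCoding z V (a + 1, -s) (b - 1, -s))) x y
    rw [Pi.sub_apply, Pi.sub_apply, Pi.sub_apply, Pi.sub_apply, Pi.smul_apply, Pi.smul_apply,
      intCast_smul_eq]
    simp only [halfFun, Pi.sub_apply]
    ring

omit hd ht in
theorem halfFun_even (m n : ℤ) (s : ℤˣ) (x y : ℕ × Bool × Bool) :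
    halfFun ε z V (2 * (m + 1)) (2 * (n + 1)) s x y =
      (V ^ (2 * (n + 1) + 1) : 𝓡ˣ) * ((z x.1 ^ m : 𝓡ˣ) * (z y.1 ^ n : 𝓡ˣ)) *
      (-v * z x.1 * z y.1 * ind (false, decide (s = 1)) (false, decide (s = 1)) x y +
      z y.1 * ind (true, decide (s = 1)) (true, decide (s = 1)) x y -
      ((ε : ℤ) : 𝓡) * v * z x.1 * z y.1 *
        ind (false, !decide (s = 1)) (false, !decide (s = 1)) x y +
      ((ε : ℤ) : 𝓡) * v ^ 2 * z x.1 *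
        ind (true, !decide (s = 1)) (true, !decide (s = 1)) x y) := by
  simp only [halfFun, pairFun_eq_ind, show ∀ m : ℤ, 2 * (m + 1) - 1 = 2 * m + 1 by intro m; ring,
    symCoding_col_even, symCoding_col_odd, symCoding_ex_even, symCoding_ex_odd, decide_neg_eq_one]
  rw [show 2 * (n + 1) + 1 = 2 * n + 1 + 1 + 1 by ring, show 2 * (n + 1) = 2 * n + 1 + 1 by ring]
  simp only [zpow_add, zpow_one, Units.val_mul]
  linear_combination (((V ^ (2 * n) : 𝓡ˣ) * V * (z x.1 ^ m : 𝓡ˣ) * (z y.1 ^ n : 𝓡ˣ) : 𝓡) *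
    (V * z x.1 * z y.1 * ind (false, decide (s = 1)) (false, decide (s = 1)) x y +
      ((ε : ℤ) : 𝓡) * V * z x.1 * z y.1 * ind (false, !decide (s = 1)) (false, !decide (s = 1)) x y -
      ((ε : ℤ) : 𝓡) * z x.1 * (v * V + 1) *
        ind (true, !decide (s = 1)) (true, !decide (s = 1)) x y)) * hvV

omit hd ht in
theorem halfFun_odd (m n : ℤ) (s : ℤˣ) (x y : ℕ × Bool × Bool) :
    halfFun ε z V (2 * m + 1) (2 * n + 1) s x y =
      (V ^ (2 * n + 1 + 1) : 𝓡ˣ) * ((z x.1 ^ m : 𝓡ˣ) * (z y.1 ^ n : 𝓡ˣ)) *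
      (-v * ind (true, decide (s = 1)) (true, decide (s = 1)) x y +
      z y.1 * ind (false, decide (s = 1)) (false, decide (s = 1)) x y -
      ((ε : ℤ) : 𝓡) * v * ind (true, !decide (s = 1)) (true, !decide (s = 1)) x y +
      ((ε : ℤ) : 𝓡) * v ^ 2 * z x.1 *
        ind (false, !decide (s = 1)) (false, !decide (s = 1)) x y) := by
  simp only [halfFun, pairFun_eq_ind, show ∀ m : ℤ, 2 * m + 1 - 1 = 2 * m by intro m; ring,
    show ∀ m : ℤ, 2 * m + 1 + 1 = 2 * (m + 1) by intro m; ring,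
    symCoding_col_even, symCoding_col_odd, symCoding_ex_even, symCoding_ex_odd, decide_neg_eq_one]
  rw [show 2 * (n + 1) = 2 * n + 1 + 1 by ring]
  simp only [zpow_add, zpow_one, Units.val_mul]
  linear_combination (((V ^ (2 * n) : 𝓡ˣ) * (z x.1 ^ m : 𝓡ˣ) * (z y.1 ^ n : 𝓡ˣ) : 𝓡) *
    (V * ind (true, decide (s = 1)) (true, decide (s = 1)) x y +
      ((ε : ℤ) : 𝓡) * V * ind (true, !decide (s = 1)) (true, !decide (s = 1)) x y -
      ((ε : ℤ) : 𝓡) * z x.1 * (v * V + 1) *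
        ind (false, !decide (s = 1)) (false, !decide (s = 1)) x y)) * hvV

omit hd hvV ht in
theorem intCast_units_eq : ((ε : ℤ) : 𝓡) = 1 ∨ ((ε : ℤ) : 𝓡) = -1 := by
  obtain rfl | rfl := Int.units_eq_one_or ε <;> simp

omit ht in
theorem exists_pairSpan_half_self (a : ℤ) (s : ℤˣ) : ∃ N G,
    (halfRel U ε a a s, G) ∈ pairSpan symCoding z V U N ∧
      (symKernel v ((ε : ℤ) : 𝓡) (fun i => (z i : 𝓡)) d).rho G = G := by
  refine ⟨a + a, _, halfRel_mem_pairSpan ε a a s, ?_⟩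
  obtain ⟨m, rfl | rfl⟩ := Int.even_or_odd' a
  -- Even exponents are written 2(m + 1) because `halfRel` involves a - 1 = 2m + 1, whose half m is
  -- the smallest one occurring in the first variable.
  · obtain ⟨m, rfl⟩ : ∃ m', m = m' + 1 := ⟨m - 1, by ring⟩
    apply symKernel_rho_eq hd (symN_rho_even_even _ _ _ (intCast_units_eq ε) (decide (s = 1)))
      (s := fun i j => (V ^ (2 * (m + 1) + 1) : 𝓡ˣ) * ((z i ^ m : 𝓡ˣ) * (z j ^ m : 𝓡ˣ)))
    · intro i j; ring
    · exact halfFun_even ε hvV m m s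
  · apply symKernel_rho_eq hd (symN_rho_odd_odd _ _ _ (intCast_units_eq ε) (decide (s = 1)))
      (s := fun i j => (V ^ (2 * m + 1 + 1) : 𝓡ˣ) * ((z i ^ m : 𝓡ˣ) * (z j ^ m : 𝓡ˣ)))
    · intro i j; ring
    · exact halfFun_odd ε hvV m m s

theorem exists_pairSpan_half (a b : ℤ) (s : ℤˣ) (k : ℕ) (hb : b = a + 2 * k) : ∃ N G,
    (halfRel U ε a b s + t ^ k • halfRel U ε b a s, G) ∈ pairSpan symCoding z V U N ∧
      (symKernel v ((ε : ℤ) : 𝓡) (fun i => (z i : 𝓡)) d).rho G = G := by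
  refine ⟨a + b, _, pairSpan_add (halfRel_mem_pairSpan ε a b s)
    (pairSpan_smul _ (add_comm b a ▸ halfRel_mem_pairSpan ε b a s)), ?_⟩
  obtain ⟨m, rfl | rfl⟩ := Int.even_or_odd' a
  · obtain ⟨m, rfl⟩ : ∃ m', m = m' + 1 := ⟨m - 1, by ring⟩
    obtain ⟨n, rfl⟩ : ∃ n, b = 2 * (n + 1) := ⟨m + k, by linarith⟩
    apply symKernel_rho_eq hd (symN_rho_even_even _ _ _ (intCast_units_eq ε) (decide (s = 1)))
      (s := fun i j => (V ^ (2 * (n + 1) + 1) : 𝓡ˣ) * ((z i ^ m : 𝓡ˣ) * (z j ^ n : 𝓡ˣ) +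
        (z i ^ n : 𝓡ˣ) * (z j ^ m : 𝓡ˣ)))
    · intro i j; ring
    · intro x y
      rw [Pi.add_apply, Pi.add_apply, Pi.smul_apply, Pi.smul_apply, pow_smul_eq ht,
        halfFun_even ε hvV, halfFun_even ε hvV, hb]
      simp only [zpow_add, Units.val_mul]
      ring
  · obtain ⟨n, rfl⟩ : ∃ n, b = 2 * n + 1 := ⟨m + k, by linarith⟩
    apply symKernel_rho_eq hd (symN_rho_odd_odd _ _ _ (intCast_units_eq ε) (decide (s = 1)))
      (s := fun i j => (V ^ (2 * n + 1 + 1) : 𝓡ˣ) * ((z i ^ m : 𝓡ˣ) * (z j ^ n : 𝓡ˣ) +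
        (z i ^ n : 𝓡ˣ) * (z j ^ m : 𝓡ˣ)))
    · intro i j; ring
    · intro x y
      rw [Pi.add_apply, Pi.add_apply, Pi.smul_apply, Pi.smul_apply, pow_smul_eq ht,
        halfFun_odd ε hvV, halfFun_odd ε hvV, hb]
      simp only [zpow_add, Units.val_mul]
      ring

theorem symGens_exists_pairSpan : ∀ g ∈ symGens U t ε, ∃ N G, (g, G) ∈ pairSpan symCoding z V U N ∧
      (symKernel v ((ε : ℤ) : 𝓡) (fun i => (z i : 𝓡)) d).rho G = G := by
  rintro g (((((⟨a, s₁, s₂, rfl⟩ | ⟨a, b, s₁, s₂, k, hb, rfl⟩) | ⟨a, s, rfl⟩) |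
    ⟨a, b, s, k, hb, rfl⟩) | ⟨a, s, rfl⟩) | ⟨a, b, s, k, hb, rfl⟩)
  · exact exists_pairSpan_commute ε hd hvV a s₁ s₂
  · exact exists_pairSpan_odd ε hd hvV ht a b s₁ s₂ k hb
  · exact exists_pairSpan_opposite_self ε hd a s
  · exact exists_pairSpan_opposite ε hd ht a b s k hb
  · exact exists_pairSpan_half_self ε hd hvV a s
  · exact exists_pairSpan_half ε hd hvV ht a b s k hb

end generators

end SymmetricNormalForm


/-! ### The symmetric case: leading terms, straightening and normal forms. -/

section SymmetricNormalForm

open Polynomial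

variable {R : Type*} [CommRing R]

/-- The parity shift of the exponents in the symmetric case. -/
def symShift (c c' : Bool × Bool) : ℤ :=
  if c.1 = c'.1 then (if c.2 = c'.2 then 1 else 0) else (if c.1 then 1 else 0)

/-- At v = 0 only the diagonal entries survive. After division by z² they are w / z or 1, which
gives a shift by 1 or 0. -/
theorem symKernel_isMonomial (ε : LaurentRing) {d : ℕ → ℕ → LaurentRing}
    (hd : ∀ i j, d i j * (laurentVar i : LaurentRing) = 1) :
    (symKernel 0 ε (fun i => (laurentVar i : LaurentRing)) d).IsMonomial laurentVar symShift := by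
  intro c c' m m'
  funext ⟨i, p, s⟩ ⟨j, p', s'⟩
  have h1 : d i j = ((laurentVar i)⁻¹ : LaurentRingˣ) := by
    rw [← mul_one (d i j), ← Units.mul_inv (laurentVar i), ← mul_assoc, hd, one_mul]
  have h2 : (((laurentVar i)⁻¹ : LaurentRingˣ) : LaurentRing) * laurentVar i = 1 := Units.inv_mul _
  have hb : s = s' ∨ s' = !s := by cases s <;> cases s' <;> decide
  have h3 : (symN 0 ε fun i => (laurentVar i : LaurentRing)).rho (mono laurentVar c m c' m')
      (i, p, s) (j, p', s') = (if p = p' then (if s = s' then (laurentVar i : LaurentRing) *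
        laurentVar j else laurentVar i ^ 2) else
        (if p then (laurentVar i : LaurentRing) * laurentVar j else laurentVar i ^ 2)) *
        mono laurentVar c m c' m' (j, p, s) (i, p', s') := by
    cases p <;> cases p' <;> obtain rfl | rfl := hb <;>
      simp [symN_rho_ft, symN_rho_tf, symN_rho_opp, symN_rho_ff, symN_rho_tt,
        -mul_eq_mul_right_iff, -mul_eq_mul_left_iff] <;> ring1
  rw [symKernel_rho, h1, h3]
  by_cases hc : (p, s) = c
  · by_cases hc' : (p', s') = c'
    · subst hc hc'
      simp only [mono, if_true, symShift]
      generalize hu : laurentVar i = u at *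
      generalize hw : laurentVar j = w at *
      split_ifs <;> simp only [zpow_sub, zpow_add, zpow_one, Units.val_mul, sub_zero, add_zero]
      · linear_combination (((u⁻¹ : LaurentRingˣ) : LaurentRing) * w * (w ^ m : LaurentRingˣ) *
          (u ^ m' : LaurentRingˣ)) * h2
      · linear_combination ((w ^ m : LaurentRingˣ) * (u ^ m' : LaurentRingˣ) *
          (((u⁻¹ : LaurentRingˣ) : LaurentRing) * u + 1)) * h2
      · linear_combination (((u⁻¹ : LaurentRingˣ) : LaurentRing) * w * (w ^ m : LaurentRingˣ) *
          (u ^ m' : LaurentRingˣ)) * h2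
      · linear_combination ((w ^ m : LaurentRingˣ) * (u ^ m' : LaurentRingˣ) *
          (((u⁻¹ : LaurentRingˣ) : LaurentRing) * u + 1)) * h2
    · simp [mono, hc']
  · simp [mono, hc]

theorem sym_straighten (t : R) (ε : ℤˣ) (x y : ℤ × ℤˣ)
    (h : ¬ (y.1 < x.1 ∨ (y.1 = x.1 ∧ x.2 = y.2))) :
    ∃ z ∈ Submodule.span R (wd R '' straighter x y), wd R [x, y] - z ∈ relIdeal (symGens R t ε) := by
  obtain ⟨a, s⟩ := x
  obtain ⟨b, s'⟩ := y
  simp only [not_or, not_lt, not_and] at h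
  obtain ⟨h1, h2⟩ := h
  have hmem : ∀ (a' b' j : ℤ) (u u' : ℤˣ), 1 ≤ j → a' = a + j → b' = b - j → a + j ≤ b →
      wd R [(a', u), (b', u')] ∈ Submodule.span R (wd R '' straighter (a, s) (b, s')) := by
    intro a' b' j u u' h1 h2 h3 h4
    exact Submodule.subset_span ⟨_, ⟨(a', u), (b', u'), j, h1, h2, h3, h4, rfl⟩, rfl⟩
  have hopp : s ≠ s' → s' = -s := by
    obtain rfl | rfl := Int.units_eq_one_or s <;> obtain rfl | rfl := Int.units_eq_one_or s' <;>
      decide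
  -- Equal exponents with opposite characters: the word itself is a relation.
  rcases h1.eq_or_lt with rfl | hlt
  · obtain rfl := hopp (h2 rfl)
    refine ⟨0, zero_mem _, ?_⟩
    rw [sub_zero]
    exact subset_relIdeal (Or.inl (Or.inl (Or.inl (Or.inr ⟨a, s, rfl⟩))))
  clear h2
  -- The distance is 2k + 1 or 2k + 2. For k = 0 the saturated generators are needed, except for
  -- opposite characters at distance 2.
  obtain ⟨k, hk | hk⟩ : ∃ k : ℕ, b = a + 2 * k + 1 ∨ b = a + 2 * k + 2 :=
    ⟨((b - a - 1) / 2).toNat, by omega⟩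
  · rcases Nat.eq_zero_or_pos k with rfl | hk0
    · refine ⟨wd R [(a + 1, s'), (a, s)], hmem _ _ 1 _ _ le_rfl rfl (by omega) (by omega), ?_⟩
      obtain rfl : b = a + 1 := by omega
      exact subset_relIdeal (Or.inl (Or.inl (Or.inl (Or.inl (Or.inl ⟨a, s, s', rfl⟩)))))
    · refine ⟨wd R [(a + 1, s'), (b - 1, s)] +
        t ^ k • (wd R [(b, s'), (a, s)] - wd R [(b - 1, s), (a + 1, s')]), ?_, ?_⟩
      · exact add_mem (hmem _ _ 1 _ _ le_rfl rfl rfl (by omega)) (Submodule.smul_mem _ _ (sub_mem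
          (hmem _ _ (b - a) _ _ (by omega) (by omega) (by omega) (by omega))
          (hmem _ _ (b - a - 1) _ _ (by omega) (by omega) (by omega) (by omega))))
      · apply subset_relIdeal
        refine Or.inl (Or.inl (Or.inl (Or.inl (Or.inr ⟨a, b, s, s', k, hk, ?_⟩))))
        exact (sub_sub _ _ _).symm
  · by_cases hs : s = s'
    · subst hs
      rcases Nat.eq_zero_or_pos k with rfl | hk0
      · obtain rfl : b = a + 2 := by omega
        refine ⟨wd R [(a + 1, s), (a + 2 - 1, s)] + ((ε : ℤ) : R) • (wd R [(a + 1, -s), (a + 2 - 1, -s)]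
          - wd R [(a + 2, -s), (a, -s)]), ?_, ?_⟩
        · exact add_mem (hmem _ _ 1 _ _ le_rfl rfl rfl (by omega)) (Submodule.smul_mem _ _ (sub_mem
            (hmem _ _ 1 _ _ le_rfl rfl rfl (by omega))
            (hmem _ _ 2 _ _ (by omega) (by omega) (by omega) (by omega))))
        · apply subset_relIdeal
          refine Or.inl (Or.inr ⟨a + 1, s, ?_⟩)
          rw [halfRel, show a + 1 - 1 = a by ring, show a + 1 + 1 = a + 2 by ring,
            show a + 2 - 1 = a + 1 by ring]
          abel
      · refine ⟨wd R [(a + 1, s), (b - 1, s)] + ((ε : ℤ) : R) • (wd R [(a + 1, -s), (b - 1, -s)]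
          - wd R [(a + 1 + 1, -s), (b - 1 - 1, -s)]) - t ^ k • halfRel R ε (b - 1) (a + 1) s,
          sub_mem ?_ (Submodule.smul_mem _ _ ?_), ?_⟩
        · exact add_mem (hmem _ _ 1 _ _ le_rfl rfl rfl (by omega)) (Submodule.smul_mem _ _ (sub_mem
            (hmem _ _ 1 _ _ le_rfl rfl rfl (by omega))
            (hmem _ _ 2 _ _ (by omega) (by omega) (by omega) (by omega))))
        · refine sub_mem (add_mem (neg_mem ?_) ?_) (Submodule.smul_mem _ _ (sub_mem ?_ ?_))
          · exact hmem _ _ (b - a - 1) _ _ (by omega) (by omega) (by omega) (by omega)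
          · exact hmem _ _ (b - a - 2) _ _ (by omega) (by omega) (by omega) (by omega)
          · exact hmem _ _ (b - a - 1) _ _ (by omega) (by omega) (by omega) (by omega)
          · exact hmem _ _ (b - a) _ _ (by omega) (by omega) (by omega) (by omega)
        · apply subset_relIdeal
          refine Or.inr ⟨a + 1, b - 1, s, k, by omega, ?_⟩
          generalize halfRel R ε (b - 1) (a + 1) s = H
          rw [halfRel, show a + 1 - 1 = a by ring, show b - 1 + 1 = b by ring]
          abel
    · obtain rfl := hopp hs
      refine ⟨-(t ^ (k + 1) • wd R [(b, s), (a, -s)]), neg_mem (Submodule.smul_mem _ _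
        (hmem _ _ (b - a) _ _ (by omega) (by omega) (by omega) (by omega))), ?_⟩
      rw [sub_neg_eq_add]
      exact subset_relIdeal (Or.inl (Or.inl (Or.inr ⟨a, b, s, k + 1, by push_cast; omega, rfl⟩)))

/-- The relation between consecutive letters of a normal word in the symmetric case. -/
def descendsSym (a b : ℤ × ℤˣ) : Prop := b.1 < a.1 ∨ (b.1 = a.1 ∧ a.2 = b.2)

theorem symCoding_injective (a b : ℤ × ℤˣ) (hc : symCoding.col a = symCoding.col b)
    (he : symCoding.ex a = symCoding.ex b) : a = b := by
  simp only [symCoding, Prod.mk.injEq, decide_eq_decide] at hc he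
  refine Prod.ext (by omega) ?_
  obtain h | h := Int.units_eq_one_or a.2 <;> obtain h' | h' := Int.units_eq_one_or b.2 <;>
    simp [h, h'] at hc ⊢

/-- Halving a strict descent of exponents gives a strict descent of halves, except from odd to even,
where the halves may agree; the shift is 1 there, and also for equal letters. -/
theorem ex_lt_of_descendsSym (a b : ℤ × ℤˣ) (h : descendsSym a b) :
    symCoding.ex b < symCoding.ex a + symShift (symCoding.col a) (symCoding.col b) := by
  obtain ⟨e, s⟩ := a
  obtain ⟨e', s'⟩ := b
  simp only [descendsSym, symCoding, symShift, decide_eq_true_eq, decide_eq_decide] at *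
  rcases h with h | ⟨rfl, rfl⟩
  · split_ifs <;> omega
  · simp

theorem sym_hasNormalForm_polynomial (ε : ℤˣ) : HasNormalForm (symGens ℤ[X] X ε) descendsSym := by
  apply HasNormalForm.of_linearIndependent
  · exact wd_mem_span_sup_relIdeal (sym_straighten X ε)
  obtain ⟨d, hd⟩ := exists_inverse (PowerSeries.X ^ 2) (by simp)
  set ψ := HahnSeries.ofPowerSeries ℤ LaurentRing with hψ
  have hψX : ψ PowerSeries.X = seriesVar LaurentRing := HahnSeries.ofPowerSeries_X
  have hk : (symKernel PowerSeries.X ((ε : ℤ) : PowerSeries LaurentRing)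
      (fun i => PowerSeries.C (laurentVar i : LaurentRing)) d).map ψ =
      symKernel (seriesVar LaurentRing : LaurentSeries LaurentRing)
        ((ε : ℤ) : LaurentSeries LaurentRing)
        (fun i => (seriesLaurentVar i : LaurentSeries LaurentRing)) fun i j => ψ (d i j) := by
    rw [symKernel_map, hψX, map_intCast]
    rfl
  have hd' : ∀ i j, ψ (d i j) * ((seriesLaurentVar i : LaurentSeries LaurentRing) -
      (seriesVar LaurentRing : LaurentSeries LaurentRing) ^ 2 * seriesLaurentVar j) = 1 := by
    intro i j
    have h := congrArg ψ (hd i j)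
    rw [map_mul, map_sub, map_mul, map_pow, hψX, map_one] at h
    exact h
  -- X acts as V² = v⁻², since the denominators of the symmetric kernel involve v².
  let _ : Algebra ℤ[X] (LaurentSeries LaurentRing) := (Polynomial.eval₂RingHom
    (Int.castRingHom (LaurentSeries LaurentRing)) (HahnSeries.single (-2) 1)).toAlgebra
  have hX : algebraMap ℤ[X] (LaurentSeries LaurentRing) X = HahnSeries.single (-2) 1 :=
    Polynomial.eval₂_X _ _
  have hX' : algebraMap ℤ[X] (LaurentSeries LaurentRing) X =
      (((seriesVar LaurentRing)⁻¹ ^ 2 : (LaurentSeries LaurentRing)ˣ) :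
        LaurentSeries LaurentRing) := by
    rw [hX, ← zpow_natCast, inv_zpow', seriesVar_zpow]
    rfl
  refine eq_zero_of_linearCombination_mem_relIdeal (cd := symCoding) (κ := symShift)
    (k := symKernel PowerSeries.X ((ε : ℤ) : PowerSeries LaurentRing)
      (fun i => PowerSeries.C (laurentVar i : LaurentRing)) d)
    (m := -2) symCoding_injective ex_lt_of_descendsSym ?_ ?_ (by decide) hX ?_
  · rw [hk]
    exact symKernel_isBraided (intCast_units_eq ε) hd'
  · rw [symKernel_map]
    simp only [PowerSeries.constantCoeff_X, PowerSeries.constantCoeff_C, map_intCast]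
    apply symKernel_isMonomial
    intro i j
    have := congrArg PowerSeries.constantCoeff (hd i j)
    simpa using this
  · rw [hk]
    exact symGens_exists_pairSpan ε hd' (Units.mul_inv _) hX'

theorem mapRingHom_halfRel {U R : Type*} [CommRing U] [CommRing R] (φ : U →+* R) (ε : ℤˣ) (a b : ℤ)
    (s : ℤˣ) : MonoidAlgebra.mapRingHom (FreeMonoid (ℤ × ℤˣ)) φ (halfRel U ε a b s) =
      halfRel R ε a b s := by
  simp only [halfRel, map_sub, map_add, map_neg, mapRingHom_smul, mapRingHom_wd, map_intCast]

theorem sym_hasNormalForm (t : R) (ε : ℤˣ) : HasNormalForm (symGens R t ε) descendsSym := by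
  set φ := Polynomial.eval₂RingHom (Int.castRingHom R) t with hφ
  have hφX : φ X = t := by simp [φ]
  apply (sym_hasNormalForm_polynomial ε).map φ
  rintro g (((((⟨a, s₁, s₂, rfl⟩ | ⟨a, b, s₁, s₂, k, hb, rfl⟩) | ⟨a, s, rfl⟩) |
    ⟨a, b, s, k, hb, rfl⟩) | ⟨a, s, rfl⟩) | ⟨a, b, s, k, hb, rfl⟩)
  · exact ⟨_, Or.inl (Or.inl (Or.inl (Or.inl (Or.inl ⟨a, s₁, s₂, rfl⟩)))), by
      simp only [map_sub, mapRingHom_wd]⟩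
  · exact ⟨_, Or.inl (Or.inl (Or.inl (Or.inl (Or.inr ⟨a, b, s₁, s₂, k, hb, rfl⟩)))), by
      simp only [map_sub, mapRingHom_smul, mapRingHom_wd, map_pow, hφX]⟩
  · exact ⟨_, Or.inl (Or.inl (Or.inl (Or.inr ⟨a, s, rfl⟩))), by simp only [mapRingHom_wd]⟩
  · exact ⟨_, Or.inl (Or.inl (Or.inr ⟨a, b, s, k, hb, rfl⟩)), by
      simp only [map_add, mapRingHom_smul, mapRingHom_wd, map_pow, hφX]⟩
  · exact ⟨_, Or.inl (Or.inr ⟨a, s, rfl⟩), by simp only [mapRingHom_halfRel]⟩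
  · exact ⟨_, Or.inr ⟨a, b, s, k, hb, rfl⟩, by
      simp only [map_add, mapRingHom_smul, mapRingHom_halfRel, map_pow, hφX]⟩

end SymmetricNormalForm


/-! ### Multiplicities and signs of words. -/

section Data

variable {S : Type} [CommGroup S]

/-- The product of the signs of the letters with a given exponent. -/
def signAt (l : List (ℤ × S)) (i : ℤ) : S := (l.map fun x => if x.1 = i then x.2 else 1).prod

@[simp] theorem signAt_nil (i : ℤ) : signAt ([] : List (ℤ × S)) i = 1 := rfl

@[simp] theorem signAt_cons (x : ℤ × S) (l : List (ℤ × S)) (i : ℤ) :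
    signAt (x :: l) i = (if x.1 = i then x.2 else 1) * signAt l i := by
  simp [signAt]

@[simp] theorem signAt_append (l l' : List (ℤ × S)) (i : ℤ) :
    signAt (l ++ l') i = signAt l i * signAt l' i := by
  simp [signAt]

theorem typData_e_apply {r : ℕ} (v : Typ S r) (i : ℤ) :
    (typData v).1.e i = ((List.ofFn v).map Prod.fst).count i := by
  have h : (typData v).1.e i = (Finset.univ.filter fun k => (v k).1 = i).card := rfl
  rw [h, List.map_ofFn, ← Multiset.coe_count, ← Fin.univ_val_map, Multiset.count,
    Multiset.countP_map]
  simp only [Function.comp_apply, eq_comm (a := i)]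
  rfl

theorem typData_χ_apply {r : ℕ} (v : Typ S r) (i : ℤ) :
    (typData v).1.χ i = signAt (List.ofFn v) i := by
  have h : (typData v).1.χ i = ∏ k ∈ Finset.univ.filter (fun k => (v k).1 = i), (v k).2 := rfl
  rw [h, signAt, List.map_ofFn, List.prod_ofFn, Finset.prod_filter]
  rfl

theorem typData_eq_iff {r : ℕ} {v w : Typ S r} : typData v = typData w ↔
    (∀ i, ((List.ofFn v).map Prod.fst).count i = ((List.ofFn w).map Prod.fst).count i) ∧
      ∀ i, signAt (List.ofFn v) i = signAt (List.ofFn w) i := by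
  simp only [← typData_e_apply, ← typData_χ_apply]
  constructor
  · intro h; simp [h]
  · rintro ⟨h1, h2⟩
    exact Subtype.ext (TypZero.ext (Finsupp.ext h1) (funext h2))

omit [CommGroup S] in
instance : IsTrans (ℤ × S) descends := ⟨fun _ _ _ h h' => le_trans h' h⟩

omit [CommGroup S] in
theorem isChain_ofFn_iff {r : ℕ} {v : Typ S r} :
    (List.ofFn v).IsChain descends ↔ Antitone fun k => (v k).1 := by
  rw [List.isChain_iff_pairwise, List.pairwise_ofFn]
  constructor
  · intro h i j hij
    rcases hij.eq_or_lt with rfl | hlt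
    · exact le_rfl
    · exact h hlt
  · intro h i j hij
    exact h hij.le

theorem map_fst_eq_of_typData_eq {r : ℕ} {v w : Typ S r} (hv : Antitone fun k => (v k).1)
    (hw : Antitone fun k => (w k).1) (h : typData v = typData w) :
    (List.ofFn v).map Prod.fst = (List.ofFn w).map Prod.fst := by
  have hs : ∀ u : Typ S r, (Antitone fun k => (u k).1) →
      ((List.ofFn u).map Prod.fst).Pairwise fun a b : ℤ => b ≤ a := by
    intro u hu
    rw [List.map_ofFn, List.pairwise_ofFn]
    intro i j hij
    exact hu hij.le
  refine List.Perm.eq_of_pairwise (fun a b _ _ h1 h2 => le_antisymm h2 h1) (hs v hv) (hs w hw) ?_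
  rw [List.perm_iff_count]
  exact (typData_eq_iff.mp h).1

theorem exists_antitone_typData_eq {r : ℕ} (t : TypZeroOfRank S r) :
    ∃ v : Typ S r, (Antitone fun k => (v k).1) ∧ typData v = t := by
  obtain ⟨t, ht⟩ := t
  set L := (Finsupp.toMultiset t.e).sort (fun a b => b ≤ a) with hL
  have hlen : L.length = r := by
    rw [hL, Multiset.length_sort, Finsupp.card_toMultiset]
    exact ht
  subst hlen
  have hcount : ∀ i, L.count i = t.e i := by
    intro i
    rw [← Finsupp.count_toMultiset, ← Multiset.coe_count, hL, Multiset.sort_eq]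
  classical
  -- The whole sign at an exponent is put on its first occurrence in the sorted list, and 1 on the
  -- others.
  let v : Typ S L.length := fun k => (L.get k, if ∀ j < k, L.get j ≠ L.get k then t.χ (L.get k) else 1)
  have hfst : (List.ofFn v).map Prod.fst = L := by
    rw [List.map_ofFn]
    exact List.ofFn_get L
  refine ⟨v, ?_, Subtype.ext (TypZero.ext (Finsupp.ext fun i => ?_) (funext fun i => ?_))⟩
  · have h1 : (List.ofFn L.get).Pairwise fun a b : ℤ => b ≤ a := by
      rw [List.ofFn_get]
      exact Multiset.pairwise_sort _ _
    rw [List.pairwise_ofFn] at h1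
    intro i j hij
    rcases hij.eq_or_lt with rfl | hlt
    · exact le_rfl
    · exact h1 hlt
  · rw [typData_e_apply, hfst, hcount]
  · have h : (typData v).1.χ i = ∏ k ∈ Finset.univ.filter (fun k => (v k).1 = i), (v k).2 := rfl
    rw [h]
    by_cases hne : (Finset.univ.filter fun k => (v k).1 = i).Nonempty
    · set k₀ := Finset.min' _ hne with hk₀
      have hk₁ : (v k₀).1 = i := (Finset.mem_filter.mp (Finset.min'_mem _ hne)).2
      have hmin : ∀ j, (v j).1 = i → k₀ ≤ j := fun j hj =>
        Finset.min'_le _ j (Finset.mem_filter.mpr ⟨Finset.mem_univ j, hj⟩)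
      rw [Finset.prod_eq_single k₀]
      · have : ∀ j < k₀, L.get j ≠ L.get k₀ := fun j hj he =>
          absurd (hmin j (he.trans hk₁)) (not_le.mpr hj)
        simp only [v]
        rw [if_pos this]
        exact congrArg t.χ hk₁
      · intro k hk hkne
        have hk' := (Finset.mem_filter.mp hk).2
        simp only [v]
        rw [if_neg]
        intro hall
        exact hall k₀ (lt_of_le_of_ne (hmin k hk') hkne.symm) (hk₁.trans hk'.symm)
      · intro hk
        exact absurd (Finset.min'_mem _ hne) hk
    · rw [Finset.not_nonempty_iff_eq_empty.mp hne, Finset.prod_empty]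
      refine (t.χ_eq_one i ?_).symm
      have h2 : (typData v).1.e i = (Finset.univ.filter fun k => (v k).1 = i).card := rfl
      rw [Finset.not_nonempty_iff_eq_empty.mp hne, Finset.card_empty, typData_e_apply, hfst,
        hcount] at h2
      exact h2

end Data

/-! ### From normal forms to the straightening isomorphism. -/

section Abstract

variable {R : Type*} [CommRing R] {S : Type} [CommGroup S] {r : ℕ}

omit [CommGroup S] in
theorem inclusion_single (v : Typ S r) : inclusion R S r (Finsupp.single v 1) = wd R (List.ofFn v) := by
  simp [inclusion, wd]

omit [CommGroup S] in
theorem mem_relPart {gens : Set (TypRing R S)} {x : Typ S r →₀ R} :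
    x ∈ relPart R gens r ↔ inclusion R S r x ∈ relIdeal gens :=
  mem_relIdeal.symm

/-- σ induces the map, and choosing a decreasing word for each datum gives its inverse: one
composite is the identity by `hσv`, the other by `hcong` because decreasing words generate.
Generation also gives uniqueness. -/
theorem exists_straightening {gens : Set (TypRing R S)}
    (hspan : ∀ v : Typ S r, wd R (List.ofFn v) ∈
      Submodule.span R (wd R '' {l | l.IsChain descends ∧ l.length = r}) ⊔ relIdeal gens)
    (hcong : ∀ v w : Typ S r, (Antitone fun k => (v k).1) → (Antitone fun k => (w k).1) →
      typData v = typData w → wd R (List.ofFn v) - wd R (List.ofFn w) ∈ relIdeal gens)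
    (σ : TypRing R S →ₗ[R] (TypZeroOfRank S r →₀ R)) (hσ : relIdeal gens ≤ LinearMap.ker σ)
    (hσv : ∀ v : Typ S r, (Antitone fun k => (v k).1) →
      σ (wd R (List.ofFn v)) = Finsupp.single (typData v) 1) :
    ∃ str : ((Typ S r →₀ R) ⧸ relPart R gens r) ≃ₗ[R] (TypZeroOfRank S r →₀ R),
      IsStraightening str.toLinearMap ∧ ∀ f, IsStraightening f → f = str.toLinearMap := by
  set T : Set ((Typ S r →₀ R) ⧸ relPart R gens r) :=
    (fun v => Submodule.Quotient.mk (Finsupp.single v 1)) '' {v | Antitone fun k => (v k).1} with hT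
  have hTtop : Submodule.span R T = ⊤ := by
    have h1 : ∀ v : Typ S r, (relPart R gens r).mkQ (Finsupp.single v 1) ∈ Submodule.span R T := by
      intro v
      obtain ⟨y, hy, z, hz, hyz⟩ := Submodule.mem_sup.mp (hspan v)
      have h2 : Submodule.span R (wd R '' {l | l.IsChain descends ∧ l.length = r}) ≤
          (Submodule.span R ((fun v => Finsupp.single v (1 : R)) ''
            {v : Typ S r | Antitone fun k => (v k).1})).map (inclusion R S r) := by
        rw [Submodule.span_le]
        rintro _ ⟨l, ⟨hl, rfl⟩, rfl⟩
        refine ⟨Finsupp.single l.get 1, Submodule.subset_span ⟨l.get, ?_, rfl⟩, ?_⟩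
        · rw [← List.ofFn_get l] at hl
          exact isChain_ofFn_iff.mp hl
        · rw [inclusion_single, List.ofFn_get]
      obtain ⟨y', hy', rfl⟩ := h2 hy
      have h3 : (relPart R gens r).mkQ (Finsupp.single v 1) = (relPart R gens r).mkQ y' := by
        rw [Submodule.mkQ_apply, Submodule.mkQ_apply, Submodule.Quotient.eq, mem_relPart, map_sub,
          inclusion_single, ← hyz, add_sub_cancel_left]
        exact hz
      rw [h3]
      have h4 := Submodule.mem_map_of_mem (f := (relPart R gens r).mkQ) hy'
      rw [Submodule.map_span, Set.image_image] at h4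
      exact h4
    rw [eq_top_iff]
    rintro x -
    obtain ⟨x, rfl⟩ := Submodule.mkQ_surjective _ x
    induction x using Finsupp.induction_linear with
    | zero => simp
    | add x y hx hy => rw [map_add]; exact add_mem hx hy
    | single v c =>
      rw [← mul_one c, ← smul_eq_mul, ← Finsupp.smul_single, map_smul]
      exact Submodule.smul_mem _ _ (h1 v)
  have hker : relPart R gens r ≤ LinearMap.ker (σ ∘ₗ inclusion R S r) :=
    fun x hx => LinearMap.mem_ker.mpr (hσ (mem_relPart.mp hx))
  set f₀ : ((Typ S r →₀ R) ⧸ relPart R gens r) →ₗ[R] (TypZeroOfRank S r →₀ R) :=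
    (relPart R gens r).liftQ (σ ∘ₗ inclusion R S r) hker with hf₀
  have hf₀v : IsStraightening f₀ := by
    intro v hv
    rw [hf₀, Submodule.liftQ_apply, LinearMap.comp_apply,
      inclusion_single, hσv v hv]
  choose s hs hst using exists_antitone_typData_eq (S := S) (r := r)
  set g : (TypZeroOfRank S r →₀ R) →ₗ[R] ((Typ S r →₀ R) ⧸ relPart R gens r) :=
    Finsupp.linearCombination R fun t => Submodule.Quotient.mk (Finsupp.single (s t) 1) with hg
  have hfg : f₀ ∘ₗ g = LinearMap.id := by
    ext1 t
    ext1
    rw [LinearMap.comp_apply, LinearMap.comp_apply, hg, Finsupp.lsingle_apply,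
      Finsupp.linearCombination_single, one_smul, hf₀v _ (hs t), hst]
    rfl
  have hgf : g ∘ₗ f₀ = LinearMap.id := by
    apply LinearMap.ext_on hTtop
    rintro _ ⟨v, hv, rfl⟩
    rw [LinearMap.comp_apply, hf₀v v hv, hg, Finsupp.linearCombination_single, one_smul,
      LinearMap.id_apply, Submodule.Quotient.eq, mem_relPart, map_sub, inclusion_single,
      inclusion_single]
    exact hcong _ _ (hs _) hv (hst _)
  refine ⟨LinearEquiv.ofLinearMap f₀ g hfg hgf, hf₀v, fun f hf => ?_⟩
  apply LinearMap.ext_on hTtop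
  rintro _ ⟨v, hv, rfl⟩
  exact (hf v hv).trans (hf₀v v hv).symm

variable (R S r) in
/-- The linear map sending a word to its data. -/
noncomputable def dataMap : TypRing R S →ₗ[R] (TypZeroOfRank S r →₀ R) :=
  wdLift fun l => if h : l.length = r then
    Finsupp.single (typData fun i => l.get (i.cast h.symm)) 1 else 0

theorem dataMap_wd_ofFn (v : Typ S r) :
    dataMap R S r (wd R (List.ofFn v)) = Finsupp.single (typData v) 1 := by
  rw [dataMap, wdLift_wd, dif_pos (List.length_ofFn)]
  congr 2
  funext i
  rw [List.get_ofFn]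
  rfl

theorem dataMap_wd_congr {l l' : List (ℤ × S)} (h : l.map Prod.fst = l'.map Prod.fst)
    (hs : ∀ i, signAt l i = signAt l' i) : dataMap R S r (wd R l) = dataMap R S r (wd R l') := by
  have hlen : l.length = l'.length := by simpa using congrArg List.length h
  by_cases hr : l.length = r
  · subst hr
    obtain ⟨v, hv⟩ : ∃ v : Typ S l.length, l = List.ofFn v := ⟨l.get, (List.ofFn_get l).symm⟩
    obtain ⟨w, hw⟩ : ∃ w : Typ S l.length, l' = List.ofFn w := by
      rw [hlen]
      exact ⟨l'.get, (List.ofFn_get l').symm⟩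
    generalize l.length = n at *
    subst hv hw
    rw [dataMap_wd_ofFn, dataMap_wd_ofFn, typData_eq_iff.mpr ⟨fun i => by rw [h], hs⟩]
  · rw [dataMap, wdLift_wd, wdLift_wd, dif_neg hr, dif_neg (hlen ▸ hr)]

end Abstract

/-! ### Straightening in the Hermitian and alternating cases. -/

section HallLittlewood

variable {R : Type*} [CommRing R]

theorem exists_straightening_hlGens (t : R) (r : ℕ) :
    ∃ str : ((Typ Unit r →₀ R) ⧸ relPart R (hlGens R t) r) ≃ₗ[R] (TypZeroOfRank Unit r →₀ R),
      IsStraightening str.toLinearMap ∧ ∀ f, IsStraightening f → f = str.toLinearMap := by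
  obtain ⟨ν, hν, -, hn⟩ := hl_hasNormalForm t
  apply exists_straightening
    (σ := dataMap R Unit r ∘ₗ Finsupp.linearCombination R (wd R) ∘ₗ ν)
  · intro v
    have := wd_mem_span_sup_relIdeal (hl_straighten t) (List.ofFn v)
    rwa [List.length_ofFn] at this
  · intro v w hv hw h
    have h1 := map_fst_eq_of_typData_eq hv hw h
    have h2 : List.ofFn v = List.ofFn w :=
      List.map_injective_iff.mpr (fun a b hab => Prod.ext hab rfl) h1
    rw [h2, sub_self]
    exact zero_mem _
  · intro x hx
    have : ν x = 0 := hν hx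
    simp [this]
  · intro v hv
    rw [LinearMap.comp_apply, LinearMap.comp_apply, hn _ (isChain_ofFn_iff.mpr hv),
      Finsupp.linearCombination_single, one_smul, dataMap_wd_ofFn]

theorem pair_eq_wd (a b : ℤ) : pair R a b = wd R [(a, ()), (b, ())] := rfl

theorem relHermitian_eq (q₀ : ℕ) : relHermitian R q₀ = hlGens R (-(q₀ : R)) := rfl

theorem relAlternating_eq (q : ℕ) : relAlternating R q = hlGens R ((q : R) ^ 2) := by
  simp only [relAlternating, hlGens, pow_mul, pair_eq_wd]

end HallLittlewood


/-! ### Straightening in the symmetric case, by Fourier transform on the signs. -/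

section Symmetric

variable {R : Type*} [CommRing R]

theorem map_mem_relIdeal {S : Type} {gens gens' : Set (TypRing R S)}
    (f : TypRing R S →ₐ[R] TypRing R S) (h : ∀ g ∈ gens, f g ∈ relIdeal gens') {x : TypRing R S}
    (hx : x ∈ relIdeal gens) : f x ∈ relIdeal gens' := by
  have : relIdeal gens ≤ (relIdeal gens').comap f.toLinearMap := by
    apply relIdeal_le
    intro g hg u w
    simp only [Submodule.mem_comap, AlgHom.toLinearMap_apply, map_mul]
    exact mul_mem_relIdeal (h g hg) _ _
  exact this hx

/-- The scaled Fourier transform on the signs of each letter. -/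
noncomputable def fourier (c : R) : TypRing R ℤˣ →ₐ[R] TypRing R ℤˣ :=
  MonoidAlgebra.lift R _ _ (FreeMonoid.lift fun x =>
    c • ∑ χ : ℤˣ, (((signChar x.2 χ : ℤˣ) : ℤ) : R) • wd R [(x.1, χ)])

theorem fourier_wd_singleton (c : R) (a : ℤ) (s : ℤˣ) : fourier c (wd R [(a, s)]) =
    c • ∑ χ : ℤˣ, (((signChar s χ : ℤˣ) : ℤ) : R) • wd R [(a, χ)] := by
  rw [fourier, wd, MonoidAlgebra.lift_single, one_smul]
  rfl

theorem sum_units_int {M : Type*} [AddCommMonoid M] (f : ℤˣ → M) : ∑ χ, f χ = f 1 + f (-1) := by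
  rw [UnitsInt.univ, Finset.sum_pair (by decide)]

/-- Fourier inversion on a group of order two; the factor 2 is its order. -/
theorem fourier_fourier {c c' : R} (h : c' * c * 2 = 1) (x : TypRing R ℤˣ) :
    fourier c (fourier c' x) = x := by
  have hl : ∀ l : List (ℤ × ℤˣ), fourier c (fourier c' (wd R l)) = wd R l := by
    intro l
    induction l with
    | nil => rw [wd_nil, map_one, map_one]
    | cons x l ih =>
      obtain ⟨a, s⟩ := x
      rw [wd_cons, map_mul, map_mul, ih]
      congr 1
      rw [fourier_wd_singleton]
      simp only [map_smul, map_add, sum_units_int, fourier_wd_singleton]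
      have h' : ∀ y : TypRing R ℤˣ, y = (c' * c * 2) • y := fun y => by rw [h, one_smul]
      obtain rfl | rfl := Int.units_eq_one_or s
      · conv_rhs => rw [h' (wd R [(a, 1)])]
        simp [signChar]
        module
      · conv_rhs => rw [h' (wd R [(a, -1)])]
        simp [signChar]
        module
  have : (fourier c).toLinearMap ∘ₗ (fourier c').toLinearMap = LinearMap.id :=
    linearMap_ext_wd hl
  exact LinearMap.congr_fun this x

theorem fourier_wd_mem_span (c : R) (l : List (ℤ × ℤˣ)) :
    fourier c (wd R l) ∈ Submodule.span R (wd R '' {l' | l'.map Prod.fst = l.map Prod.fst}) := by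
  induction l with
  | nil =>
    rw [wd_nil, map_one, ← wd_nil]
    exact Submodule.subset_span ⟨[], rfl, rfl⟩
  | cons x l ih =>
    obtain ⟨a, s⟩ := x
    rw [wd_cons, map_mul, fourier_wd_singleton, smul_mul_assoc, Finset.sum_mul]
    refine Submodule.smul_mem _ _ (Submodule.sum_mem _ fun χ _ => ?_)
    rw [smul_mul_assoc]
    refine Submodule.smul_mem _ _ ?_
    have h1 := Submodule.mem_map_of_mem (f := LinearMap.mulLeft R (wd R [(a, χ)])) ih
    rw [Submodule.map_span, Set.image_image] at h1
    refine Submodule.span_mono ?_ h1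
    rintro _ ⟨l', hl', rfl⟩
    exact ⟨(a, χ) :: l', by simpa using hl', wd_cons _ _⟩

theorem fourier_wd_pair (a : ℤ) (s : ℤˣ) (b : ℤ) (s' : ℤˣ) :
    fourier (1 : R) (wd R [(a, s), (b, s')]) = pairSigma R a s b s' := by
  have h : ∀ (χ χ' : ℤˣ) (m : ℤ), MonoidAlgebra.single (FreeMonoid.of (a, χ) * FreeMonoid.of (b, χ'))
      ((m : ℤ) : R) = ((m : ℤ) : R) • (wd R [(a, χ)] * wd R [(b, χ')]) := by
    intro χ χ' m
    simp [wd, MonoidAlgebra.single_mul_single, MonoidAlgebra.smul_single]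
  rw [wd_cons, map_mul, fourier_wd_singleton, fourier_wd_singleton, one_smul, one_smul,
    Finset.sum_mul_sum, pairSigma]
  refine Finset.sum_congr rfl fun χ _ => Finset.sum_congr rfl fun χ' _ => ?_
  rw [h, smul_mul_smul_comm, Units.val_mul, Int.cast_mul]

theorem fourier_halfRel (ε : ℤˣ) (a b : ℤ) (s : ℤˣ) :
    fourier (1 : R) (halfRel R ε a b s) = relHalf R ε a b s := by
  simp only [halfRel, relHalf, map_sub, map_add, map_neg, map_smul, fourier_wd_pair]

theorem mem_of_two_smul_mem (h2 : IsUnit (2 : R)) {M : Type*} [AddCommGroup M] [Module R M]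
    {N : Submodule R M} {x : M} (h : x + x ∈ N) : x ∈ N := by
  rw [← two_smul R] at h
  exact (Submodule.smul_mem_iff_of_isUnit N h2).mp h

theorem pairSigma_opposite_mem (h2 : IsUnit (2 : R)) (q : ℕ) (ε : ℤˣ) (a : ℤ) (s : ℤˣ) :
    pairSigma R a s a (-s) ∈ relIdeal (relSymmetric R q ε) := by
  apply mem_of_two_smul_mem h2
  exact subset_relIdeal (Or.inl (Or.inr ⟨a, a, s, 0, by simp, by rw [pow_zero, one_smul]⟩))

/-- For k = 0 each original generator is twice a saturated one; this is where 2 has to be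
invertible. -/
theorem fourier_mem_relIdeal_relSymmetric (h2 : IsUnit (2 : R)) (q : ℕ) (ε : ℤˣ) :
    ∀ g ∈ symGens R (q : R) ε, fourier (1 : R) g ∈ relIdeal (relSymmetric R q ε) := by
  rintro g (((((⟨a, s₁, s₂, rfl⟩ | ⟨a, b, s₁, s₂, k, hb, rfl⟩) | ⟨a, s, rfl⟩) |
    ⟨a, b, s, k, hb, rfl⟩) | ⟨a, s, rfl⟩) | ⟨a, b, s, k, hb, rfl⟩) <;>
    simp only [map_sub, map_add, map_smul, fourier_wd_pair, fourier_halfRel]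
  · apply mem_of_two_smul_mem h2
    refine subset_relIdeal (Or.inl (Or.inl ⟨a, a + 1, s₁, s₂, 0, by simp, ?_⟩))
    rw [pow_zero, one_smul, add_sub_cancel_right]
    abel
  · exact subset_relIdeal (Or.inl (Or.inl ⟨a, b, s₁, s₂, k, hb, rfl⟩))
  · exact pairSigma_opposite_mem h2 q ε a s
  · exact subset_relIdeal (Or.inl (Or.inr ⟨a, b, s, k, hb, rfl⟩))
  · apply mem_of_two_smul_mem h2
    refine subset_relIdeal (Or.inr ⟨a - 1, a + 1, s, 0, by push_cast; ring, ?_⟩)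
    rw [pow_zero, one_smul, add_sub_cancel_right, sub_add_cancel]
  · refine subset_relIdeal (Or.inr ⟨a - 1, b + 1, s, k, by rw [hb]; ring, ?_⟩)
    rw [add_sub_cancel_right, sub_add_cancel]

theorem exists_fourier_eq (q : ℕ) (ε : ℤˣ) :
    ∀ g ∈ relSymmetric R q ε, ∃ g' ∈ symGens R (q : R) ε, fourier (1 : R) g' = g := by
  rintro g ((⟨a, b, s₁, s₂, k, hb, rfl⟩ | ⟨a, b, s, k, hb, rfl⟩) | ⟨a, b, s, k, hb, rfl⟩)
  · exact ⟨_, Or.inl (Or.inl (Or.inl (Or.inl (Or.inr ⟨a, b, s₁, s₂, k, hb, rfl⟩)))), by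
      simp only [map_sub, map_smul, fourier_wd_pair]⟩
  · exact ⟨_, Or.inl (Or.inl (Or.inr ⟨a, b, s, k, hb, rfl⟩)), by
      simp only [map_add, map_smul, fourier_wd_pair]⟩
  · exact ⟨_, Or.inr ⟨a + 1, b - 1, s, k, by rw [hb]; ring, rfl⟩, by
      simp only [map_add, map_smul, fourier_halfRel]⟩

theorem pairSigma_self_one (a : ℤ) : pairSigma R a 1 a (-1) =
    wd R [(a, 1), (a, 1)] - wd R [(a, 1), (a, -1)] + (wd R [(a, -1), (a, 1)] -
      wd R [(a, -1), (a, -1)]) := by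
  have h : ∀ χ χ' : ℤˣ, wd R [(a, χ), (a, χ')] =
      MonoidAlgebra.single (FreeMonoid.of (a, χ) * FreeMonoid.of (a, χ')) 1 := fun _ _ => rfl
  simp only [pairSigma, sum_units_int, signChar, h]
  simp [sub_eq_add_neg, MonoidAlgebra.single_neg]

theorem pairSigma_self_neg_one (a : ℤ) : pairSigma R a (-1) a 1 =
    wd R [(a, 1), (a, 1)] + wd R [(a, 1), (a, -1)] - (wd R [(a, -1), (a, 1)] +
      wd R [(a, -1), (a, -1)]) := by
  have h : ∀ χ χ' : ℤˣ, wd R [(a, χ), (a, χ')] =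
      MonoidAlgebra.single (FreeMonoid.of (a, χ) * FreeMonoid.of (a, χ')) 1 := fun _ _ => rfl
  simp only [pairSigma, sum_units_int, signChar, h]
  simp [sub_eq_add_neg, MonoidAlgebra.single_neg, add_comm]

/-- The sum and the difference of the two transformed relations with opposite characters at a are,
up to sign, twice the differences in question. -/
theorem wd_neg_neg_congr (h2 : IsUnit (2 : R)) (q : ℕ) (ε : ℤˣ) (a : ℤ) (χ χ' : ℤˣ) :
    wd R [(a, χ), (a, χ')] - wd R [(a, -χ), (a, -χ')] ∈ relIdeal (relSymmetric R q ε) := by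
  have h1 := pairSigma_opposite_mem h2 q ε a 1
  have h3 := pairSigma_opposite_mem h2 q ε a (-1)
  rw [neg_neg] at h3
  rw [pairSigma_self_one] at h1
  rw [pairSigma_self_neg_one] at h3
  have h4 : wd R [(a, 1), (a, 1)] - wd R [(a, -1), (a, -1)] ∈ relIdeal (relSymmetric R q ε) := by
    apply mem_of_two_smul_mem h2
    convert add_mem h1 h3 using 1
    abel
  have h5 : wd R [(a, 1), (a, -1)] - wd R [(a, -1), (a, 1)] ∈ relIdeal (relSymmetric R q ε) := by
    apply mem_of_two_smul_mem h2
    convert sub_mem h3 h1 using 1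
    abel
  obtain rfl | rfl := Int.units_eq_one_or χ <;> obtain rfl | rfl := Int.units_eq_one_or χ'
  · exact h4
  · simpa using h5
  · have := neg_mem h5
    simpa using this
  · have := neg_mem h4
    simpa using this

/-- Flipping neighbouring signs at equal exponents, which are adjacent in a decreasing word, matches
the letters one after another. -/
theorem wd_congr_of_signAt_eq (h2 : IsUnit (2 : R)) (q : ℕ) (ε : ℤˣ) {l l' : List (ℤ × ℤˣ)}
    (hl : l.IsChain descends) (hfst : l.map Prod.fst = l'.map Prod.fst)
    (hs : ∀ i, signAt l i = signAt l' i) : wd R l - wd R l' ∈ relIdeal (relSymmetric R q ε) := by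
  induction l generalizing l' with
  | nil =>
    obtain rfl : l' = [] := by simpa using hfst.symm
    rw [sub_self]
    exact zero_mem _
  | cons x m ih =>
    obtain ⟨a, χ⟩ := x
    rcases l' with _ | ⟨⟨a', χ'⟩, m'⟩
    · simp at hfst
    · simp only [List.map_cons, List.cons.injEq] at hfst
      obtain ⟨rfl, hm⟩ := hfst
      have hcons : ∀ (m' : List (ℤ × ℤˣ)), m.map Prod.fst = m'.map Prod.fst →
          (∀ i, signAt m i = signAt m' i) →
          wd R ((a, χ) :: m) - wd R ((a, χ) :: m') ∈ relIdeal (relSymmetric R q ε) := by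
        intro m' h3 h4
        have h5 := mul_mem_relIdeal (ih hl.tail h3 h4) (wd R [(a, χ)]) 1
        rwa [mul_one, mul_sub, ← wd_cons, ← wd_cons] at h5
      by_cases hχ : χ = χ'
      · subst hχ
        refine hcons m' hm fun i => ?_
        have := hs i
        rw [signAt_cons, signAt_cons] at this
        exact mul_left_cancel this
      · obtain rfl : χ' = -χ := by
          obtain rfl | rfl := Int.units_eq_one_or χ <;>
            obtain rfl | rfl := Int.units_eq_one_or χ' <;> simp at hχ ⊢
        -- The total signs at a agree but the first letters differ, so the tails differ at a. Hence
        -- a occurs again, and by monotonicity in the very next letter.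
        have hne : signAt m a ≠ signAt m' a := by
          intro he
          have := hs a
          simp only [signAt_cons, if_true, he, mul_left_inj] at this
          exact hχ this
        rcases m' with _ | ⟨⟨b, ψ⟩, m''⟩
        · obtain rfl : m = [] := by simpa using hm
          exact absurd rfl hne
        · obtain rfl : b = a := by
            by_contra hb
            apply hne
            have hpw : (a :: b :: m''.map Prod.fst).Pairwise fun a b : ℤ => b ≤ a := by
              have h3 : (((a, χ) :: m).map Prod.fst).Pairwise fun a b : ℤ => b ≤ a :=
                List.pairwise_map.mpr (List.isChain_iff_pairwise.mp hl)
              rwa [List.map_cons, hm] at h3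
            simp only [List.pairwise_cons, List.mem_cons, forall_eq_or_imp] at hpw
            have hlt : ∀ n : List (ℤ × ℤˣ), n.map Prod.fst = b :: m''.map Prod.fst →
                signAt n a = 1 := by
              intro n hn
              apply List.prod_eq_one
              intro y hy
              obtain ⟨x, hx, rfl⟩ := List.mem_map.mp hy
              rw [if_neg]
              intro hxa
              have h3 : a ∈ b :: m''.map Prod.fst := hn ▸ hxa ▸ List.mem_map_of_mem hx
              rcases List.mem_cons.mp h3 with h3 | h3
              · exact hb h3.symm
              · exact hb (le_antisymm hpw.1.1 (hpw.2.1 a h3))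
            rw [hlt m (by simpa using hm), hlt _ rfl]
          -- Flipping the first two signs of the second word makes its first letter agree with that
          -- of the first word.
          have h6 := mul_mem_relIdeal (wd_neg_neg_congr h2 q ε b (-χ) ψ) 1 (wd R m'')
          rw [one_mul, neg_neg, sub_mul, ← wd_append, ← wd_append] at h6
          have h7 := hcons ((b, -ψ) :: m'') (by simpa using hm) fun i => by
            have := hs i
            simp only [signAt_cons] at this ⊢
            by_cases hi : b = i
            · simp only [hi, if_true] at this ⊢
              apply mul_left_cancel (a := χ)
              rw [this, neg_mul, neg_mul, mul_neg]
            · simpa only [hi, if_false, one_mul] using this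
          have h8 := sub_mem h7 h6
          convert h8 using 1
          simp

/-- Flipping both signs preserves the data, whereas the product of the two characters changes sign,
so the four terms cancel in pairs. -/
theorem dataMap_mul_pairSigma_mul {r : ℕ} (a : ℤ) (s : ℤˣ) (x y : TypRing R ℤˣ) :
    dataMap R ℤˣ r (x * pairSigma R a s a (-s) * y) = 0 := by
  have hflip : ∀ (u w : List (ℤ × ℤˣ)) (χ χ' : ℤˣ),
      dataMap R ℤˣ r (wd R u * wd R [(a, -χ), (a, -χ')] * wd R w) =
      dataMap R ℤˣ r (wd R u * wd R [(a, χ), (a, χ')] * wd R w) := by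
    intro u w χ χ'
    rw [← wd_append, ← wd_append, ← wd_append, ← wd_append]
    apply dataMap_wd_congr
    · simp
    · intro i
      simp only [signAt_append, signAt_cons, signAt_nil]
      split_ifs <;> simp
  have key : ∀ u w : List (ℤ × ℤˣ),
      dataMap R ℤˣ r (wd R u * pairSigma R a s a (-s) * wd R w) = 0 := by
    intro u w
    have h1 := hflip u w 1 1
    have h3 := hflip u w 1 (-1)
    rw [neg_neg] at h3
    obtain rfl | rfl := Int.units_eq_one_or s
    · rw [pairSigma_self_one]
      simp only [mul_add, mul_sub, add_mul, sub_mul, map_add, map_sub, h1, h3]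
      abel
    · rw [neg_neg, pairSigma_self_neg_one]
      simp only [mul_add, mul_sub, add_mul, sub_mul, map_add, map_sub, h1, h3]
      abel
  have h1 : ∀ u : List (ℤ × ℤˣ), dataMap R ℤˣ r ∘ₗ
      LinearMap.mulLeft R (wd R u * pairSigma R a s a (-s)) = 0 := fun u =>
    linearMap_ext_wd fun w => key u w
  have h3 : dataMap R ℤˣ r ∘ₗ LinearMap.mulRight R (pairSigma R a s a (-s) * y) = 0 :=
    linearMap_ext_wd fun u => by
      have := LinearMap.congr_fun (h1 u) y
      simpa [mul_assoc] using this
  have := LinearMap.congr_fun h3 x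
  simpa [mul_assoc] using this

theorem isChain_descends_congr {S : Type} {l l' : List (ℤ × S)}
    (h : l'.map Prod.fst = l.map Prod.fst) (hl : l.IsChain descends) : l'.IsChain descends := by
  have h1 : ∀ m : List (ℤ × S), m.IsChain descends ↔
      (m.map Prod.fst).IsChain fun a b : ℤ => b ≤ a := by
    intro m
    rw [List.isChain_map]
    rfl
  rw [h1, h, ← h1]
  exact hl

theorem descends_of_descendsSym (a b : ℤ × ℤˣ) (h : descendsSym a b) : descends a b := by
  rcases h with h | h
  · exact h.le
  · exact h.1.le

/-- The map σ passes to characters, takes the normal form, returns to signs and reads off the data.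
-/
theorem exists_straightening_relSymmetric (h2 : IsUnit (2 : R)) (q : ℕ) (ε : ℤˣ) (r : ℕ) :
    ∃ str : ((Typ ℤˣ r →₀ R) ⧸ relPart R (relSymmetric R q ε) r) ≃ₗ[R] (TypZeroOfRank ℤˣ r →₀ R),
      IsStraightening str.toLinearMap ∧ ∀ f, IsStraightening f → f = str.toLinearMap := by
  obtain ⟨ν, hν, -, hn⟩ := sym_hasNormalForm (q : R) ε
  obtain ⟨c, hc⟩ := h2.exists_left_inv
  have hB : ∀ {x}, x ∈ relIdeal (symGens R (q : R) ε) →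
      fourier (1 : R) x ∈ relIdeal (relSymmetric R q ε) :=
    map_mem_relIdeal _ (fourier_mem_relIdeal_relSymmetric h2 q ε)
  have hA : ∀ {x}, x ∈ relIdeal (relSymmetric R q ε) →
      fourier c x ∈ relIdeal (symGens R (q : R) ε) := by
    refine map_mem_relIdeal _ fun g hg => ?_
    obtain ⟨g', hg', rfl⟩ := exists_fourier_eq q ε g hg
    rw [fourier_fourier (by rw [one_mul, hc])]
    exact subset_relIdeal hg'
  apply exists_straightening (σ := dataMap R ℤˣ r ∘ₗ (fourier (1 : R)).toLinearMap ∘ₗ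
    Finsupp.linearCombination R (wd R) ∘ₗ ν ∘ₗ (fourier c).toLinearMap)
  · intro v
    have h1 := fourier_wd_mem_span c (List.ofFn v)
    set P := Submodule.span R (wd R '' {l : List (ℤ × ℤˣ) | l.IsChain descends ∧ l.length = r}) ⊔
      relIdeal (relSymmetric R q ε) with hP
    have h3 : ∀ n : List (ℤ × ℤˣ), n.IsChain descendsSym → n.length = r →
        fourier (1 : R) (wd R n) ∈ P := by
      intro n hn hr
      refine Submodule.mem_sup_left (Submodule.span_mono (Set.image_mono fun l hl => ?_)
        (fourier_wd_mem_span 1 n))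
      exact ⟨isChain_descends_congr hl (hn.imp descends_of_descendsSym),
        by simpa [hr] using congrArg List.length hl⟩
    have h4 : Submodule.span R (wd R '' {l' | l'.map Prod.fst = (List.ofFn v).map Prod.fst}) ≤
        P.comap (fourier (1 : R)).toLinearMap := by
      rw [Submodule.span_le]
      rintro _ ⟨l', hl', rfl⟩
      have hlen : l'.length = r := by simpa using congrArg List.length hl'
      refine (sup_le ?_ fun x hx => Submodule.mem_sup_right (hB hx) :
        _ ≤ P.comap (fourier (1 : R)).toLinearMap)
        (wd_mem_span_sup_relIdeal (sym_straighten (q : R) ε) l')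
      rw [Submodule.span_le]
      rintro _ ⟨n, ⟨hn, hnl⟩, rfl⟩
      exact h3 n hn (hnl.trans hlen)
    have h5 := h4 h1
    rwa [Submodule.mem_comap, AlgHom.toLinearMap_apply,
      fourier_fourier (by rw [mul_one, hc])] at h5
  · intro v w hv hw h
    exact wd_congr_of_signAt_eq h2 q ε (isChain_ofFn_iff.mpr hv)
      (map_fst_eq_of_typData_eq hv hw h) (typData_eq_iff.mp h).2
  · intro x hx
    have : ν (fourier c x) = 0 := hν (hA hx)
    simp [this]
  · intro v hv
    -- On decreasing words in characters the normal form is invisible to the data: either the word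
    -- is normal, or it contains a pair (a, s), (a, -s), which is killed by ν on one side and by the
    -- data map on the other.
    have h1 : Set.EqOn (dataMap R ℤˣ r ∘ₗ (fourier (1 : R)).toLinearMap ∘ₗ
        Finsupp.linearCombination R (wd R) ∘ₗ ν) (dataMap R ℤˣ r ∘ₗ (fourier (1 : R)).toLinearMap)
        (wd R '' {l' | l'.map Prod.fst = (List.ofFn v).map Prod.fst}) := by
      rintro _ ⟨l, hl, rfl⟩
      simp only [LinearMap.comp_apply]
      by_cases hls : l.IsChain descendsSym
      · rw [hn l hls, Finsupp.linearCombination_single, one_smul]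
      · obtain ⟨u, x, y, w, rfl, hxy⟩ := exists_of_not_isChain hls
        have hd : descends x y := by
          have h3 := isChain_descends_congr hl (isChain_ofFn_iff.mpr hv)
          simpa using h3.infix ⟨u, w, rfl⟩
        obtain ⟨a, s⟩ := x
        obtain ⟨b, s'⟩ := y
        obtain ⟨rfl, rfl⟩ : b = a ∧ s' = -s := by
          simp only [descends, descendsSym, not_or, not_lt, not_and] at hd hxy
          have hba := le_antisymm hd hxy.1
          refine ⟨hba, ?_⟩
          have := hxy.2 hba
          obtain rfl | rfl := Int.units_eq_one_or s <;> obtain rfl | rfl := Int.units_eq_one_or s' <;>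
            simp at this ⊢
        have h3 : ν (wd R (u ++ [(b, s), (b, -s)] ++ w)) = 0 := by
          rw [wd_append, wd_append]
          exact hν (mul_mem_relIdeal (subset_relIdeal
            (Or.inl (Or.inl (Or.inl (Or.inr ⟨b, s, rfl⟩))))) _ _)
        rw [h3, map_zero, map_zero, map_zero, wd_append, wd_append, AlgHom.toLinearMap_apply,
          map_mul (fourier (1 : R)), map_mul (fourier (1 : R)), fourier_wd_pair,
          dataMap_mul_pairSigma_mul]
    have h3 := LinearMap.eqOn_span h1 (fourier_wd_mem_span c (List.ofFn v))
    refine Eq.trans h3 ?_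
    rw [LinearMap.comp_apply, AlgHom.toLinearMap_apply, fourier_fourier (by rw [mul_one, hc]),
      dataMap_wd_ofFn]

end Symmetric

end Straightening

theorem mainTheorem3 (p : ℕ) (hp : p.Prime)
    (F₀ : Type*) [Field F₀] [CharZero F₀] [ValuativeRel F₀] [TopologicalSpace F₀]
    [IsNonarchimedeanLocalField F₀] [CharP 𝓀[F₀] p]
    (R : Type*) [CommRing R] (r : ℕ) :
    -- the unramified Hermitian case
    (∃ str : ((Typ Unit r →₀ R) ⧸
          relPart R (relHermitian R (Nat.card 𝓀[F₀])) r) ≃ₗ[R]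
          (TypZeroOfRank Unit r →₀ R),
        IsStraightening str.toLinearMap ∧
          ∀ f, IsStraightening f → f = str.toLinearMap) ∧
    -- the symmetric case
    (p ≠ 2 → IsUnit (2 : R) →
      ∃ str : ((Typ ℤˣ r →₀ R) ⧸
          relPart R (relSymmetric R (Nat.card 𝓀[F₀])
            (sign 𝓀[F₀] (-1))) r) ≃ₗ[R] (TypZeroOfRank ℤˣ r →₀ R),
        IsStraightening str.toLinearMap ∧
          ∀ f, IsStraightening f → f = str.toLinearMap) ∧
    -- the alternating case
    (∃ str : ((Typ Unit r →₀ R) ⧸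
          relPart R (relAlternating R (Nat.card 𝓀[F₀])) r) ≃ₗ[R]
          (TypZeroOfRank Unit r →₀ R),
        IsStraightening str.toLinearMap ∧
          ∀ f, IsStraightening f → f = str.toLinearMap) := by
  refine ⟨?_, fun _ h2 => exists_straightening_relSymmetric h2 _ _ r, ?_⟩
  · rw [relHermitian_eq]
    exact exists_straightening_hlGens _ r
  · rw [relAlternating_eq]
    exact exists_straightening_hlGens _ r
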